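/- Let $S^2=\{x\in\mathbb R^3: |x|=1\}$ and let $M,N\subset S^2$ be the following two unions of $9$ disjoint circles. * $M$ consists of the equator $\{x\in S^2: x_3=0\}$ and the eight circles $\{x\in S^2: \varepsilon_1x_1+\varepsilon_2x_2+\varepsilon_3x_3=\tfrac32\}$, $\varepsilon\in\{1,-1\}^3$. (The equator separates two components of $S^2\setminus M$, each of which is a disc with four holes, and the remaining eight components are discs that fill the holes. Thus the dual tree of $M$, whose vertices are the components of $S^2\setminus M$ and whose edges are the circles, has two adjacent vertices of degree $5$ and eight leaves.) * $N$ consists of the nine circles $\{x\in S^2: x_i=c\}$, $i\in\{1,2,3\}$, $c\in\{\tfrac45,\tfrac56,\tfrac67\}$. (These are three disjoint nests of three concentric circles; the dual tree of $N$ consists of three paths with three edges each, issuing from a common vertex.) A *sphere in $\mathbb R^3$* is the image of a piecewise-linear embedding into $\mathbb R^3$ of the boundary of a tetrahedron. Two such spheres $S,T$ *intersect transversally* if every point of $S\cap T$ has an open neighbourhood $U$ in $\mathbb R^3$ with a homeomorphism $\varphi$ from $U$ onto an open subset of $\mathbb R^3$ such that $S\cap U=\{y\in U:\varphi(y)_1=0\}$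 and $T\cap U=\{y\in U:\varphi(y)_2=0\}$. A subset $A\subset S$ is *situated in $S$ as $A'\subset S'$ in $S'$* if there is a homeomorphism $S\to S'$ that maps $A$ onto $A'$. **Theorem 1.** There are no two spheres $S,T$ in $\mathbb R^3$ that intersect transversally and whose intersection $S\cap T$ is situated in $S$ as $M$ in $S^2$ and in $T$ as $N$ in $S^2$. -/

import Mathlib

/-- Euclidean three-space. -/
abbrev E3 : Type := EuclideanSpace ℝ (Fin 3)

/-- The boundary of the standard three-simplex: the standard piecewise-linear two-sphere. -/
def tetraBoundary : Set (Fin 4 → ℝ) :=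
  {x | x ∈ stdSimplex ℝ (Fin 4) ∧ ∃ i, x i = 0}

/-- `f` is piecewise linear on the set `P`: there is a finite simplicial complex with underlying
space `P` on each simplex of which `f` is affine. -/
def PiecewiseLinearOn {E F : Type*} [AddCommGroup E] [Module ℝ E] [AddCommGroup F] [Module ℝ F]
    (f : E → F) (P : Set E) : Prop :=
  ∃ K : Geometry.SimplicialComplex ℝ E, K.faces.Finite ∧ K.space = P ∧
    ∀ s ∈ K.faces, ∃ A : E →ᵃ[ℝ] F, Set.EqOn f A (convexHull ℝ (s : Set E))

/-- A (piecewise-linear) sphere in three-space: the image of a piecewise-linear embedding of the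
boundary of a tetrahedron. -/
def IsPLSphere (S : Set E3) : Prop :=
  ∃ f : (Fin 4 → ℝ) → E3, PiecewiseLinearOn f tetraBoundary ∧ Set.InjOn f tetraBoundary ∧
    f '' tetraBoundary = S

/-- Two surfaces in three-space intersect transversally: around each common point there are local
coordinates in which the two surfaces are two distinct coordinate planes. -/
def IntersectTransversally (S T : Set E3) : Prop :=
  ∀ x ∈ S ∩ T, ∃ φ : OpenPartialHomeomorph E3 E3, x ∈ φ.source ∧
    ∀ y ∈ φ.source, (y ∈ S ↔ φ y 0 = 0) ∧ (y ∈ T ↔ φ y 1 = 0)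

/-- `A` is situated in `S` as `A'` in `S'`: some homeomorphism from `S` to `S'` maps `A`
onto `A'` (where `A ⊆ S` and `A' ⊆ S'`). -/
def SituatedAs {X Y : Type*} [TopologicalSpace X] [TopologicalSpace Y]
    (S A : Set X) (S' A' : Set Y) : Prop :=
  ∃ h : S ≃ₜ S', h '' {x | (x : X) ∈ A} = {y | (y : Y) ∈ A'}

/-- The round unit sphere. -/
def S2 : Set E3 := Metric.sphere 0 1

/-- The section of the unit sphere by the plane of all `x` with `⟨u, x⟩ = c`
(a circle when `|c| < ‖u‖`). -/
def circleOn (u : E3) (c : ℝ) : Set E3 := {x | x ∈ S2 ∧ inner ℝ u x = c}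

/-- The union `M` of nine disjoint circles: the equator and eight small circles around the
directions `(±1, ±1, ±1)`, four of them in each open hemisphere. The complement has ten components:
the eight small discs and two discs with four holes that share the equator. -/
def circlesM : Set E3 :=
  circleOn !₂[0, 0, 1] 0 ∪
    ⋃ (a ∈ ({1, -1} : Set ℝ)) (b ∈ ({1, -1} : Set ℝ)) (c ∈ ({1, -1} : Set ℝ)),
      circleOn !₂[a, b, c] (3 / 2)

/-- The union `N` of nine disjoint circles: three concentric circles around each of the three
coordinate directions, the three outer discs being disjoint. The complement has ten components,
and its dual tree consists of three paths with three edges each that issue from one vertex. -/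
def circlesN : Set E3 :=
  ⋃ (i : Fin 3) (c ∈ ({4 / 5, 5 / 6, 6 / 7} : Set ℝ)), circleOn (EuclideanSpace.single i 1) c

open Set Filter Topology MeasureTheory Geometry

/-! ### Gluing local functions modulo two over a normed space -/

section LocalModels

variable {E : Type*} [NormedAddCommGroup E]

/-- On `U`, the function `w` agrees with the local models `m` near each point of `U`, up to a
constant and off the complement of `G`. -/
def IsLocalModel (G : Set E) (m : E → E → ZMod 2) (U : Set E) (w : E → ZMod 2) : Prop :=
  ∀ x ∈ U, ∃ c, ∀ᶠ z in 𝓝[G] x, w z = m x z + c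

variable {G : Set E} {m : E → E → ZMod 2} {U V : Set E} {w w' : E → ZMod 2}

theorem Dense.nhdsWithin_neBot' (hG : Dense G) (x : E) : (𝓝[G] x).NeBot :=
  mem_closure_iff_nhdsWithin_neBot.1 (hG x)

/-- A function whose germs along `H` at the points of a preconnected set are constant has the same
constant at all these points. -/
theorem IsPreconnected.exists_germ_eq {A H : Set E} (hA : IsPreconnected A)
    (hne : ∀ x ∈ A, (𝓝[H] x).NeBot) (h : ∀ x ∈ A, ∃ c, ∀ᶠ z in 𝓝[H] x, w z = c) :
    ∃ c, ∀ x ∈ A, ∀ᶠ z in 𝓝[H] x, w z = c := by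
  have key : ∀ x, ∃ d, x ∈ A → ∀ᶠ z in 𝓝[H] x, w z = d := by
    intro x
    by_cases hx : x ∈ A
    · obtain ⟨c, hc⟩ := h x hx
      exact ⟨c, fun _ => hc⟩
    · exact ⟨0, fun h => absurd h hx⟩
  choose d hd using key
  rcases A.eq_empty_or_nonempty with rfl | ⟨x₀, hx₀⟩
  · exact ⟨0, by simp⟩
  refine ⟨d x₀, fun x hx => ?_⟩
  have : d x = d x₀ := by
    refine hA.induction₂ (fun x y => d x = d y) ?_ ?_ ?_ hx hx₀
    · intro x hx
      have h2 : ∀ᶠ y in 𝓝 x, ∀ᶠ z in 𝓝[H] y, w z = d x := by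
        have := hd x hx
        rw [eventually_nhdsWithin_iff] at this
        filter_upwards [eventually_eventually_nhds.2 this] with y hy
        rwa [eventually_nhdsWithin_iff]
      filter_upwards [self_mem_nhdsWithin, nhdsWithin_le_nhds h2] with y hyA hy
      have := hne y hyA
      obtain ⟨z, hz1, hz2⟩ := (hy.and (hd y hyA)).exists
      exact hz1.symm.trans hz2
    · exact fun x y z _ _ _ h1 h2 => h1.trans h2
    · exact fun x y _ _ h => h.symm
  rw [← this]
  exact hd x hx

/-- The difference of two solutions has constant germs. Density of `G` makes each constant
unambiguous, and connectedness makes them all equal. -/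
theorem IsLocalModel.eq_add_const (hG : Dense G) (hc : IsPreconnected U)
    (hw : IsLocalModel G m U w) (hw' : IsLocalModel G m U w') :
    ∃ c, ∀ x ∈ U, ∀ᶠ z in 𝓝[G] x, w' z = w z + c := by
  obtain ⟨c, hc⟩ := hc.exists_germ_eq (w := fun z => w' z - w z) (H := G)
    (fun x _ => hG.nhdsWithin_neBot' x) (fun x hx => by
      obtain ⟨c, hc⟩ := hw x hx
      obtain ⟨c', hc'⟩ := hw' x hx
      refine ⟨c' - c, ?_⟩
      filter_upwards [hc, hc'] with z h1 h2
      rw [h1, h2]; ring)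
  refine ⟨c, fun x hx => ?_⟩
  filter_upwards [hc x hx] with z hz
  rw [← hz]; ring

theorem IsLocalModel.mono (hw : IsLocalModel G m U w) (h : V ⊆ U) : IsLocalModel G m V w :=
  fun x hx => hw x (h hx)

theorem IsLocalModel.add_const (hw : IsLocalModel G m U w) (d : ZMod 2) :
    IsLocalModel G m U (fun z => w z + d) := fun x hx => by
  obtain ⟨c, hc⟩ := hw x hx
  refine ⟨c + d, ?_⟩
  filter_upwards [hc] with z hz
  rw [hz]; ring

/-- Over a connected overlap two solutions differ by a single constant; subtracting it from the
second one makes them fit. -/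
theorem IsLocalModel.union (hG : Dense G) (hU : IsOpen U) (hV : IsOpen V)
    (hUV : IsPreconnected (U ∩ V)) (hw : IsLocalModel G m U w) (hw' : IsLocalModel G m V w') :
    ∃ w'', IsLocalModel G m (U ∪ V) w'' := by
  classical
  obtain ⟨c, hc⟩ := IsLocalModel.eq_add_const hG hUV (hw.mono inter_subset_left)
    (hw'.mono inter_subset_right)
  refine ⟨fun z => if z ∈ U then w z else w' z - c, ?_⟩
  rintro x (hx | hx)
  · obtain ⟨d, hd⟩ := hw x hx
    refine ⟨d, ?_⟩
    filter_upwards [hd, nhdsWithin_le_nhds (hU.mem_nhds hx)] with z hz hzU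
    rw [if_pos hzU, hz]
  · obtain ⟨d, hd⟩ := hw' x hx
    refine ⟨d - c, ?_⟩
    filter_upwards [hd, nhdsWithin_le_nhds (hV.mem_nhds hx), self_mem_nhdsWithin] with z hz hzV hzG
    by_cases hzU : z ∈ U
    · have := (hc z ⟨hzU, hzV⟩).self_of_nhdsWithin hzG
      rw [if_pos hzU]
      rw [this] at hz
      linear_combination hz
    · rw [if_neg hzU, hz]; ring

theorem exists_isLocalModel_ball
    (hm : ∀ x, ∀ᶠ y in 𝓝 x, ∃ c, ∀ᶠ z in 𝓝[G] y, m y z = m x z + c) (x : E) :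
    ∃ ε > 0, IsLocalModel G m (Metric.ball x ε) (m x) := by
  obtain ⟨ε, hε, h⟩ := Metric.eventually_nhds_iff_ball.1 (hm x)
  refine ⟨ε, hε, fun y hy => ?_⟩
  obtain ⟨c, hc⟩ := h y hy
  refine ⟨-c, ?_⟩
  filter_upwards [hc] with z hz
  rw [hz]; ring

variable [NormedSpace ℝ E]

/-- Continuation along the segment from the origin: a Lebesgue number gives balls of one radius on
which a solution exists, and these are attached one after the other. The overlaps are convex, hence
connected. -/
theorem exists_isLocalModel_thickening (hG : Dense G)
    (hm : ∀ x, ∀ᶠ y in 𝓝 x, ∃ c, ∀ᶠ z in 𝓝[G] y, m y z = m x z + c) (x : E) :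
    ∃ ε > 0, ∃ w, IsLocalModel G m (Metric.thickening ε (segment ℝ 0 x)) w := by
  have hcomp : IsCompact (segment ℝ 0 x) := by
    rw [segment_eq_image]
    exact isCompact_Icc.image (by fun_prop)
  choose r hr hrm using exists_isLocalModel_ball hm
  obtain ⟨δ, hδ, hδm⟩ := lebesgue_number_lemma_of_metric (c := fun y : E => Metric.ball y (r y))
    hcomp (fun y => Metric.isOpen_ball)
    (fun y _ => mem_iUnion.2 ⟨y, Metric.mem_ball_self (hr y)⟩)
  have hball : ∀ y ∈ segment ℝ 0 x, ∃ w, IsLocalModel G m (Metric.ball y δ) w := fun y hy => by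
    obtain ⟨i, hi⟩ := hδm y hy
    exact ⟨m i, (hrm i).mono hi⟩
  -- With steps of length at most `δ / 4`, the tube of radius `δ / 4` around the next step lies in
  -- the ball of radius `δ` around the point already reached.
  obtain ⟨n, hn⟩ := exists_nat_gt (‖x‖ / (δ / 4))
  have hn0 : (0 : ℝ) < n := lt_of_le_of_lt (by positivity) hn
  have hmem : ∀ t : ℝ, 0 ≤ t → t ≤ 1 → t • x ∈ segment ℝ 0 x := fun t h0 h1 =>
    ⟨1 - t, t, by linarith, h0, by ring, by simp⟩
  have main : ∀ k : ℕ, k ≤ n → ∃ w, IsLocalModel G m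
      (Metric.thickening (δ / 4) (segment ℝ 0 (((k : ℝ) / n) • x))) w := by
    intro k
    induction k with
    | zero =>
      intro _
      obtain ⟨w, hw⟩ := hball 0 (left_mem_segment _ _ _)
      refine ⟨w, hw.mono ?_⟩
      simp only [CharP.cast_eq_zero, zero_div, zero_smul, segment_same, Metric.thickening_singleton]
      exact Metric.ball_subset_ball (by linarith)
    | succ k ih =>
      intro hk
      obtain ⟨w, hw⟩ := ih (by omega)
      have hk' : (k : ℝ) + 1 ≤ n := by exact_mod_cast hk
      obtain ⟨w', hw'⟩ := hball (((k : ℝ) / n) • x)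
        (hmem _ (by positivity) (by rw [div_le_one hn0]; linarith))
      obtain ⟨w'', hw''⟩ := IsLocalModel.union hG Metric.isOpen_thickening Metric.isOpen_ball
        (((convex_segment _ _).thickening _).inter (convex_ball _ _)).isPreconnected hw hw'
      refine ⟨w'', hw''.mono ?_⟩
      intro z hz
      obtain ⟨y, hy, hzy⟩ := Metric.mem_thickening_iff.1 hz
      obtain ⟨a, b, ha, hb, hab, rfl⟩ := hy
      rw [smul_zero, zero_add, smul_smul] at hzy
      set t : ℝ := b * (((k + 1 : ℕ) : ℝ) / n) with ht
      have ht0 : 0 ≤ t := by positivity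
      have ht1 : t ≤ ((k : ℝ) + 1) / n := by
        rw [ht]; push_cast
        exact mul_le_of_le_one_left (by positivity) (by linarith)
      by_cases htk : t ≤ (k : ℝ) / n
      · left
        refine Metric.mem_thickening_iff.2 ⟨t • x, ?_, hzy⟩
        rcases eq_or_lt_of_le (show (0 : ℝ) ≤ (k : ℝ) / n by positivity) with h0 | h0
        · have : t = 0 := le_antisymm (by rw [h0]; exact htk) ht0
          rw [this, zero_smul]
          exact left_mem_segment _ _ _
        · refine ⟨1 - t / ((k : ℝ) / n), t / ((k : ℝ) / n), ?_, by positivity, by ring, ?_⟩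
          · rw [sub_nonneg, div_le_one h0]; exact htk
          · rw [smul_zero, zero_add, smul_smul, div_mul_cancel₀ _ h0.ne']
      · right
        push Not at htk
        have h1 : dist (t • x) (((k : ℝ) / n) • x) ≤ δ / 4 := by
          rw [dist_eq_norm, ← sub_smul, norm_smul, Real.norm_of_nonneg (by linarith)]
          have h2 : t - (k : ℝ) / n ≤ 1 / n := by
            have : ((k : ℝ) + 1) / n - k / n = 1 / n := by ring
            linarith
          calc (t - (k : ℝ) / n) * ‖x‖ ≤ 1 / n * ‖x‖ := by gcongr
            _ ≤ δ / 4 := by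
              rw [div_lt_iff₀ (by positivity)] at hn
              rw [one_div, inv_mul_le_iff₀ hn0]
              exact hn.le
        rw [Metric.mem_ball]
        calc dist z (((k : ℝ) / n) • x) ≤ dist z (t • x) + dist (t • x) (((k : ℝ) / n) • x) :=
              dist_triangle _ _ _
          _ < δ / 4 + δ / 4 + δ / 4 := by linarith
          _ ≤ δ := by linarith
  obtain ⟨w, hw⟩ := main n le_rfl
  rw [div_self hn0.ne', one_smul] at hw
  exact ⟨δ / 4, by linarith, w, hw⟩

/-- Coherent local models on a real normed space glue to a global function: the space is
contractible, so that every double covering of it is trivial. -/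
theorem exists_isLocalModel_univ (hG : Dense G)
    (hm : ∀ x, ∀ᶠ y in 𝓝 x, ∃ c, ∀ᶠ z in 𝓝[G] y, m y z = m x z + c) :
    ∃ w : E → ZMod 2, ∀ x, ∃ c, ∀ᶠ z in 𝓝[G] x, w z = m x z + c := by
  have h : ∀ x, ∃ ε > 0, ∃ w : E → ZMod 2, IsLocalModel G m (Metric.thickening ε (segment ℝ 0 x)) w ∧
      ∀ᶠ z in 𝓝[G] 0, w z = m 0 z := by
    intro x
    obtain ⟨ε, hε, w, hw⟩ := exists_isLocalModel_thickening hG hm x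
    obtain ⟨c, hc⟩ := hw 0 (Metric.self_subset_thickening hε _ (left_mem_segment _ _ _))
    refine ⟨ε, hε, _, hw.add_const (-c), ?_⟩
    filter_upwards [hc] with z hz
    rw [hz]; ring
  choose ε hε W hW hW0 using h
  -- Each point is evaluated with its own continuation, normalised to agree with `m 0` near the
  -- origin.
  refine ⟨fun z => W z z, fun x => ?_⟩
  have h0 : ∀ x, (0 : E) ∈ Metric.thickening (ε x) (segment ℝ 0 x) := fun x =>
    Metric.self_subset_thickening (hε x) _ (left_mem_segment _ _ _)
  have h1 : ∀ x, x ∈ Metric.thickening (ε x) (segment ℝ 0 x) := fun x =>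
    Metric.self_subset_thickening (hε x) _ (right_mem_segment _ _ _)
  obtain ⟨c, hc⟩ := hW x x (h1 x)
  refine ⟨c, ?_⟩
  filter_upwards [hc, nhdsWithin_le_nhds (Metric.isOpen_thickening.mem_nhds (h1 x)),
    self_mem_nhdsWithin] with z hz hzx hzG
  rw [← hz]
  -- The two convex tubes meet in a connected set containing the origin, where the normalisation
  -- forces the constant `d` to vanish.
  obtain ⟨d, hd⟩ := IsLocalModel.eq_add_const hG
    (((convex_segment _ _).thickening _).inter ((convex_segment _ _).thickening _)).isPreconnected
    ((hW x).mono (inter_subset_left (t := Metric.thickening (ε z) (segment ℝ 0 z))))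
    ((hW z).mono inter_subset_right)
  have := hG.nhdsWithin_neBot' 0
  obtain ⟨y, ⟨hy1, hy2⟩, hy3⟩ := ((hd 0 ⟨h0 x, h0 z⟩).and (hW0 x) |>.and (hW0 z)).exists
  have hd0 : d = 0 := by
    rw [hy2, hy3] at hy1
    exact (left_eq_add.1 hy1)
  have := (hd z ⟨hzx, h1 z⟩).self_of_nhdsWithin hzG
  rw [this, hd0, add_zero]

end LocalModels

/-! ### Two-sided surfaces and separation by a disc -/

section Sides

variable {E : Type*} [NormedAddCommGroup E]

/-- `w` tells the two sides of `X`: it is locally constant off `X`, and both of its values are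
attained off `X` arbitrarily near each point of `X`. -/
def IsSide (X : Set E) (w : E → ZMod 2) : Prop :=
  (∀ x ∉ X, ∀ᶠ y in 𝓝 x, w y = w x) ∧ ∀ x ∈ X, ∀ c, ∃ᶠ y in 𝓝 x, y ∉ X ∧ w y = c

variable {S T : Set E} {wS wT : E → ZMod 2}

theorem IsSide.dense_compl (hT : IsSide T wT) : Dense Tᶜ := fun x => by
  by_cases hx : x ∈ T
  · exact mem_closure_iff_frequently.2 ((hT.2 x hx 0).mono fun y hy => hy.1)
  · exact subset_closure hx

/-- The sides of `T` are open, so a dense set meets each of them wherever it accumulates. This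
allows the points of `S` to be discarded as well. -/
theorem IsSide.frequently (hT : IsSide T wT) {G : Set E} (hG : Dense G) {x : E}
    (hx : x ∈ T) (c : ZMod 2) : ∃ᶠ y in 𝓝[G] x, wT y = c := by
  rw [frequently_nhdsWithin_iff, frequently_iff]
  intro U hU
  obtain ⟨V, hVU, hV, hxV⟩ := mem_nhds_iff.1 hU
  obtain ⟨y, ⟨hy, hyc⟩, hyV⟩ := ((hT.2 x hx c).and_eventually (hV.mem_nhds hxV)).exists
  have := hG.nhdsWithin_neBot' y
  obtain ⟨z, ⟨hz1, hz2⟩, hz3⟩ := (((hT.1 y hy).and (hV.mem_nhds hyV)).filter_mono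
    (nhdsWithin_le_nhds (s := G)) |>.and self_mem_nhdsWithin).exists
  exact ⟨z, hVU hz2, hz1.trans hyc, hz3⟩

theorem ZMod.two_eq_add_one {a b : ZMod 2} (h : a ≠ b) : a = b + 1 := by
  revert a b; decide

theorem ZMod.two_add_self (a : ZMod 2) : a + a = 0 := by
  revert a; decide

theorem ZMod.two_add_one_ne (a : ZMod 2) : a + 1 ≠ a := by
  revert a; decide

variable [NormedSpace ℝ E]

/-- If a disc `D` in `S` lies on the side `β` of the closed connected surface `T` and its boundary
`C` divides `T` into `T₁` and `T₂`, then a connected set on the side `β` of `T` that misses `D`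
cannot accumulate both at `T₁` and at `T₂`. -/
theorem not_accumulate_both {C D T₁ T₂ v : Set E} {β : ZMod 2} {p q : E}
    (hS : IsSide S wS) (hT : IsSide T wT) (hSc : IsClosed S) (hTc : IsClosed T)
    (hTconn : IsPreconnected T) (hDS : D ⊆ S) (hDT : ∀ y ∈ D, y ∉ T)
    (hTu : T₁ ∪ T₂ ∪ C = T) (h12 : Disjoint T₁ T₂) (h1C : Disjoint T₁ C)
    (h2C : Disjoint T₂ C) (hDC : IsClosed (D ∪ C)) (hT1C : IsClosed (T₁ ∪ C))
    (hT2C : IsClosed (T₂ ∪ C)) (hSD : IsClosed (S \ D))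
    (hC : ∀ x ∈ C, ∃ α, ∀ᶠ y in 𝓝 x, (y ∈ S → y ∈ T → y ∈ C) ∧
      (y ∈ T → y ∉ S → (y ∈ T₁ ↔ wS y = α)) ∧ (y ∈ S → y ∉ T → (y ∈ D ↔ wT y = β)))
    (hacc : ∀ x ∈ C, ∃ᶠ y in 𝓝 x, y ∈ T₁ ∧ y ∉ S)
    (hv : IsPreconnected v) (hvT : ∀ y ∈ v, y ∉ T) (hvD : ∀ y ∈ v, y ∉ D)
    (hvβ : ∀ y ∈ v, wT y = β) (hp : p ∈ T₁) (hpv : p ∈ closure v) (hq : q ∈ T₂)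
    (hqv : q ∈ closure v) : False := by
  classical
  have hT1T : T₁ ⊆ T := fun y hy => hTu ▸ Or.inl (Or.inl hy)
  have hT2T : T₂ ⊆ T := fun y hy => hTu ▸ Or.inl (Or.inr hy)
  have hCT : C ⊆ T := fun y hy => hTu ▸ Or.inr hy
  have hTmem : ∀ y ∈ T, y ∉ T₁ → y ∉ C → y ∈ T₂ := fun y hy h1 h2 => by
    rw [← hTu] at hy
    exact hy.elim (fun h => h.resolve_left h1) (fun h => absurd h h2)
  have n12 := fun y (h1 : y ∈ T₁) (h2 : y ∈ T₂) => Set.disjoint_left.1 h12 h1 h2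
  have n1C := fun y (h1 : y ∈ T₁) (h2 : y ∈ C) => Set.disjoint_left.1 h1C h1 h2
  have n2C := fun y (h1 : y ∈ T₂) (h2 : y ∈ C) => Set.disjoint_left.1 h2C h1 h2
  set G : Set E := Sᶜ ∩ Tᶜ with hGdef
  have hG : Dense G := hS.dense_compl.inter_of_isOpen_left hT.dense_compl hSc.isOpen_compl
  have key : ∀ x, ∃ α, x ∈ C → ∀ᶠ y in 𝓝 x, (y ∈ S → y ∈ T → y ∈ C) ∧
      (y ∈ T → y ∉ S → (y ∈ T₁ ↔ wS y = α)) ∧ (y ∈ S → y ∉ T → (y ∈ D ↔ wT y = β)) := by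
    intro x
    by_cases hx : x ∈ C
    · obtain ⟨α, hα⟩ := hC x hx
      exact ⟨α, fun _ => hα⟩
    · exact ⟨0, fun h => absurd h hx⟩
  choose α hα using key
  -- Models for a function that jumps across `T₁ ∪ C ∪ D`. At `C` the product is the indicator of
  -- the quadrant between `T₁` and `D`: its factors are one exactly where `wS z = α x` (the side of
  -- `S` containing `T₁`) and where `wT z = β` (the side of `T` containing `D`).
  set m : E → E → ZMod 2 := fun x z =>
    if x ∈ C then (wS z + α x + 1) * (wT z + β + 1) else if x ∈ T₁ then wT z
      else if x ∈ D then wS z else 0 with hmdef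
  have mC : ∀ x ∈ C, ∀ z, m x z = (wS z + α x + 1) * (wT z + β + 1) := fun x hx z => if_pos hx
  have mT : ∀ x ∈ T₁, ∀ z, m x z = wT z := fun x hx z => by
    simp only [hmdef]
    rw [if_neg (n1C x hx), if_pos hx]
  have mD : ∀ x ∈ D, ∀ z, m x z = wS z := fun x hx z => by
    simp only [hmdef]
    rw [if_neg (fun h => hDT x hx (hCT h)), if_neg (fun h => hDT x hx (hT1T h)), if_pos hx]
  have m0 : ∀ x, x ∉ C → x ∉ T₁ → x ∉ D → ∀ z, m x z = 0 := fun x h1 h2 h3 z => by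
    simp only [hmdef]
    rw [if_neg h1, if_neg h2, if_neg h3]
  have sS : ∀ x ∉ S, ∀ᶠ y in 𝓝[G] x, wS y = wS x := fun x hx => nhdsWithin_le_nhds (hS.1 x hx)
  have sT : ∀ x ∉ T, ∀ᶠ y in 𝓝[G] x, wT y = wT x := fun x hx => nhdsWithin_le_nhds (hT.1 x hx)
  have hm : ∀ x, ∀ᶠ y in 𝓝 x, ∃ c, ∀ᶠ z in 𝓝[G] y, m y z = m x z + c := by
    intro x
    by_cases hxC : x ∈ C
    · have hαx := hα x hxC
      filter_upwards [hαx, eventually_eventually_nhds.2 hαx] with y ⟨hy1, hy2, hy3⟩ hyy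
      by_cases hyC : y ∈ C
      -- Points of `T₁` off `S` accumulate at `y`, and their side of `S` equals both constants.
      · have : α y = α x := by
          obtain ⟨z, ⟨hz1, hz2⟩, hz3, hz4⟩ := ((hacc y hyC).and_eventually (hyy.and (hα y hyC))).exists
          exact (((hz4.2.1 (hT1T hz1) hz2).1 hz1).symm.trans ((hz3.2.1 (hT1T hz1) hz2).1 hz1))
        exact ⟨0, Eventually.of_forall fun z => by rw [mC y hyC, mC x hxC, this, add_zero]⟩
      -- On `T₁` the first factor is one and the product is `wT` up to a constant; on the rest of
      -- `T` it vanishes. Likewise for `D` and the rest of `S` with the second factor. Off both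
      -- surfaces both factors are locally constant.
      by_cases hyT : y ∈ T
      · have hyS : y ∉ S := fun h => hyC (hy1 h hyT)
        by_cases hyT1 : y ∈ T₁
        · have h1 := (hy2 hyT hyS).1 hyT1
          refine ⟨β + 1, ?_⟩
          filter_upwards [sS y hyS] with z hz
          rw [mT y hyT1, mC x hxC, hz, h1]
          generalize α x = a, wT z = b
          clear * -
          revert a b β; decide
        · have h1 := ZMod.two_eq_add_one (mt (hy2 hyT hyS).2 hyT1)
          refine ⟨0, ?_⟩
          filter_upwards [sS y hyS] with z hz
          rw [m0 y hyC hyT1 (fun h => hDT y h hyT), mC x hxC, hz, h1]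
          generalize α x = a, wT z = b
          clear * -
          revert a b β; decide
      · by_cases hyS : y ∈ S
        · by_cases hyD : y ∈ D
          · have h1 := (hy3 hyS hyT).1 hyD
            refine ⟨α x + 1, ?_⟩
            filter_upwards [sT y hyT] with z hz
            rw [mD y hyD, mC x hxC, hz, h1]
            generalize α x = a, wS z = b
            clear * -
            revert a b β; decide
          · have h1 := ZMod.two_eq_add_one (mt (hy3 hyS hyT).2 hyD)
            refine ⟨0, ?_⟩
            filter_upwards [sT y hyT] with z hz
            rw [m0 y hyC (fun h => hyT (hT1T h)) hyD, mC x hxC, hz, h1]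
            generalize α x = a, wS z = b
            clear * -
            revert a b β; decide
        · have hyD : y ∉ D := fun h => hyS (hDS h)
          refine ⟨-m x y, ?_⟩
          filter_upwards [sS y hyS, sT y hyT] with z hz1 hz2
          rw [m0 y hyC (fun h => hyT (hT1T h)) hyD, mC x hxC, mC x hxC, hz1, hz2]
          ring
    by_cases hxT : x ∈ T₁
    · have hxD : x ∉ D ∪ C := fun h => h.elim (fun h => hDT x h (hT1T hxT)) hxC
      have hx2 : x ∉ T₂ ∪ C := fun h => h.elim (n12 x hxT) hxC
      filter_upwards [hDC.isOpen_compl.mem_nhds hxD, hT2C.isOpen_compl.mem_nhds hx2] with y hyD hy2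
      have hyC : y ∉ C := fun h => hyD (Or.inr h)
      by_cases hyT : y ∈ T
      · have hyT1 : y ∈ T₁ := by
          by_contra h
          exact hy2 (Or.inl (hTmem y hyT h hyC))
        exact ⟨0, Eventually.of_forall fun z => by rw [mT y hyT1, mT x hxT, add_zero]⟩
      · refine ⟨-wT y, ?_⟩
        filter_upwards [sT y hyT] with z hz
        rw [m0 y hyC (fun h => hyT (hT1T h)) (fun h => hyD (Or.inl h)), mT x hxT, hz]
        ring
    by_cases hxD : x ∈ D
    · have h1 : x ∉ S \ D := fun h => h.2 hxD
      filter_upwards [hTc.isOpen_compl.mem_nhds (hDT x hxD), hSD.isOpen_compl.mem_nhds h1]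
        with y hyT hyS
      by_cases hyD : y ∈ D
      · exact ⟨0, Eventually.of_forall fun z => by rw [mD y hyD, mD x hxD, add_zero]⟩
      · have hyS' : y ∉ S := fun h => hyS ⟨h, hyD⟩
        refine ⟨-wS y, ?_⟩
        filter_upwards [sS y hyS'] with z hz
        rw [m0 y (fun h => hyT (hCT h)) (fun h => hyT (hT1T h)) hyD, mD x hxD, hz]
        ring
    · have h1 : x ∉ D ∪ C := fun h => h.elim hxD hxC
      have h2 : x ∉ T₁ ∪ C := fun h => h.elim hxT hxC
      filter_upwards [hDC.isOpen_compl.mem_nhds h1, hT1C.isOpen_compl.mem_nhds h2] with y hy1 hy2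
      refine ⟨0, Eventually.of_forall fun z => ?_⟩
      rw [m0 x hxC hxT hxD, m0 y (fun h => hy1 (Or.inr h)) (fun h => hy2 (Or.inl h))
        (fun h => hy1 (Or.inl h)), add_zero]
  obtain ⟨w, hw⟩ := exists_isLocalModel_univ hG hm
  have hne : ∀ x, (𝓝[G] x).NeBot := fun x => hG.nhdsWithin_neBot' x
  -- On the side `β + 1` no jump occurs along `T`: at `C` the second factor vanishes there, at `T₁`
  -- the model `wT` is constant, and at `T₂` the model is zero. So one constant serves the whole
  -- connected `T`.
  obtain ⟨c, hc⟩ : ∃ c, ∀ t ∈ T, ∀ᶠ z in 𝓝[G ∩ {z | wT z = β + 1}] t, w z = c := by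
    refine hTconn.exists_germ_eq ?_ ?_
    · intro t ht
      rw [← mem_closure_iff_nhdsWithin_neBot, mem_closure_iff_frequently]
      have := hT.frequently hG ht (β + 1)
      rw [frequently_nhdsWithin_iff] at this
      exact this.mono fun y hy => ⟨hy.2, hy.1⟩
    · intro t ht
      obtain ⟨d, hd⟩ := hw t
      have hd' := nhdsWithin_mono t (inter_subset_left (s := G) (t := {z | wT z = β + 1})) hd
      by_cases htC : t ∈ C
      · refine ⟨d, ?_⟩
        filter_upwards [hd', self_mem_nhdsWithin] with z hz1 hz2
        rw [hz1, mC t htC, show wT z = β + 1 from hz2.2,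
          show β + 1 + β + 1 = 0 by generalize β = b; revert b; decide]
        ring
      by_cases ht1 : t ∈ T₁
      · refine ⟨β + 1 + d, ?_⟩
        filter_upwards [hd', self_mem_nhdsWithin] with z hz1 hz2
        rw [hz1, mT t ht1, show wT z = β + 1 from hz2.2]
      · refine ⟨d, ?_⟩
        filter_upwards [hd', self_mem_nhdsWithin] with z hz1 hz2
        rw [hz1, m0 t htC ht1 (fun h => hDT t h ht), zero_add]
  have hvne : ∀ y ∈ v, ∀ d, (∀ᶠ z in 𝓝[G] y, w z = m y z + d) → ∀ᶠ z in 𝓝[G] y, w z = d := by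
    intro y hy d hd
    filter_upwards [hd] with z hz
    rw [hz, m0 y (fun h => hvT y hy (hCT h)) (fun h => hvT y hy (hT1T h)) (hvD y hy), zero_add]
  obtain ⟨k, hk⟩ : ∃ k, ∀ y ∈ v, ∀ᶠ z in 𝓝[G] y, w z = k :=
    hv.exists_germ_eq (fun x _ => hne x) fun y hy => (hw y).imp fun d hd => hvne y hy d hd
  have hneT : ∀ t ∈ T, ∃ᶠ z in 𝓝[G] t, wT z = β + 1 := fun t ht => hT.frequently hG ht (β + 1)
  -- Close to a point of `T` approached by `v`, both sides of `T` are visible: `w = k` occurs on the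
  -- side of `v`, and `w = c` on the other.
  have near : ∀ t ∈ T, t ∈ closure v → ∀ P : E → Prop, (∀ᶠ z in 𝓝[G] t, P z) →
      (∃ z, P z ∧ w z = k ∧ wT z = β) ∧ ∃ z, P z ∧ w z = c ∧ wT z = β + 1 := by
    intro t ht htv P hP
    constructor
    · rw [eventually_nhdsWithin_iff] at hP
      obtain ⟨y, hy, hyv⟩ := ((mem_closure_iff_frequently.1 htv).and_eventually
        (eventually_eventually_nhds.2 hP)).exists
      rw [← eventually_nhdsWithin_iff] at hyv
      obtain ⟨z, ⟨hz1, hz2⟩, hz3⟩ := ((hyv.and (hk y hy)).and (sT y (hvT y hy))).exists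
      exact ⟨z, hz1, hz2, hz3.trans (hvβ y hy)⟩
    · have h1 := hc t ht
      rw [nhdsWithin_inter', eventually_inf_principal] at h1
      obtain ⟨z, hz1, hz2, hz3⟩ := ((hneT t ht).and_eventually (h1.and hP)).exists
      exact ⟨z, hz3, hz2 hz1, hz1⟩
  have hp' : ∃ d, ∀ᶠ z in 𝓝[G] p, w z = wT z + d := by
    obtain ⟨d, hd⟩ := hw p
    refine ⟨d, ?_⟩
    filter_upwards [hd] with z hz
    rw [hz, mT p hp]
  have hq' : ∃ d, ∀ᶠ z in 𝓝[G] q, w z = d := by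
    obtain ⟨d, hd⟩ := hw q
    refine ⟨d, ?_⟩
    filter_upwards [hd] with z hz
    rw [hz, m0 q (n2C q hq) (fun h => n12 q h hq) (fun h => hDT q h (hT2T hq)), zero_add]
  obtain ⟨d, hd⟩ := hp'
  obtain ⟨d', hd'⟩ := hq'
  -- At `p` the function `w` follows `wT`, so `k ≠ c`; at `q` it is locally constant, so `k = c`.
  obtain ⟨⟨z1, h1, h1k, h1T⟩, z2, h2, h2c, h2T⟩ := near p (hT1T hp) hpv _ hd
  obtain ⟨⟨z3, h3, h3k, -⟩, z4, h4, h4c, -⟩ := near q (hT2T hq) hqv _ hd'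
  have hck : c = k := by rw [← h3k, ← h4c, h3, h4]
  rw [h1T, h1k] at h1
  rw [h2T, h2c, hck, h1] at h2
  exact ZMod.two_add_one_ne (β + d) (by linear_combination -h2)

end Sides

/-! ### Sides in transversal coordinates -/

section Charts

variable {S T X : Set E3} {w : E3 → ZMod 2} {φ : OpenPartialHomeomorph E3 E3} {x : E3}

theorem IsSide.const_of_isPreconnected {E : Type*} [NormedAddCommGroup E] {X A : Set E}
    {w : E → ZMod 2} (hX : IsSide X w) (hA : IsPreconnected A) (hAX : ∀ y ∈ A, y ∉ X) :
    ∃ c, ∀ y ∈ A, w y = c := by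
  obtain ⟨c, hc⟩ := hA.exists_germ_eq (w := w) (H := univ)
    (fun y _ => by rw [nhdsWithin_univ]; infer_instance)
    (fun y hy => ⟨w y, by rw [nhdsWithin_univ]; exact hX.1 y (hAX y hy)⟩)
  refine ⟨c, fun y hy => ?_⟩
  have := hc y hy
  rw [nhdsWithin_univ] at this
  exact this.self_of_nhds

/-- Shrinking the chart to a round ball makes half-balls and half-discs convex, so that their
preimages are connected. -/
theorem exists_ball_chart (hx : x ∈ φ.source) {P : E3 → Prop} (hP : ∀ᶠ y in 𝓝 x, P y) :
    ∃ r > 0, Metric.ball (φ x) r ⊆ φ.target ∧ (∀ z ∈ Metric.ball (φ x) r, P (φ.symm z)) ∧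
      ∀ᶠ y in 𝓝 x, y ∈ φ.source ∧ φ y ∈ Metric.ball (φ x) r := by
  have h1 : ∀ᶠ z in 𝓝 (φ x), z ∈ φ.target := φ.open_target.mem_nhds (φ.map_source hx)
  have h2 : ∀ᶠ z in 𝓝 (φ x), P (φ.symm z) := by
    have := φ.continuousAt_symm (φ.map_source hx)
    rw [ContinuousAt, φ.left_inv hx] at this
    exact this.eventually hP
  obtain ⟨r, hr, h⟩ := Metric.eventually_nhds_iff_ball.1 (h1.and h2)
  refine ⟨r, hr, fun z hz => (h z hz).1, fun z hz => (h z hz).2, ?_⟩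
  filter_upwards [φ.open_source.mem_nhds hx,
    (φ.continuousAt hx).eventually (Metric.ball_mem_nhds (φ x) hr)] with y h1 h2
  exact ⟨h1, h2⟩

theorem convex_coord_pos (k : Fin 3) : Convex ℝ {z : E3 | 0 < z k} := by
  intro x hx y hy a b ha hb hab
  simp only [mem_ofPred_eq, PiLp.add_apply, PiLp.smul_apply, smul_eq_mul] at *
  rcases ha.eq_or_lt with rfl | ha
  · have : b = 1 := by linarith
    subst this; linarith
  · have := mul_pos ha hx
    have := mul_nonneg hb hy.le
    linarith

theorem convex_coord_neg (k : Fin 3) : Convex ℝ {z : E3 | z k < 0} := by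
  have h : {z : E3 | z k < 0} = -{z : E3 | 0 < z k} := by ext z; simp
  rw [h]
  exact (convex_coord_pos k).neg

theorem convex_coord_zero (k : Fin 3) : Convex ℝ {z : E3 | z k = 0} := by
  intro x hx y hy a b ha hb hab
  simp only [mem_ofPred_eq, PiLp.add_apply, PiLp.smul_apply, smul_eq_mul] at *
  rw [hx, hy]; ring

theorem isPreconnected_symm_image {A : Set E3} (hA : Convex ℝ A) (h : A ⊆ φ.target) :
    IsPreconnected (φ.symm '' A) :=
  hA.isPreconnected.image _ (φ.continuousOn_symm.mono h)

/-- In a chart where `X` is a coordinate plane, the two sides of `X` are the two sides of the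
plane. -/
theorem IsSide.chart {k : Fin 3} (hX : IsSide X w) (hx : x ∈ φ.source) (hxX : x ∈ X)
    (hφ : ∀ y ∈ φ.source, y ∈ X ↔ φ y k = 0) :
    ∃ α, ∀ᶠ y in 𝓝 x, y ∉ X → (w y = α ↔ 0 < φ y k) := by
  obtain ⟨r, hr, hrt, -, hev⟩ := exists_ball_chart hx (Eventually.of_forall fun _ => trivial)
  have hoff : ∀ z ∈ Metric.ball (φ x) r, z k ≠ 0 → φ.symm z ∉ X := fun z hz hzk h => by
    have := (hφ _ (φ.map_target (hrt hz))).1 h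
    rw [φ.right_inv (hrt hz)] at this
    exact hzk this
  obtain ⟨a, ha⟩ := hX.const_of_isPreconnected
    (isPreconnected_symm_image ((convex_ball (φ x) r).inter (convex_coord_pos k))
      (inter_subset_left.trans hrt)) (by
        rintro _ ⟨z, hz, rfl⟩
        exact hoff z hz.1 (ne_of_gt hz.2))
  obtain ⟨b, hb⟩ := hX.const_of_isPreconnected
    (isPreconnected_symm_image ((convex_ball (φ x) r).inter (convex_coord_neg k))
      (inter_subset_left.trans hrt)) (by
        rintro _ ⟨z, hz, rfl⟩
        exact hoff z hz.1 (ne_of_lt hz.2))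
  have hpos : ∀ y ∈ φ.source, φ y ∈ Metric.ball (φ x) r → 0 < φ y k → w y = a := fun y hy h1 h2 =>
    ha y ⟨φ y, ⟨h1, h2⟩, φ.left_inv hy⟩
  have hneg : ∀ y ∈ φ.source, φ y ∈ Metric.ball (φ x) r → φ y k < 0 → w y = b := fun y hy h1 h2 =>
    hb y ⟨φ y, ⟨h1, h2⟩, φ.left_inv hy⟩
  have hab : a ≠ b := by
    rintro rfl
    obtain ⟨y, ⟨hy1, hy2⟩, hy3, hy4⟩ := ((hX.2 x hxX (a + 1)).and_eventually hev).exists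
    have hy5 : w y = a := by
      rcases lt_trichotomy (φ y k) 0 with h | h | h
      · exact hneg y hy3 hy4 h
      · exact absurd ((hφ y hy3).2 h) hy1
      · exact hpos y hy3 hy4 h
    exact ZMod.two_add_one_ne a (hy2.symm.trans hy5)
  refine ⟨a, ?_⟩
  filter_upwards [hev] with y ⟨hy1, hy2⟩ hyX
  constructor
  · intro h
    rcases lt_trichotomy (φ y k) 0 with h' | h' | h'
    · exact absurd (h.symm.trans (hneg y hy1 hy2 h')) hab
    · exact absurd ((hφ y hy1).2 h') hyX
    · exact h'
  · exact hpos y hy1 hy2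

/-- Near a transversal intersection point, `S` meets both sides of `T`. -/
theorem IsSide.frequently_mem_of_chart {k l : Fin 3} (hkl : k ≠ l) (hT : IsSide T w)
    (hx : x ∈ φ.source) (hxS : x ∈ S) (hxT : x ∈ T) (hφS : ∀ y ∈ φ.source, y ∈ S ↔ φ y l = 0)
    (hφT : ∀ y ∈ φ.source, y ∈ T ↔ φ y k = 0) (c : ZMod 2) :
    ∃ᶠ y in 𝓝 x, y ∈ S ∧ y ∉ T ∧ w y = c := by
  obtain ⟨α, hα⟩ := hT.chart hx hxT hφT
  -- Moving along the axis `k` in the chart stays in `S`, because `l ≠ k`, and leaves `T` to either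
  -- side according to the sign of `t`.
  have ht : Tendsto (fun t : ℝ => φ x + t • EuclideanSpace.single k (1 : ℝ)) (𝓝 0) (𝓝 (φ x)) := by
    have : Continuous (fun t : ℝ => φ x + t • EuclideanSpace.single k (1 : ℝ)) := by fun_prop
    simpa using this.tendsto 0
  have ht' : Tendsto (fun t : ℝ => φ.symm (φ x + t • EuclideanSpace.single k (1 : ℝ))) (𝓝 0)
      (𝓝 x) := by
    have := φ.continuousAt_symm (φ.map_source hx)
    rw [ContinuousAt, φ.left_inv hx] at this
    exact this.comp ht
  have hsrc : ∀ᶠ t : ℝ in 𝓝 0, φ x + t • EuclideanSpace.single k (1 : ℝ) ∈ φ.target :=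
    ht.eventually (φ.open_target.mem_nhds (φ.map_source hx))
  have hl : φ x l = 0 := (hφS x hx).1 hxS
  have hk : φ x k = 0 := (hφT x hx).1 hxT
  have hev : ∀ᶠ t : ℝ in 𝓝 0, t ≠ 0 →
      φ.symm (φ x + t • EuclideanSpace.single k (1 : ℝ)) ∈ S ∧
      φ.symm (φ x + t • EuclideanSpace.single k (1 : ℝ)) ∉ T ∧
      (w (φ.symm (φ x + t • EuclideanSpace.single k (1 : ℝ))) = α ↔ 0 < t) := by
    filter_upwards [hsrc, ht'.eventually hα] with t h1 h2 ht0
    have h3 := φ.map_target h1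
    have hT' : φ.symm (φ x + t • EuclideanSpace.single k (1 : ℝ)) ∉ T := by
      rw [hφT _ h3, φ.right_inv h1]
      simpa [hk] using ht0
    refine ⟨?_, hT', ?_⟩
    · rw [hφS _ h3, φ.right_inv h1]
      simp [hl, hkl.symm]
    · rw [h2 hT', φ.right_inv h1]
      simp [hk]
  refine ht'.frequently ?_
  by_cases hc : c = α
  · have : ∃ᶠ t : ℝ in 𝓝 0, 0 < t :=
      (frequently_gt_nhds (0 : ℝ))
    refine (this.and_eventually hev).mono fun t ⟨h1, h2⟩ => ?_
    obtain ⟨h3, h4, h5⟩ := h2 h1.ne'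
    exact ⟨h3, h4, hc ▸ h5.2 h1⟩
  · have : ∃ᶠ t : ℝ in 𝓝 0, t < 0 := (frequently_lt_nhds (0 : ℝ))
    refine (this.and_eventually hev).mono fun t ⟨h1, h2⟩ => ?_
    obtain ⟨h3, h4, h5⟩ := h2 h1.ne
    refine ⟨h3, h4, ?_⟩
    rw [ZMod.two_eq_add_one hc]
    exact ZMod.two_eq_add_one (fun h => absurd (h5.1 h) (not_lt.2 h1.le))

/-- Near a transversal intersection point, two disjoint relatively open pieces of `T` that cover
`T \ S` and both accumulate there lie on different sides of `S`. -/
theorem IsSide.exists_mem_iff_of_chart {k l : Fin 3} {T₁ T₂ : Set E3} (hS : IsSide S w)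
    (hx : x ∈ φ.source) (hxS : x ∈ S) (hφS : ∀ y ∈ φ.source, y ∈ S ↔ φ y l = 0)
    (hφT : ∀ y ∈ φ.source, y ∈ T ↔ φ y k = 0)
    (hcov : ∀ᶠ y in 𝓝 x, y ∈ T → y ∉ S → y ∈ T₁ ∨ y ∈ T₂)
    (hdis : ∀ y ∈ T₁, y ∉ T₂)
    (ho₁ : ∀ y ∈ T₁, ∀ᶠ y' in 𝓝[T] y, y' ∈ T₁) (ho₂ : ∀ y ∈ T₂, ∀ᶠ y' in 𝓝[T] y, y' ∈ T₂)
    (hacc₁ : ∃ᶠ y in 𝓝 x, y ∈ T ∧ y ∉ S ∧ y ∈ T₁) (hacc₂ : ∃ᶠ y in 𝓝 x, y ∈ T ∧ y ∉ S ∧ y ∈ T₂) :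
    ∃ α, ∀ᶠ y in 𝓝 x, y ∈ T → y ∉ S → (y ∈ T₁ ↔ w y = α) := by
  obtain ⟨a, ha⟩ := hS.chart hx hxS hφS
  obtain ⟨r, hr, hrt, hrcov, hev⟩ := exists_ball_chart hx hcov
  -- A connected piece of `T \ S` in the chart is covered by two disjoint relatively open sets,
  -- hence lies in one of them. This is applied to the two half-discs of `T`.
  have hpre : ∀ A : Set E3, Convex ℝ A → A ⊆ Metric.ball (φ x) r → (∀ z ∈ A, z k = 0) →
      (∀ z ∈ A, z l ≠ 0) → (∀ z ∈ A, φ.symm z ∈ T₁) ∨ ∀ z ∈ A, φ.symm z ∈ T₂ := by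
    intro A hA hAb hAk hAl
    have hmT : ∀ z ∈ A, φ.symm z ∈ T := fun z hz => by
      rw [hφT _ (φ.map_target (hrt (hAb hz))), φ.right_inv (hrt (hAb hz))]
      exact hAk z hz
    have hmS : ∀ z ∈ A, φ.symm z ∉ S := fun z hz => by
      rw [hφS _ (φ.map_target (hrt (hAb hz))), φ.right_inv (hrt (hAb hz))]
      exact hAl z hz
    have hor : ∀ z ∈ A, φ.symm z ∈ T₁ ∨ φ.symm z ∈ T₂ := fun z hz =>
      hrcov z (hAb hz) (hmT z hz) (hmS z hz)
    have hPc := isPreconnected_symm_image (φ := φ) hA (hAb.trans hrt)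
    have hsub : φ.symm '' A ⊆ T := by
      rintro _ ⟨z, hz, rfl⟩; exact hmT z hz
    have hconst : ∀ y ∈ φ.symm '' A, ∀ y' ∈ φ.symm '' A, (y ∈ T₁ ↔ y' ∈ T₁) := by
      intro y hy y' hy'
      refine hPc.induction₂ (fun y y' => (y ∈ T₁ ↔ y' ∈ T₁)) ?_ ?_ ?_ hy hy'
      · rintro _ ⟨z, hz, rfl⟩
        rcases hor z hz with h | h
        · filter_upwards [nhdsWithin_mono _ hsub (ho₁ _ h)] with y' hy'
          exact iff_of_true h hy'
        · filter_upwards [nhdsWithin_mono _ hsub (ho₂ _ h)] with y' hy'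
          exact iff_of_false (fun h' => hdis _ h' h) (fun h' => hdis _ h' hy')
      · exact fun _ _ _ _ _ _ h1 h2 => h1.trans h2
      · exact fun _ _ _ _ h => h.symm
    by_cases h : ∃ z ∈ A, φ.symm z ∈ T₁
    · obtain ⟨z, hz, hz1⟩ := h
      exact Or.inl fun z' hz' => (hconst _ ⟨z, hz, rfl⟩ _ ⟨z', hz', rfl⟩).1 hz1
    · push Not at h
      exact Or.inr fun z hz => (hor z hz).resolve_left (h z hz)
  have hP := hpre (Metric.ball (φ x) r ∩ ({z | z k = 0} ∩ {z | 0 < z l}))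
    ((convex_ball _ _).inter ((convex_coord_zero k).inter (convex_coord_pos l))) inter_subset_left
    (fun z hz => hz.2.1) (fun z hz => ne_of_gt hz.2.2)
  have hN := hpre (Metric.ball (φ x) r ∩ ({z | z k = 0} ∩ {z | z l < 0}))
    ((convex_ball _ _).inter ((convex_coord_zero k).inter (convex_coord_neg l))) inter_subset_left
    (fun z hz => hz.2.1) (fun z hz => ne_of_lt hz.2.2)
  have hcase : ∀ y, y ∈ φ.source → φ y ∈ Metric.ball (φ x) r → y ∈ T → y ∉ S →
      φ y ∈ Metric.ball (φ x) r ∩ ({z | z k = 0} ∩ {z | 0 < z l}) ∨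
      φ y ∈ Metric.ball (φ x) r ∩ ({z | z k = 0} ∩ {z | z l < 0}) := by
    intro y h1 h2 h3 h4
    rcases lt_trichotomy (φ y l) 0 with h | h | h
    · exact Or.inr ⟨h2, (hφT y h1).1 h3, h⟩
    · exact absurd ((hφS y h1).2 h) h4
    · exact Or.inl ⟨h2, (hφT y h1).1 h3, h⟩
  obtain ⟨y₁, ⟨h11, h12, h13⟩, h14, h15⟩ := (hacc₁.and_eventually hev).exists
  obtain ⟨y₂, ⟨h21, h22, h23⟩, h24, h25⟩ := (hacc₂.and_eventually hev).exists
  have hc1 := hcase y₁ h14 h15 h11 h12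
  have hc2 := hcase y₂ h24 h25 h21 h22
  -- If both half-discs belonged to the same piece, the other piece could not accumulate at `x`.
  rcases hP with hP | hP <;> rcases hN with hN | hN
  · exfalso
    have := hc2.elim (hP _) (hN _)
    rw [φ.left_inv h24] at this
    exact hdis _ this h23
  · refine ⟨a, ?_⟩
    filter_upwards [ha, hev] with y hy1 ⟨hy2, hy3⟩ hyT hyS
    rw [hy1 hyS]
    rcases hcase y hy2 hy3 hyT hyS with h | h
    · have h' := hP _ h
      rw [φ.left_inv hy2] at h'
      exact iff_of_true h' h.2.2
    · have h' := hN _ h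
      rw [φ.left_inv hy2] at h'
      exact iff_of_false (fun h'' => hdis _ h'' h') (not_lt.2 (le_of_lt h.2.2))
  · refine ⟨a + 1, ?_⟩
    filter_upwards [ha, hev] with y hy1 ⟨hy2, hy3⟩ hyT hyS
    have hy1 := hy1 hyS
    rcases hcase y hy2 hy3 hyT hyS with h | h
    · have h' := hP _ h
      rw [φ.left_inv hy2] at h'
      refine iff_of_false (fun h'' => hdis _ h'' h') ?_
      rw [hy1.2 h.2.2]
      exact (ZMod.two_add_one_ne a).symm
    · have h' := hN _ h
      rw [φ.left_inv hy2] at h'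
      exact iff_of_true h' (ZMod.two_eq_add_one fun h'' =>
        absurd (hy1.1 h'') (not_lt.2 (le_of_lt h.2.2)))
  · exfalso
    have := hc1.elim (hP _) (hN _)
    rw [φ.left_inv h14] at this
    exact hdis _ h13 this

end Charts

/-! ### Parity of the simplices on `dim + 2` points that contain a point -/

section Weights

variable {E : Type*} [AddCommGroup E] [Module ℝ E]

theorem mem_affineSpan_of_weights {P : Finset E} {A : Set E} {w : E → ℝ}
    (h1 : ∑ y ∈ P, w y = 1) (hA : ∀ y ∈ P, y ∉ A → w y = 0) :
    ∑ y ∈ P, w y • y ∈ affineSpan ℝ A := by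
  have := affineCombination_mem_affineSpan_image h1 hA (id : E → E)
  rwa [P.affineCombination_eq_linear_combination _ _ h1, image_id] at this

/-- With weights on all of `P`, simplices that omit different vertices are compared within one space
of weights: omitting `a` means giving it weight zero. -/
theorem mem_convexHull_erase_iff [DecidableEq E] {P : Finset E} {a x : E} (ha : a ∈ P) :
    x ∈ convexHull ℝ (P.erase a : Set E) ↔
      ∃ w : E → ℝ, (∀ y ∈ P, 0 ≤ w y) ∧ ∑ y ∈ P, w y = 1 ∧ ∑ y ∈ P, w y • y = x ∧ w a = 0 := by
  rw [Finset.mem_convexHull']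
  constructor
  · rintro ⟨w, h0, h1, hx⟩
    refine ⟨fun y => if y = a then 0 else w y, ?_, ?_, ?_, if_pos rfl⟩
    · intro y hy
      dsimp only
      split_ifs with h
      · exact le_rfl
      · exact h0 y (Finset.mem_erase.2 ⟨h, hy⟩)
    · rw [← Finset.add_sum_erase _ _ ha, if_pos rfl, zero_add, ← h1]
      exact Finset.sum_congr rfl fun y hy => if_neg (Finset.ne_of_mem_erase hy)
    · rw [← Finset.add_sum_erase _ _ ha]
      beta_reduce
      rw [if_pos rfl, zero_smul, zero_add, ← hx]
      exact Finset.sum_congr rfl fun y hy => by rw [if_neg (Finset.ne_of_mem_erase hy)]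
  · rintro ⟨w, h0, h1, hx, hwa⟩
    refine ⟨w, fun y hy => h0 y (Finset.mem_of_mem_erase hy), ?_, ?_⟩
    · rw [← Finset.add_sum_erase _ _ ha, hwa, zero_add] at h1
      exact h1
    · rw [← Finset.add_sum_erase _ _ ha, hwa, zero_smul, zero_add] at hx
      exact hx

/-- Among the simplices spanned by all but one of `dim E + 2` points, an even number contains a
given point in general position. -/
theorem even_card_mem_convexHull_erase [DecidableEq E] [FiniteDimensional ℝ E] {P : Finset E}
    {x : E}
    (hP : P.card = Module.finrank ℝ E + 2)
    (hx : ∀ y ∈ P, ∀ z ∈ P, y ≠ z → x ∉ affineSpan ℝ ((P.erase y).erase z : Set E))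
    [DecidablePred fun y => x ∈ convexHull ℝ (P.erase y : Set E)] :
    Even (P.filter fun y => x ∈ convexHull ℝ (P.erase y : Set E)).card := by
  have hgen : ∀ w : E → ℝ, ∑ y ∈ P, w y = 1 → ∑ y ∈ P, w y • y = x → ∀ y ∈ P, ∀ z ∈ P,
      w y = 0 → w z = 0 → y = z := by
    intro w h1 hwx y hy z hz hwy hwz
    by_contra hyz
    refine hx y hy z hz hyz (hwx ▸ mem_affineSpan_of_weights h1 ?_)
    intro e he heA
    by_contra hne
    refine heA ?_
    simp only [Finset.coe_erase, Set.mem_sdiff, Finset.mem_coe, mem_singleton_iff]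
    exact ⟨⟨he, fun h => hne (h ▸ hwy)⟩, fun h => hne (h ▸ hwz)⟩
  rcases (P.filter fun y => x ∈ convexHull ℝ (P.erase y : Set E)).eq_empty_or_nonempty with h | h
  · rw [h]; simp
  obtain ⟨a, ha⟩ := h
  rw [Finset.mem_filter] at ha
  obtain ⟨haP, hax⟩ := ha
  obtain ⟨l, hl0, hl1, hlx, hla⟩ := (mem_convexHull_erase_iff haP).1 hax
  have hlpos : ∀ y ∈ P, y ≠ a → 0 < l y := fun y hy hya =>
    lt_of_le_of_ne (hl0 y hy) fun h => hya (hgen l hl1 hlx y hy a haP h.symm hla)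
  -- an affine dependency vanishing at `a` is trivial
  have hdep : ∀ m : E → ℝ, ∑ y ∈ P, m y = 0 → ∑ y ∈ P, m y • y = 0 → m a = 0 →
      ∀ y ∈ P, m y = 0 := by
    intro m h0 hm hma y hy
    by_contra hmy
    have hya : y ≠ a := fun h => hmy (h ▸ hma)
    refine hya (hgen (fun z => l z - l y / m y * m z) ?_ ?_ y hy a haP ?_ ?_)
    · rw [Finset.sum_sub_distrib, ← Finset.mul_sum, hl1, h0]; ring
    · simp only [sub_smul, mul_smul]
      rw [Finset.sum_sub_distrib, ← Finset.smul_sum, hlx, hm]; simp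
    · field_simp; ring
    · simp [hla, hma]
  obtain ⟨m, hm0, hmx, hma⟩ : ∃ m : E → ℝ, ∑ y ∈ P, m y = 0 ∧ ∑ y ∈ P, m y • y = 0 ∧ m a = 1 := by
    obtain ⟨m, hm, hm0, b, hb, hmb⟩ :=
      Module.exists_nontrivial_relation_sum_zero_of_finrank_succ_lt_card (R := ℝ) (t := P)
        (by omega)
    have hma : m a ≠ 0 := fun h => hmb (hdep m hm0 hm h b hb)
    refine ⟨fun y => (m a)⁻¹ * m y, ?_, ?_, inv_mul_cancel₀ hma⟩
    · rw [← Finset.mul_sum, hm0, mul_zero]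
    · simp only [mul_smul]
      rw [← Finset.smul_sum, hm, smul_zero]
  -- The weights that represent `x` form the line `l + t • m`, parametrised by the weight of `a`.
  -- Its nonnegative part is a segment, and only the two ends, where a weight vanishes, are counted.
  have hline : ∀ w : E → ℝ, ∑ y ∈ P, w y = 1 → ∑ y ∈ P, w y • y = x → ∀ y ∈ P,
      w y = l y + w a * m y := by
    intro w h1 hwx y hy
    have := hdep (fun z => w z - l z - w a * m z) ?_ ?_ ?_ y hy
    · linarith
    · rw [Finset.sum_sub_distrib, Finset.sum_sub_distrib, ← Finset.mul_sum, h1, hl1, hm0]; ring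
    · simp only [sub_smul, mul_smul]
      rw [Finset.sum_sub_distrib, Finset.sum_sub_distrib, ← Finset.smul_sum, hwx, hlx, hmx]; simp
    · simp [hla, hma]
  have hneg : (P.filter fun y => m y < 0).Nonempty := by
    by_contra h
    rw [Finset.not_nonempty_iff_eq_empty, Finset.filter_eq_empty_iff] at h
    have := (Finset.sum_eq_zero_iff_of_nonneg (fun y hy => not_lt.1 (h hy))).1 hm0 a haP
    rw [hma] at this
    exact one_ne_zero this
  -- The line leaves the nonnegative weights where the first of the decreasing weights reaches zero;
  -- this gives the second end.
  obtain ⟨b, hb, hbmin⟩ := Finset.exists_min_image _ (fun y => l y / (-m y)) hneg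
  rw [Finset.mem_filter] at hb
  obtain ⟨hbP, hmb⟩ := hb
  set t := l b / (-m b) with ht
  have hba : b ≠ a := fun h => by rw [h, hma] at hmb; linarith
  have htpos : 0 < t := div_pos (hlpos b hbP hba) (by linarith)
  have htb : l b + t * m b = 0 := by
    rw [ht, div_neg, neg_mul, div_mul_cancel₀ _ hmb.ne, add_neg_cancel]
  have htnn : ∀ y ∈ P, 0 ≤ l y + t * m y := by
    intro y hy
    rcases lt_or_ge (m y) 0 with h | h
    · have := hbmin y (Finset.mem_filter.2 ⟨hy, h⟩)
      rw [le_div_iff₀ (by linarith)] at this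
      linarith
    · exact add_nonneg (hl0 y hy) (mul_nonneg htpos.le h)
  have hbx : x ∈ convexHull ℝ (P.erase b : Set E) := by
    refine (mem_convexHull_erase_iff hbP).2 ⟨fun y => l y + t * m y, htnn, ?_, ?_, htb⟩
    · rw [Finset.sum_add_distrib, ← Finset.mul_sum, hl1, hm0]; ring
    · simp only [add_smul, mul_smul]
      rw [Finset.sum_add_distrib, ← Finset.smul_sum, hlx, hmx]; simp
  have hset : (P.filter fun y => x ∈ convexHull ℝ (P.erase y : Set E)) = {a, b} := by
    ext y
    simp only [Finset.mem_filter, Finset.mem_insert, Finset.mem_singleton]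
    constructor
    · rintro ⟨hy, hyx⟩
      obtain ⟨w, h0, h1, hwx, hwy⟩ := (mem_convexHull_erase_iff hy).1 hyx
      by_contra! hne
      have hl := hline w h1 hwx
      have h2 := hl y hy
      have h3 := hl b hbP
      have h4 := h0 a haP
      have h5 := hlpos y hy hne.1
      have h6 : m y < 0 := by
        by_contra h
        have := mul_nonneg h4 (not_lt.1 h)
        linarith
      have h7 : t ≤ w a := by
        have := hbmin y (Finset.mem_filter.2 ⟨hy, h6⟩)
        rw [le_div_iff₀ (by linarith)] at this
        by_contra h
        have := mul_lt_mul_of_pos_right (not_le.1 h) (neg_pos.2 h6)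
        linarith
      have h8 : w a ≤ t := by
        by_contra h
        have := mul_lt_mul_of_neg_right (not_le.1 h) hmb
        have := h0 b hbP
        linarith
      have h9 : w b = 0 := by rw [h3, le_antisymm h8 h7, htb]
      exact hne.2 (hgen w h1 hwx y hy b hbP hwy h9)
    · rintro (rfl | rfl)
      · exact ⟨haP, hax⟩
      · exact ⟨hbP, hbx⟩
  rw [hset, Finset.card_pair hba.symm]
  exact even_two

end Weights

/-! ### General position and tetrahedra in three-space -/

section General

theorem affineSpan_ne_top_of_card_le [DecidableEq E3] {s : Finset E3} (hs : s.card ≤ 3) :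
    affineSpan ℝ (s : Set E3) ≠ ⊤ := by
  rcases s.eq_empty_or_nonempty with rfl | hne
  · simp
  intro h
  have h1 : vectorSpan ℝ (s : Set E3) = ⊤ := by
    rw [← direction_affineSpan, h, AffineSubspace.direction_top]
  have h2 : s.card = (s.card - 1) + 1 := by have := hne.card_pos; omega
  have h3 := finrank_vectorSpan_image_finset_le ℝ (id : E3 → E3) s h2
  rw [Finset.image_id, h1, finrank_top, finrank_euclideanSpace_fin] at h3
  omega

/-- Finitely many planes do not cover a neighbourhood of any point. -/
theorem dense_forall_notMem_affineSpan [DecidableEq E3] (F : Finset (Finset E3))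
    (hF : ∀ s ∈ F, s.card ≤ 3) : Dense {x : E3 | ∀ s ∈ F, x ∉ affineSpan ℝ (s : Set E3)} := by
  refine Measure.dense_of_ae (μ := volume) ?_
  rw [eventually_all_finset]
  intro s hs
  have := Measure.addHaar_affineSubspace volume _ (affineSpan_ne_top_of_card_le (hF s hs))
  rw [ae_iff]
  simpa using this

/-- Off the boundary of a tetrahedron, belonging to the tetrahedron is a locally constant
property. -/
theorem eventually_mem_convexHull_iff [DecidableEq E3] {s : Finset E3} (hs : s.card = 4) {x : E3}
    (hx : ∀ a ∈ s, x ∉ convexHull ℝ (s.erase a : Set E3)) :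
    ∀ᶠ z in 𝓝 x, (z ∈ convexHull ℝ (s : Set E3) ↔ x ∈ convexHull ℝ (s : Set E3)) := by
  by_cases hxs : x ∈ convexHull ℝ (s : Set E3)
  swap
  · filter_upwards [(s.finite_toSet.isClosed_convexHull ℝ).isOpen_compl.mem_nhds hxs] with z hz
    exact iff_of_false hz hxs
  suffices h : x ∈ interior (convexHull ℝ (s : Set E3)) by
    filter_upwards [mem_interior_iff_mem_nhds.1 h] with z hz
    exact iff_of_true hz hxs
  have hind : AffineIndependent ℝ ((↑) : s → E3) := by
    rw [convexHull_eq_union] at hxs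
    simp only [mem_iUnion] at hxs
    obtain ⟨t, hts, hti, hxt⟩ := hxs
    rw [Finset.coe_subset] at hts
    rcases eq_or_ne t s with rfl | hne
    · exact hti
    · obtain ⟨a, ha, hat⟩ := Finset.exists_of_ssubset (hts.ssubset_of_ne hne)
      refine absurd (convexHull_mono ?_ hxt) (hx a ha)
      rw [Finset.coe_subset]
      exact fun y hy => Finset.mem_erase.2 ⟨fun h => hat (h ▸ hy), hts hy⟩
  have htop : affineSpan ℝ (range ((↑) : s → E3)) = ⊤ := by
    rw [hind.affineSpan_eq_top_iff_card_eq_finrank_add_one, finrank_euclideanSpace_fin,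
      Fintype.card_coe, hs]
  let b : AffineBasis s ℝ E3 := ⟨(↑), hind, htop⟩
  have hb : (s : Set E3) = range b := by
    change _ = range ((↑) : s → E3)
    simp
  rw [hb, b.interior_convexHull]
  intro i
  rw [hb, b.convexHull_eq_nonneg_coord] at hxs
  refine lt_of_le_of_ne (hxs i) fun h0 => hx i i.2 ?_
  rw [mem_convexHull_erase_iff i.2]
  classical
  refine ⟨fun y => if hy : y ∈ s then b.coord ⟨y, hy⟩ x else 0, ?_, ?_, ?_, ?_⟩
  · intro y hy
    simp only [hy, dif_pos]
    exact hxs ⟨y, hy⟩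
  · rw [← Finset.sum_coe_sort]
    simp only [Finset.coe_mem, dif_pos, Subtype.coe_eta]
    exact b.sum_coord_apply_eq_one x
  · rw [← Finset.sum_coe_sort]
    simp only [Finset.coe_mem, dif_pos, Subtype.coe_eta]
    exact b.linear_combination_coord_eq_self x
  · simp only [i.2, dif_pos]
    exact h0.symm

end General

/-! ### Cone parity of a mod 2 cycle of triangles -/

open scoped Classical in
/-- A finite set of triangles in three-space that meet properly and of which an even number contain
any given edge. -/
structure IsTriangulatedCycle (𝒯 : Finset (Finset E3)) : Prop where
  card_eq : ∀ s ∈ 𝒯, s.card = 3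
  indep : ∀ s ∈ 𝒯, AffineIndependent ℝ ((↑) : s → E3)
  inter : ∀ s ∈ 𝒯, ∀ t ∈ 𝒯, convexHull ℝ (s : Set E3) ∩ convexHull ℝ (t : Set E3) ⊆
    convexHull ℝ (s ∩ t : Set E3)
  even : ∀ e : Finset E3, e.card = 2 → Even (𝒯.filter fun s => e ⊆ s).card

section Cycle

open scoped Classical in
/-- The number modulo two of triangles of `𝒯` whose cone from `o` contains `x`. -/
noncomputable def coneParity (𝒯 : Finset (Finset E3)) (o x : E3) : ZMod 2 :=
  ∑ s ∈ 𝒯, if x ∈ convexHull ℝ ((insert o s : Finset E3) : Set E3) then 1 else 0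

open scoped Classical in
/-- `o` is a cone point for which the cones over the edges of `𝒯` avoid `x`. -/
def IsGoodApex (𝒯 : Finset (Finset E3)) (o x : E3) : Prop :=
  (∀ s ∈ 𝒯, o ∉ s) ∧
    ∀ s ∈ 𝒯, ∀ a ∈ s, x ∉ convexHull ℝ ((insert o (s.erase a) : Finset E3) : Set E3)

/-- The union of the triangles in `𝒯`. -/
def triangleUnion (𝒯 : Finset (Finset E3)) : Set E3 := ⋃ s ∈ 𝒯, convexHull ℝ (s : Set E3)

variable {𝒯 : Finset (Finset E3)} {o o' x : E3}

theorem mem_triangleUnion : x ∈ triangleUnion 𝒯 ↔ ∃ s ∈ 𝒯, x ∈ convexHull ℝ (s : Set E3) := by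
  simp [triangleUnion]

theorem isClosed_convexHull_finset (s : Finset E3) : IsClosed (convexHull ℝ (s : Set E3)) :=
  s.finite_toSet.isClosed_convexHull ℝ

theorem isClosed_triangleUnion (𝒯 : Finset (Finset E3)) : IsClosed (triangleUnion 𝒯) :=
  𝒯.finite_toSet.isClosed_biUnion fun s _ => isClosed_convexHull_finset s

theorem IsGoodApex.eventually (h : IsGoodApex 𝒯 o x) : ∀ᶠ z in 𝓝 x, IsGoodApex 𝒯 o z := by
  have : ∀ᶠ z in 𝓝 x, ∀ s ∈ 𝒯, ∀ a ∈ s,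
      z ∉ convexHull ℝ ((insert o (s.erase a) : Finset E3) : Set E3) := by
    rw [eventually_all_finset]
    intro s hs
    rw [eventually_all_finset]
    intro a ha
    exact (isClosed_convexHull_finset _).isOpen_compl.mem_nhds (h.2 s hs a ha)
  exact this.mono fun z hz => ⟨h.1, hz⟩

-- The faces of the cone are the triangle, which avoids `x` by `hx`, and the cones over its edges,
-- which avoid `x` since the apex is good.
open scoped Classical in
theorem IsTriangulatedCycle.eventually_mem_cone_iff (hT : IsTriangulatedCycle 𝒯)
    (h : IsGoodApex 𝒯 o x) {s : Finset E3} (hs : s ∈ 𝒯) (hx : x ∉ convexHull ℝ (s : Set E3)) :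
    ∀ᶠ z in 𝓝 x, (z ∈ convexHull ℝ ((insert o s : Finset E3) : Set E3) ↔
      x ∈ convexHull ℝ ((insert o s : Finset E3) : Set E3)) := by
  refine eventually_mem_convexHull_iff ?_ ?_
  · rw [Finset.card_insert_of_notMem (h.1 s hs), hT.card_eq s hs]
  · intro a ha
    rcases Finset.mem_insert.1 ha with rfl | ha'
    · rwa [Finset.erase_insert (h.1 s hs)]
    · have : o ≠ a := fun h' => h.1 s hs (h' ▸ ha')
      rw [Finset.erase_insert_of_ne this]
      exact h.2 s hs a ha'

theorem IsTriangulatedCycle.eventually_coneParity_eq (hT : IsTriangulatedCycle 𝒯)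
    (h : IsGoodApex 𝒯 o x) (hx : x ∉ triangleUnion 𝒯) :
    ∀ᶠ z in 𝓝 x, coneParity 𝒯 o z = coneParity 𝒯 o x := by
  classical
  have : ∀ᶠ z in 𝓝 x, ∀ s ∈ 𝒯, (z ∈ convexHull ℝ ((insert o s : Finset E3) : Set E3) ↔
      x ∈ convexHull ℝ ((insert o s : Finset E3) : Set E3)) := by
    rw [eventually_all_finset]
    intro s hs
    exact hT.eventually_mem_cone_iff h hs fun h' => hx (mem_triangleUnion.2 ⟨s, hs, h'⟩)
  filter_upwards [this] with z hz
  unfold coneParity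
  exact Finset.sum_congr rfl fun s hs => by simp only [hz s hs]

/-- The boundary of the cycle vanishes modulo two: after exchanging the sums, each edge is counted
once for every triangle containing it, an even number of times. -/
theorem IsTriangulatedCycle.sum_edges_eq_zero (hT : IsTriangulatedCycle 𝒯)
    [DecidableEq E3] (h : Finset E3 → ZMod 2) : ∑ s ∈ 𝒯, ∑ a ∈ s, h (s.erase a) = 0 := by
  have h1 : ∀ s ∈ 𝒯, ∑ a ∈ s, h (s.erase a) = ∑ e ∈ s.powersetCard 2, h e := by
    intro s hs
    refine Finset.sum_bij (fun a _ => s.erase a) ?_ ?_ ?_ ?_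
    · intro a ha
      rw [Finset.mem_powersetCard]
      exact ⟨Finset.erase_subset _ _, by rw [Finset.card_erase_of_mem ha, hT.card_eq s hs]⟩
    · intro a ha b hb hab
      by_contra hne
      have : b ∈ s.erase a := Finset.mem_erase.2 ⟨Ne.symm hne, hb⟩
      rw [hab] at this
      exact Finset.notMem_erase b s this
    · intro e he
      rw [Finset.mem_powersetCard] at he
      have : (s \ e).card = 1 := by rw [Finset.card_sdiff_of_subset he.1, hT.card_eq s hs, he.2]
      obtain ⟨a, ha⟩ := Finset.card_eq_one.1 this
      have hae : a ∈ s \ e := ha ▸ Finset.mem_singleton_self a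
      refine ⟨a, (Finset.mem_sdiff.1 hae).1, ?_⟩
      rw [← Finset.sdiff_singleton_eq_erase, ← ha, Finset.sdiff_sdiff_eq_self he.1]
    · exact fun _ _ => rfl
  set U : Finset (Finset E3) := 𝒯.biUnion fun s => s.powersetCard 2 with hU
  have h2 : ∀ s ∈ 𝒯, ∑ e ∈ s.powersetCard 2, h e = ∑ e ∈ U, if e ⊆ s then h e else 0 := by
    intro s hs
    rw [← Finset.sum_filter]
    refine Finset.sum_congr ?_ fun _ _ => rfl
    ext e
    simp only [hU, Finset.mem_filter, Finset.mem_biUnion, Finset.mem_powersetCard]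
    constructor
    · exact fun he => ⟨⟨s, hs, he⟩, he.1⟩
    · rintro ⟨⟨s', -, -, he⟩, hes⟩
      exact ⟨hes, he⟩
  rw [Finset.sum_congr rfl h1, Finset.sum_congr rfl h2, Finset.sum_comm]
  refine Finset.sum_eq_zero fun e he => ?_
  obtain ⟨s, -, hes⟩ := Finset.mem_biUnion.1 he
  rw [← Finset.sum_filter, Finset.sum_const]
  have := hT.even e (Finset.mem_powersetCard.1 hes).2
  obtain ⟨k, hk⟩ := this
  have h3 : (𝒯.filter fun s => e ⊆ s).card = k + k := by convert hk
  rw [h3, add_nsmul]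
  exact ZMod.two_add_self _

/-- The cone parity does not depend on the apex. -/
theorem IsTriangulatedCycle.coneParity_eq_of_generic [DecidableEq E3] (hT : IsTriangulatedCycle 𝒯)
    (ho : ∀ s ∈ 𝒯, o ∉ s) (ho' : ∀ s ∈ 𝒯, o' ∉ s) (hoo' : o ≠ o')
    (hx : ∀ s ∈ 𝒯, ∀ e ∈ (insert o (insert o' s)).powersetCard 3,
      x ∉ affineSpan ℝ (e : Set E3)) :
    coneParity 𝒯 o x = coneParity 𝒯 o' x := by
  classical
  let χ : Finset E3 → ZMod 2 := fun P => if x ∈ convexHull ℝ (P : Set E3) then 1 else 0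
  -- The five points `o`, `o'` and the vertices of `s` span five tetrahedra, an even number of which
  -- contain `x`. Summed over `s`, those with both apices cancel along the edges.
  have key : ∀ s ∈ 𝒯, χ (insert o' s) + (χ (insert o s) +
      ∑ a ∈ s, χ (insert o (insert o' (s.erase a)))) = 0 := by
    intro s hs
    have ho's := ho' s hs
    have hos : o ∉ insert o' s := fun h => (Finset.mem_insert.1 h).elim hoo' (ho s hs)
    have hcard : (insert o (insert o' s)).card = 5 := by
      rw [Finset.card_insert_of_notMem hos, Finset.card_insert_of_notMem ho's, hT.card_eq s hs]
    have hev := even_card_mem_convexHull_erase (P := insert o (insert o' s)) (x := x)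
      (by rw [hcard, finrank_euclideanSpace_fin]) (fun y hy z hz hyz => by
        have : ((insert o (insert o' s)).erase y).erase z ∈
            (insert o (insert o' s)).powersetCard 3 := by
          rw [Finset.mem_powersetCard]
          refine ⟨(Finset.erase_subset _ _).trans (Finset.erase_subset _ _), ?_⟩
          rw [Finset.card_erase_of_mem (Finset.mem_erase.2 ⟨hyz.symm, hz⟩),
            Finset.card_erase_of_mem hy, hcard]
        have := hx s hs _ this
        simpa using this)
    have hsum : ∑ y ∈ insert o (insert o' s), χ ((insert o (insert o' s)).erase y) = 0 := by
      have h1 : ∑ y ∈ insert o (insert o' s), χ ((insert o (insert o' s)).erase y) =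
          (((insert o (insert o' s)).filter fun y =>
            x ∈ convexHull ℝ ((insert o (insert o' s)).erase y : Set E3)).card : ZMod 2) := by
        rw [Finset.card_filter, Nat.cast_sum]
        refine Finset.sum_congr rfl fun y _ => ?_
        simp only [χ]
        split_ifs <;> simp
      rw [h1]
      exact (ZMod.natCast_eq_zero_iff_even).2 hev
    rw [Finset.sum_insert hos, Finset.sum_insert ho's, Finset.erase_insert hos,
      Finset.erase_insert_of_ne hoo', Finset.erase_insert ho's] at hsum
    rw [← hsum]
    congr 2
    refine Finset.sum_congr rfl fun a ha => ?_
    have hoa : o ≠ a := fun h => ho s hs (h ▸ ha)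
    have hoa' : o' ≠ a := fun h => ho's (h ▸ ha)
    rw [Finset.erase_insert_of_ne hoa, Finset.erase_insert_of_ne hoa']
  have hsum := Finset.sum_eq_zero key
  rw [Finset.sum_add_distrib, Finset.sum_add_distrib,
    hT.sum_edges_eq_zero (fun e => χ (insert o (insert o' e))), add_zero] at hsum
  have h1 : ∑ s ∈ 𝒯, χ (insert o s) = coneParity 𝒯 o x :=
    Finset.sum_congr rfl fun s _ => by congr!
  have h2 : ∑ s ∈ 𝒯, χ (insert o' s) = coneParity 𝒯 o' x :=
    Finset.sum_congr rfl fun s _ => by congr!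
  rw [h1, h2] at hsum
  generalize coneParity 𝒯 o x = a, coneParity 𝒯 o' x = b at hsum
  revert a b; decide

/-- The point `x` may be special for planes through `o` and `o'`. Both parities are locally
constant, so `x` can be replaced by a nearby generic point. -/
theorem IsTriangulatedCycle.coneParity_eq (hT : IsTriangulatedCycle 𝒯) (h : IsGoodApex 𝒯 o x)
    (h' : IsGoodApex 𝒯 o' x) (hx : x ∉ triangleUnion 𝒯) :
    coneParity 𝒯 o x = coneParity 𝒯 o' x := by
  classical
  rcases eq_or_ne o o' with rfl | hoo'
  · rfl
  have hd := dense_forall_notMem_affineSpan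
    (𝒯.biUnion fun s => (insert o (insert o' s)).powersetCard 3) (by
      intro e he
      obtain ⟨s, -, hes⟩ := Finset.mem_biUnion.1 he
      exact (Finset.mem_powersetCard.1 hes).2.le)
  obtain ⟨z, hz, hz1, hz2⟩ := ((mem_closure_iff_frequently.1 (hd x)).and_eventually
    ((hT.eventually_coneParity_eq h hx).and (hT.eventually_coneParity_eq h' hx))).exists
  rw [← hz1, ← hz2]
  exact hT.coneParity_eq_of_generic h.1 h'.1 hoo' fun s hs e he =>
    hz e (Finset.mem_biUnion.2 ⟨s, hs, he⟩)

/-- If `o` is off the planes through `x` and the edges of `𝒯`, and `x` is not on the edges, then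
`o` is a good apex for `x`. -/
theorem IsTriangulatedCycle.isGoodApex [DecidableEq E3] (hT : IsTriangulatedCycle 𝒯)
    (ho : ∀ s ∈ 𝒯, o ∉ s)
    (hx : ∀ s ∈ 𝒯, ∀ a ∈ s, x ∉ convexHull ℝ (s.erase a : Set E3))
    (hspan : ∀ s ∈ 𝒯, ∀ a ∈ s, o ∉ affineSpan ℝ ((insert x (s.erase a) : Finset E3) : Set E3)) :
    IsGoodApex 𝒯 o x := by
  refine ⟨ho, fun s hs a ha hxo => ?_⟩
  have hne : (s.erase a : Set E3).Nonempty := by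
    rw [Finset.coe_nonempty, ← Finset.card_pos, Finset.card_erase_of_mem ha, hT.card_eq s hs]
    norm_num
  have e1 : x ∈ convexHull ℝ (insert o (s.erase a : Set E3)) := by
    rw [← Finset.coe_insert]
    convert hxo
  rw [convexHull_insert hne, mem_convexJoin] at e1
  obtain ⟨p, hp, y, hy, b, c, hb, hc, hbc, hxy⟩ := e1
  rw [mem_singleton_iff.1 hp] at hxy
  rcases hb.eq_or_lt with rfl | hb
  · have hc1 : c = 1 := by linarith
    subst hc1
    rw [zero_smul, one_smul, zero_add] at hxy
    exact hx s hs a ha (hxy ▸ hy)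
  · refine hspan s hs a ha ?_
    have h1 : x ∈ affineSpan ℝ ((insert x (s.erase a) : Finset E3) : Set E3) :=
      subset_affineSpan _ _ (by simp)
    have h2 : y ∈ affineSpan ℝ ((insert x (s.erase a) : Finset E3) : Set E3) := by
      refine affineSpan_mono ℝ ?_ (convexHull_subset_affineSpan _ hy)
      rw [Finset.coe_insert]
      exact subset_insert _ _
    have h3 : o = AffineMap.lineMap y x b⁻¹ := by
      rw [AffineMap.lineMap_apply_module, ← hxy, smul_add, smul_smul, smul_smul,
        inv_mul_cancel₀ hb.ne', one_smul, show c = 1 - b by linarith]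
      have : b⁻¹ * (1 - b) = b⁻¹ - 1 := by field_simp
      rw [this]
      module
    rw [h3]
    exact AffineMap.lineMap_mem _ h2 h1

theorem IsTriangulatedCycle.exists_isGoodApex [DecidableEq E3] (hT : IsTriangulatedCycle 𝒯)
    (hx : ∀ s ∈ 𝒯, ∀ a ∈ s, x ∉ convexHull ℝ (s.erase a : Set E3)) :
    ∃ o, IsGoodApex 𝒯 o x ∧ ∀ s ∈ 𝒯, o ∉ affineSpan ℝ (s : Set E3) := by
  obtain ⟨o, ho⟩ := (dense_forall_notMem_affineSpan
    (𝒯 ∪ 𝒯.biUnion fun s => s.image fun a => insert x (s.erase a)) (by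
      intro e he
      rw [Finset.mem_union, Finset.mem_biUnion] at he
      rcases he with he | ⟨s, hs, he⟩
      · exact (hT.card_eq e he).le
      · obtain ⟨a, ha, rfl⟩ := Finset.mem_image.1 he
        refine (Finset.card_insert_le _ _).trans ?_
        rw [Finset.card_erase_of_mem ha, hT.card_eq s hs])).nonempty
  have ho1 : ∀ s ∈ 𝒯, o ∉ affineSpan ℝ (s : Set E3) := fun s hs =>
    ho s (Finset.mem_union_left _ hs)
  refine ⟨o, hT.isGoodApex (fun s hs h => ho1 s hs (subset_affineSpan _ _ h)) hx
    fun s hs a ha => ?_, ho1⟩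
  exact ho _ (Finset.mem_union_right _ (Finset.mem_biUnion.2 ⟨s, hs, Finset.mem_image_of_mem _ ha⟩))

/-- The parity of the number of cones jumps at interior points of triangles. -/
theorem IsTriangulatedCycle.frequently_coneParity [DecidableEq E3] (hT : IsTriangulatedCycle 𝒯)
    {s : Finset E3} (hs : s ∈ 𝒯) (hxs : x ∈ convexHull ℝ (s : Set E3))
    (hx : ∀ a ∈ s, x ∉ convexHull ℝ (s.erase a : Set E3)) (c : ZMod 2) :
    ∃ o, IsGoodApex 𝒯 o x ∧ ∃ᶠ z in 𝓝 x, z ∉ triangleUnion 𝒯 ∧ coneParity 𝒯 o z = c := by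
  classical
  -- Another triangle meets `s` only in a proper face of `s`, and `x` is off the edges of `s`. So
  -- near `x` only the cone over `s` can change its contribution.
  have hxt : ∀ t ∈ 𝒯, t ≠ s → x ∉ convexHull ℝ (t : Set E3) := by
    intro t ht hts hxt
    have hmem := hT.inter s hs t ht ⟨hxs, hxt⟩
    have : ¬ s ⊆ t := fun h => hts (Finset.eq_of_subset_of_card_le h
      (by rw [hT.card_eq s hs, hT.card_eq t ht])).symm
    obtain ⟨a, ha, hat⟩ := Finset.not_subset.1 this
    refine hx a ha (convexHull_mono ?_ hmem)
    rintro y ⟨hy1, hy2⟩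
    exact Finset.mem_coe.2 (Finset.mem_erase.2 ⟨fun h => hat (h ▸ hy2), hy1⟩)
  have hxe : ∀ t ∈ 𝒯, ∀ a ∈ t, x ∉ convexHull ℝ (t.erase a : Set E3) := by
    intro t ht a ha h
    rcases eq_or_ne t s with rfl | hts
    · exact hx a ha h
    · exact hxt t ht hts (convexHull_mono (by simp) h)
  obtain ⟨o, ho, hospan⟩ := hT.exists_isGoodApex hxe
  refine ⟨o, ho, ?_⟩
  have hxspan : x ∈ affineSpan ℝ (s : Set E3) := convexHull_subset_affineSpan _ hxs
  have hne : (s : Set E3).Nonempty := ⟨_, convexHull_nonempty_iff.1 ⟨x, hxs⟩ |>.some_mem⟩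
  set d : ZMod 2 := ∑ t ∈ 𝒯.erase s,
    if x ∈ convexHull ℝ ((insert o t : Finset E3) : Set E3) then 1 else 0 with hd
  have hother : ∀ᶠ z in 𝓝 x, (∀ t ∈ 𝒯.erase s, z ∉ convexHull ℝ (t : Set E3)) ∧
      ∑ t ∈ 𝒯.erase s, (if z ∈ convexHull ℝ ((insert o t : Finset E3) : Set E3)
        then (1 : ZMod 2) else 0) = d := by
    have h1 : ∀ᶠ z in 𝓝 x, ∀ t ∈ 𝒯.erase s, z ∉ convexHull ℝ (t : Set E3) := by
      rw [eventually_all_finset]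
      intro t ht
      exact (isClosed_convexHull_finset t).isOpen_compl.mem_nhds
        (hxt t (Finset.mem_of_mem_erase ht) (Finset.ne_of_mem_erase ht))
    have h2 : ∀ᶠ z in 𝓝 x, ∀ t ∈ 𝒯.erase s,
        (z ∈ convexHull ℝ ((insert o t : Finset E3) : Set E3) ↔
          x ∈ convexHull ℝ ((insert o t : Finset E3) : Set E3)) := by
      rw [eventually_all_finset]
      intro t ht
      convert hT.eventually_mem_cone_iff ho (Finset.mem_of_mem_erase ht)
        (hxt t (Finset.mem_of_mem_erase ht) (Finset.ne_of_mem_erase ht))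
    filter_upwards [h1, h2] with z hz1 hz2
    exact ⟨hz1, Finset.sum_congr rfl fun t ht => by simp only [hz2 t ht]⟩
  have hline : Tendsto (fun r : ℝ => AffineMap.lineMap x o r) (𝓝 0) (𝓝 x) := by
    have : Continuous (fun r : ℝ => (AffineMap.lineMap x o r : E3)) :=
      AffineMap.lineMap_continuous
    simpa using this.tendsto 0
  have hspan : ∀ r : ℝ, r ≠ 0 → AffineMap.lineMap x o r ∉ affineSpan ℝ (s : Set E3) := by
    intro r hr h
    refine hospan s hs ?_
    have : o = AffineMap.lineMap x (AffineMap.lineMap x o r : E3) r⁻¹ := by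
      simp only [AffineMap.lineMap_apply, vsub_eq_sub, vadd_eq_add, add_sub_cancel_right,
        smul_smul, inv_mul_cancel₀ hr, one_smul, sub_add_cancel]
    rw [this]
    exact AffineMap.lineMap_mem _ hxspan h
  have hin : ∀ r : ℝ, 0 < r → r < 1 →
      (AffineMap.lineMap x o r : E3) ∈ convexHull ℝ ((insert o s : Finset E3) : Set E3) := by
    intro r h0 h1
    have hsub : (s : Set E3) ⊆ ((insert o s : Finset E3) : Set E3) := by simp
    exact (convex_convexHull ℝ _).segment_subset (convexHull_mono hsub hxs)
      (subset_convexHull ℝ _ (show o ∈ ((insert o s : Finset E3) : Set E3) by simp))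
      (by rw [segment_eq_image_lineMap]; exact ⟨r, ⟨h0.le, h1.le⟩, rfl⟩)
  -- Beyond the triangle as seen from `o`: a point there that belonged to the cone would put `o`
  -- into the plane of `s`.
  have hout : ∀ r : ℝ, r < 0 →
      (AffineMap.lineMap x o r : E3) ∉ convexHull ℝ ((insert o s : Finset E3) : Set E3) := by
    intro r hr h
    rw [Finset.coe_insert, convexHull_insert hne, mem_convexJoin] at h
    obtain ⟨p, hp, y, hy, a, b, ha, hb, hab, hxy⟩ := h
    rw [mem_singleton_iff.1 hp] at hxy
    have hys := convexHull_subset_affineSpan _ hy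
    refine hospan s hs ?_
    have h1 : o = AffineMap.lineMap y x ((1 - r) / (a - r)) := by
      rw [AffineMap.lineMap_apply_module] at hxy ⊢
      have h2 : a - r ≠ 0 := by linarith
      have h3 : (a - r) • o = (1 - r) • x - b • y := by
        rw [sub_smul, ← sub_eq_zero]
        have := sub_eq_zero.2 hxy
        rw [← this]; module
      have h4 : 1 - (1 - r) / (a - r) = -b / (a - r) := by
        rw [eq_div_iff h2, sub_mul, div_mul_cancel₀ _ h2]; linarith
      rw [h4, ← inv_smul_smul₀ h2 o, h3]
      module
    rw [h1]
    exact AffineMap.lineMap_mem _ hys hxspan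
  have hval : ∀ᶠ r : ℝ in 𝓝 0, r ≠ 0 → AffineMap.lineMap x o r ∉ triangleUnion 𝒯 ∧
      coneParity 𝒯 o (AffineMap.lineMap x o r) = (if 0 < r then 1 else 0) + d := by
    filter_upwards [hline.eventually hother, gt_mem_nhds (zero_lt_one (α := ℝ))]
      with r ⟨h1, h2⟩ hr1 hr0
    constructor
    · intro h
      obtain ⟨t, ht, hrt⟩ := mem_triangleUnion.1 h
      rcases eq_or_ne t s with rfl | hts
      · exact hspan r hr0 (convexHull_subset_affineSpan _ hrt)
      · exact h1 t (Finset.mem_erase.2 ⟨hts, ht⟩) hrt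
    · have h3 : coneParity 𝒯 o (AffineMap.lineMap x o r) =
          (if (AffineMap.lineMap x o r : E3) ∈ convexHull ℝ ((insert o s : Finset E3) : Set E3)
            then 1 else 0) + ∑ t ∈ 𝒯.erase s,
          (if (AffineMap.lineMap x o r : E3) ∈ convexHull ℝ ((insert o t : Finset E3) : Set E3)
            then (1 : ZMod 2) else 0) := by
        rw [Finset.add_sum_erase _ (fun t => if (AffineMap.lineMap x o r : E3) ∈
          convexHull ℝ ((insert o t : Finset E3) : Set E3) then (1 : ZMod 2) else 0) hs]
        unfold coneParity
        congr!
      rw [h3, h2]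
      congr 1
      rcases lt_or_gt_of_ne hr0 with h | h
      · rw [if_neg (hout r h), if_neg (not_lt.2 h.le)]
      · rw [if_pos (hin r h hr1), if_pos h]
  refine hline.frequently ?_
  by_cases hc : c = d
  · refine ((frequently_lt_nhds (0 : ℝ)).and_eventually hval).mono fun r ⟨h1, h2⟩ => ?_
    refine ⟨(h2 h1.ne).1, ?_⟩
    rw [(h2 h1.ne).2, if_neg (not_lt.2 h1.le), hc, zero_add]
  · refine ((frequently_gt_nhds (0 : ℝ)).and_eventually hval).mono fun r ⟨h1, h2⟩ => ?_
    refine ⟨(h2 h1.ne').1, ?_⟩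
    rw [(h2 h1.ne').2, if_pos h1, ZMod.two_eq_add_one hc, add_comm]

/-- Every point of a nondegenerate triangle is a limit of points off its edges. -/
theorem frequently_notMem_edges [DecidableEq E3] {s : Finset E3} (hs : s.Nonempty)
    (hind : AffineIndependent ℝ ((↑) : s → E3)) (hx : x ∈ convexHull ℝ (s : Set E3)) :
    ∃ᶠ z in 𝓝 x, z ∈ convexHull ℝ (s : Set E3) ∧
      ∀ a ∈ s, z ∉ convexHull ℝ (s.erase a : Set E3) := by
  obtain ⟨w, h0, h1, hwx⟩ := Finset.mem_convexHull'.1 hx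
  set n : ℝ := (s.card : ℝ)⁻¹ with hn
  have hcard : (0 : ℝ) < s.card := by exact_mod_cast hs.card_pos
  have hnpos : 0 < n := inv_pos.2 hcard
  -- Moving `x` towards the barycentre makes all weights positive.
  set u : ℝ → E3 → ℝ := fun r y => (1 - r) * w y + r * n with hu
  have hu1 : ∀ r, ∑ y ∈ s, u r y = 1 := fun r => by
    simp only [hu]
    rw [Finset.sum_add_distrib, ← Finset.mul_sum, h1, Finset.sum_const, nsmul_eq_mul, hn]
    field_simp; ring
  have ht : Tendsto (fun r : ℝ => ∑ y ∈ s, u r y • y) (𝓝 0) (𝓝 x) := by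
    have : Continuous (fun r : ℝ => ∑ y ∈ s, u r y • y) := by
      simp only [hu]; fun_prop
    have := this.tendsto 0
    simpa [hu, hwx] using this
  refine ht.frequently (((frequently_gt_nhds (0 : ℝ)).and_eventually
    (gt_mem_nhds (zero_lt_one (α := ℝ)))).mono fun r ⟨hr0, hr1⟩ => ?_)
  have hpos : ∀ y ∈ s, 0 < u r y := fun y hy =>
    add_pos_of_nonneg_of_pos (mul_nonneg (by linarith) (h0 y hy)) (mul_pos hr0 hnpos)
  refine ⟨Finset.mem_convexHull'.2 ⟨u r, fun y hy => (hpos y hy).le, hu1 r, rfl⟩, ?_⟩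
  intro a ha h
  obtain ⟨v, -, hv1, hvx, hva⟩ := (mem_convexHull_erase_iff ha).1 h
  have h2 := (affineIndependent_iff.1 hind) Finset.univ (fun y : s => u r y - v y) ?_ ?_ ⟨a, ha⟩
    (Finset.mem_univ _)
  · have := hpos a ha
    simp only at h2
    linarith
  · rw [Finset.sum_coe_sort s (fun y => u r y - v y), Finset.sum_sub_distrib, hu1, hv1, sub_self]
  · rw [Finset.sum_coe_sort s (fun y => (u r y - v y) • y)]
    simp only [sub_smul]
    rw [Finset.sum_sub_distrib, hvx, sub_self]

/-- A triangulated cycle modulo two is two-sided in three-space. -/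
theorem IsTriangulatedCycle.exists_isSide (hT : IsTriangulatedCycle 𝒯) :
    ∃ w, IsSide (triangleUnion 𝒯) w := by
  classical
  have key : ∀ x, ∃ c, x ∉ triangleUnion 𝒯 → ∀ o, IsGoodApex 𝒯 o x → coneParity 𝒯 o x = c := by
    intro x
    by_cases h : ∃ o, IsGoodApex 𝒯 o x
    · obtain ⟨o, ho⟩ := h
      exact ⟨coneParity 𝒯 o x, fun hx o' ho' => hT.coneParity_eq ho' ho hx⟩
    · exact ⟨0, fun _ o ho => absurd ⟨o, ho⟩ h⟩
  choose w hw using key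
  have hopen := (isClosed_triangleUnion 𝒯).isOpen_compl
  refine ⟨w, fun x hx => ?_, fun x hx c => ?_⟩
  · obtain ⟨o, ho, -⟩ := hT.exists_isGoodApex (x := x) fun s hs a ha h => hx
      (mem_triangleUnion.2 ⟨s, hs, convexHull_mono (by simp) h⟩)
    filter_upwards [hT.eventually_coneParity_eq ho hx, ho.eventually, hopen.mem_nhds hx]
      with z hz1 hz2 hz3
    rw [← hw x hx o ho, ← hw z hz3 o hz2, hz1]
  · obtain ⟨s, hs, hxs⟩ := mem_triangleUnion.1 hx
    -- The jump is available at points off the edges of a triangle; these accumulate at every point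
    -- of it.
    have h1 := frequently_notMem_edges (Finset.card_pos.1 (by rw [hT.card_eq s hs]; norm_num))
      (hT.indep s hs) hxs
    rw [frequently_iff]
    intro U hU
    obtain ⟨V, hVU, hV, hxV⟩ := mem_nhds_iff.1 hU
    obtain ⟨y, ⟨hys, hye⟩, hyV⟩ := (h1.and_eventually (hV.mem_nhds hxV)).exists
    obtain ⟨o, ho, hfr⟩ := hT.frequently_coneParity hs hys hye c
    obtain ⟨z, ⟨hz1, hz2⟩, hz3, hz4⟩ :=
      (hfr.and_eventually ((hV.eventually_mem hyV).and ho.eventually)).exists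
    exact ⟨z, hVU hz3, hz1, by rw [← hw z hz1 o hz4, hz2]⟩

end Cycle

/-! ### Radial projection onto the boundary of the tetrahedron -/

section Retraction

/-- The least coordinate. -/
noncomputable def minCoord (u : Fin 4 → ℝ) : ℝ := min (min (u 0) (u 1)) (min (u 2) (u 3))

/-- The sum of the coordinates after a translation along the diagonal that makes the least
coordinate vanish. -/
noncomputable def coordExcess (u : Fin 4 → ℝ) : ℝ := ∑ j, (u j - minCoord u)

/-- The projection along the diagonal and along rays onto the boundary of the tetrahedron. -/
noncomputable def toTetraBoundary (u : Fin 4 → ℝ) : Fin 4 → ℝ :=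
  (coordExcess u)⁻¹ • (u - minCoord u • 1)

theorem minCoord_le (u : Fin 4 → ℝ) (i : Fin 4) : minCoord u ≤ u i := by
  unfold minCoord
  fin_cases i <;> simp

theorem exists_minCoord_eq (u : Fin 4 → ℝ) : ∃ i, u i = minCoord u := by
  unfold minCoord
  rcases min_choice (min (u 0) (u 1)) (min (u 2) (u 3)) with h | h
  · rcases min_choice (u 0) (u 1) with h' | h'
    · exact ⟨0, by rw [h, h']⟩
    · exact ⟨1, by rw [h, h']⟩
  · rcases min_choice (u 2) (u 3) with h' | h'
    · exact ⟨2, by rw [h, h']⟩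
    · exact ⟨3, by rw [h, h']⟩

theorem minCoord_eq {u : Fin 4 → ℝ} {d : ℝ} (h : ∀ i, d ≤ u i) (h' : ∃ i, u i = d) :
    minCoord u = d := by
  obtain ⟨i, hi⟩ := exists_minCoord_eq u
  obtain ⟨j, hj⟩ := h'
  exact le_antisymm (hj ▸ minCoord_le u j) (hi ▸ h i)

variable {p u : Fin 4 → ℝ} {N d : ℝ}

theorem minCoord_add (hp : p ∈ tetraBoundary) (hN : 0 < N) : minCoord (N • p + d • 1) = d := by
  obtain ⟨⟨h0, h1⟩, i, hi⟩ := hp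
  refine minCoord_eq (fun j => ?_) ⟨i, ?_⟩
  · have := mul_nonneg hN.le (h0 j)
    simp; linarith
  · simp [hi]

theorem coordExcess_add (hp : p ∈ tetraBoundary) (hN : 0 < N) :
    coordExcess (N • p + d • 1) = N := by
  unfold coordExcess
  rw [minCoord_add hp hN]
  simp only [Pi.add_apply, Pi.smul_apply, smul_eq_mul, Pi.one_apply, mul_one,
    add_sub_cancel_right]
  rw [← Finset.mul_sum, hp.1.2, mul_one]

/-- Modulo the diagonal, four-space becomes three-space and the boundary of the tetrahedron a
surface met exactly once by each ray from the origin. Here `N` is the radial and `d` the diagonal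
coordinate. -/
theorem toTetraBoundary_add (hp : p ∈ tetraBoundary) (hN : 0 < N) :
    toTetraBoundary (N • p + d • 1) = p := by
  unfold toTetraBoundary
  rw [coordExcess_add hp hN, minCoord_add hp hN, add_sub_cancel_right, smul_smul,
    inv_mul_cancel₀ hN.ne', one_smul]

theorem toTetraBoundary_self (hp : p ∈ tetraBoundary) : toTetraBoundary p = p := by
  simpa using toTetraBoundary_add (d := 0) hp one_pos

theorem coordExcess_self (hp : p ∈ tetraBoundary) : coordExcess p = 1 := by
  simpa using coordExcess_add (d := 0) hp one_pos

theorem eq_smul_toTetraBoundary_add (hu : 0 < coordExcess u) :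
    u = coordExcess u • toTetraBoundary u + minCoord u • 1 := by
  unfold toTetraBoundary
  rw [smul_smul, mul_inv_cancel₀ hu.ne', one_smul, sub_add_cancel]

theorem toTetraBoundary_mem (hu : 0 < coordExcess u) : toTetraBoundary u ∈ tetraBoundary := by
  refine ⟨⟨fun i => ?_, ?_⟩, ?_⟩
  · have := minCoord_le u i
    simp only [toTetraBoundary, Pi.smul_apply, Pi.sub_apply, Pi.one_apply, smul_eq_mul, mul_one]
    exact mul_nonneg (inv_nonneg.2 hu.le) (by linarith)
  · simp only [toTetraBoundary, Pi.smul_apply, Pi.sub_apply, Pi.one_apply, smul_eq_mul, mul_one]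
    rw [← Finset.mul_sum]
    exact inv_mul_cancel₀ hu.ne'
  · obtain ⟨i, hi⟩ := exists_minCoord_eq u
    exact ⟨i, by simp [toTetraBoundary, hi]⟩

theorem continuous_minCoord : Continuous minCoord := by
  unfold minCoord; fun_prop

theorem continuous_coordExcess : Continuous coordExcess := by
  have := continuous_minCoord
  unfold coordExcess; fun_prop

/-- Points near `p` in the direction `u` project near `p`. -/
theorem tendsto_toTetraBoundary (hp : p ∈ tetraBoundary) (u : Fin 4 → ℝ) :
    Tendsto (fun t : ℝ => toTetraBoundary (p + t • u)) (𝓝 0) (𝓝 p) ∧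
      ∀ᶠ t : ℝ in 𝓝 0, 0 < coordExcess (p + t • u) := by
  have hl : Tendsto (fun t : ℝ => p + t • u) (𝓝 0) (𝓝 p) := by
    have : Continuous (fun t : ℝ => p + t • u) := by fun_prop
    simpa using this.tendsto 0
  have h1 : Tendsto (fun t : ℝ => coordExcess (p + t • u)) (𝓝 0) (𝓝 1) := by
    have := continuous_coordExcess.tendsto p
    rw [coordExcess_self hp] at this
    exact this.comp hl
  refine ⟨?_, h1.eventually (lt_mem_nhds one_pos)⟩
  have h2 : ContinuousAt toTetraBoundary p := by
    have hm := continuous_minCoord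
    have h3 : Continuous fun u : Fin 4 → ℝ => u - minCoord u • (1 : Fin 4 → ℝ) :=
      continuous_id.sub (hm.smul continuous_const)
    have h4 : ContinuousAt (fun u => (coordExcess u)⁻¹) p :=
      continuous_coordExcess.continuousAt.inv₀ (by rw [coordExcess_self hp]; exact one_ne_zero)
    exact h4.smul h3.continuousAt
  have := h2.tendsto
  rw [toTetraBoundary_self hp] at this
  exact this.comp hl

end Retraction

/-! ### Triangulations of the boundary of the tetrahedron -/

section Complex

variable {K : SimplicialComplex ℝ (Fin 4 → ℝ)} {s e : Finset (Fin 4 → ℝ)}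

/-- The vertices of a simplex on the boundary of the tetrahedron and the diagonal vector are
linearly independent. -/
theorem weights_eq_zero (hK : K.space = tetraBoundary) (hs : s ∈ K.faces)
    {w : (Fin 4 → ℝ) → ℝ} {d : ℝ} (h : ∑ y ∈ s, w y • y + d • (1 : Fin 4 → ℝ) = 0) :
    d = 0 ∧ ∀ y ∈ s, w y = 0 := by
  have hsub : convexHull ℝ (s : Set (Fin 4 → ℝ)) ⊆ tetraBoundary :=
    hK ▸ K.convexHull_subset_space hs
  have hmem : ∀ y ∈ s, y ∈ tetraBoundary := fun y hy => hsub (subset_convexHull ℝ _ hy)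
  have hcard : (0 : ℝ) < s.card := by
    exact_mod_cast (SimplicialComplex.nonempty_of_mem_faces hs).card_pos
  -- The simplex lies in one face of the tetrahedron: some coordinate vanishes at its barycentre,
  -- hence at all its vertices, whose coordinates are nonnegative.
  obtain ⟨i, hi⟩ : ∃ i, ∀ y ∈ s, y i = 0 := by
    have hc : ∑ y ∈ s, (s.card : ℝ)⁻¹ • y ∈ tetraBoundary := by
      refine hsub (Finset.mem_convexHull'.2 ⟨fun _ => (s.card : ℝ)⁻¹, fun _ _ => by positivity,
        ?_, rfl⟩)
      rw [Finset.sum_const, nsmul_eq_mul, mul_inv_cancel₀ hcard.ne']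
    obtain ⟨-, i, hi⟩ := hc
    refine ⟨i, fun y hy => ?_⟩
    rw [Finset.sum_apply] at hi
    have := (Finset.sum_eq_zero_iff_of_nonneg (fun y hy => by
      simp only [Pi.smul_apply, smul_eq_mul]
      exact mul_nonneg (inv_nonneg.2 hcard.le) ((hmem y hy).1.1 i))).1 hi y hy
    simpa [hcard.ne'] using this
  have hd : d = 0 := by
    have := congrFun h i
    simp only [Pi.add_apply, Finset.sum_apply, Pi.smul_apply, smul_eq_mul, Pi.one_apply, mul_one,
      Pi.zero_apply] at this
    rw [Finset.sum_eq_zero fun y hy => by rw [hi y hy, mul_zero], zero_add] at this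
    exact this
  refine ⟨hd, ?_⟩
  rw [hd, zero_smul, add_zero] at h
  have hsum : ∑ y ∈ s, w y = 0 := by
    have h1 : ∑ j, (∑ y ∈ s, w y • y) j = 0 := by rw [h]; simp
    simp only [Finset.sum_apply, Pi.smul_apply, smul_eq_mul] at h1
    rw [Finset.sum_comm] at h1
    rw [← h1]
    exact Finset.sum_congr rfl fun y hy => by rw [← Finset.mul_sum, (hmem y hy).1.2, mul_one]
  intro y hy
  refine (affineIndependent_iff.1 (K.indep hs)) Finset.univ (fun y : s => w y) ?_ ?_ ⟨y, hy⟩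
    (Finset.mem_univ _)
  · rwa [Finset.sum_coe_sort s w]
  · rwa [Finset.sum_coe_sort s (fun y => w y • y)]

/-- The vertices of a simplex together with the diagonal vector. -/
def withDiagonal (s : Finset (Fin 4 → ℝ)) : Option s → Fin 4 → ℝ
  | none => 1
  | some y => y

theorem linearIndependent_withDiagonal (hK : K.space = tetraBoundary) (hs : s ∈ K.faces) :
    LinearIndependent ℝ (withDiagonal s) := by
  classical
  rw [Fintype.linearIndependent_iff]
  intro g hg
  rw [Fintype.sum_option] at hg
  have := weights_eq_zero hK hs (w := fun y => if hy : y ∈ s then g (some ⟨y, hy⟩) else 0)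
    (d := g none) (by
      rw [← hg, add_comm, ← Finset.sum_coe_sort]
      simp [withDiagonal])
  rintro (_ | ⟨y, hy⟩)
  · exact this.1
  · simpa [hy] using this.2 y hy

theorem card_le_three (hK : K.space = tetraBoundary) (hs : s ∈ K.faces) : s.card ≤ 3 := by
  have := (linearIndependent_withDiagonal hK hs).fintype_card_le_finrank
  rw [Fintype.card_option, Fintype.card_coe, Module.finrank_fintype_fun_eq_card,
    Fintype.card_fin] at this
  omega

/-- Three vertices and the diagonal vector are four independent vectors in four-space, hence a
basis. -/
theorem exists_weights (hK : K.space = tetraBoundary) (hs : s ∈ K.faces) (hcard : s.card = 3)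
    (u : Fin 4 → ℝ) :
    ∃ (w : (Fin 4 → ℝ) → ℝ) (d : ℝ), u = ∑ y ∈ s, w y • y + d • (1 : Fin 4 → ℝ) := by
  classical
  have h := (linearIndependent_withDiagonal hK hs).span_eq_top_of_card_eq_finrank' (by
    rw [Fintype.card_option, Fintype.card_coe, Module.finrank_fintype_fun_eq_card,
      Fintype.card_fin, hcard])
  have hu : u ∈ Submodule.span ℝ (range (withDiagonal s)) := h ▸ Submodule.mem_top
  obtain ⟨g, hg⟩ := (Submodule.mem_span_range_iff_exists_fun ℝ).1 hu
  refine ⟨fun y => if hy : y ∈ s then g (some ⟨y, hy⟩) else 0, g none, ?_⟩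
  rw [← hg, Fintype.sum_option, add_comm, ← Finset.sum_coe_sort s]
  simp [withDiagonal]

/-- The span of the vertices of a simplex and of the diagonal vector. -/
def diagSpan (s : Finset (Fin 4 → ℝ)) : Submodule ℝ (Fin 4 → ℝ) :=
  Submodule.span ℝ (insert 1 (s : Set (Fin 4 → ℝ)))

theorem diagSpan_ne_top (hs : s.card ≤ 2) : diagSpan s ≠ ⊤ := by
  classical
  intro h
  have h1 := finrank_span_finset_le_card (R := ℝ) (insert (1 : Fin 4 → ℝ) s)
  rw [Finset.coe_insert] at h1
  change Module.finrank ℝ (diagSpan s) ≤ _ at h1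
  rw [h, finrank_top, Module.finrank_fintype_fun_eq_card, Fintype.card_fin] at h1
  have := Finset.card_insert_le (1 : Fin 4 → ℝ) s
  omega

theorem mem_diagSpan_of_mem_convexHull {x : Fin 4 → ℝ}
    (hx : x ∈ convexHull ℝ (s : Set (Fin 4 → ℝ))) : x ∈ diagSpan s := by
  obtain ⟨w, -, -, rfl⟩ := Finset.mem_convexHull'.1 hx
  exact Submodule.sum_mem _ fun y hy => Submodule.smul_mem _ _
    (Submodule.subset_span (mem_insert_of_mem _ hy))

theorem mem_diagSpan_of_toTetraBoundary {u : Fin 4 → ℝ} (hu : 0 < coordExcess u)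
    (h : toTetraBoundary u ∈ convexHull ℝ (s : Set (Fin 4 → ℝ))) : u ∈ diagSpan s := by
  rw [eq_smul_toTetraBoundary_add hu]
  exact Submodule.add_mem _ (Submodule.smul_mem _ _ (mem_diagSpan_of_mem_convexHull h))
    (Submodule.smul_mem _ _ (Submodule.subset_span (mem_insert _ _)))

theorem isClosed_convexHull_finset' (s : Finset (Fin 4 → ℝ)) :
    IsClosed (convexHull ℝ (s : Set (Fin 4 → ℝ))) :=
  s.finite_toSet.isClosed_convexHull ℝ

/-- A triangulation of the boundary of the tetrahedron is pure. -/
theorem exists_triangle_mem (hfin : K.faces.Finite) (hK : K.space = tetraBoundary)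
    {z : Fin 4 → ℝ} (hz : z ∈ tetraBoundary) :
    ∃ s ∈ K.faces, s.card = 3 ∧ z ∈ convexHull ℝ (s : Set (Fin 4 → ℝ)) := by
  -- A generic direction: pushing `z` along `u` leaves all vertices and edges, so the projected
  -- point lies in a triangle. As finitely many closed triangles are involved, one of them contains
  -- `z`.
  obtain ⟨u, hu⟩ : ∃ u, ∀ s ∈ hfin.toFinset.filter (fun s : Finset (Fin 4 → ℝ) => s.card ≤ 2), u ∉ diagSpan s := by
    have h := MeasureTheory.Measure.dense_of_ae (μ := MeasureTheory.volume)
      (p := fun u => ∀ s ∈ hfin.toFinset.filter (fun s : Finset (Fin 4 → ℝ) => s.card ≤ 2), u ∉ diagSpan s) (by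
        rw [eventually_all_finset]
        intro s hs
        have := MeasureTheory.Measure.addHaar_submodule MeasureTheory.volume (diagSpan s)
          (diagSpan_ne_top (Finset.mem_filter.1 hs).2)
        rw [MeasureTheory.ae_iff]
        simpa using this)
    exact h.nonempty
  obtain ⟨ht, hpos⟩ := tendsto_toTetraBoundary hz u
  by_contra! hcon
  have h1 : ∀ᶠ t : ℝ in 𝓝 0, ∀ s ∈ hfin.toFinset.filter (fun s : Finset (Fin 4 → ℝ) => s.card = 3),
      toTetraBoundary (z + t • u) ∉ convexHull ℝ (s : Set (Fin 4 → ℝ)) := by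
    rw [eventually_all_finset]
    intro s hs
    rw [Finset.mem_filter, Set.Finite.mem_toFinset] at hs
    exact ht.eventually ((isClosed_convexHull_finset' s).isOpen_compl.mem_nhds (hcon s hs.1 hs.2))
  have hl : Tendsto (fun t : ℝ => z + t • u) (𝓝 0) (𝓝 z) := by
    have : Continuous (fun t : ℝ => z + t • u) := by fun_prop
    simpa using this.tendsto 0
  have h2 : ∀ᶠ t : ℝ in 𝓝 0, ∀ s ∈ hfin.toFinset.filter (fun s : Finset (Fin 4 → ℝ) => s.card ≤ 2),
      t ≠ 0 → z + t • u ∉ diagSpan s := by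
    rw [eventually_all_finset]
    intro s hs
    by_cases hzs : z ∈ diagSpan s
    · refine Eventually.of_forall fun t ht0 h => hu s hs ?_
      have := Submodule.smul_mem _ t⁻¹ (Submodule.sub_mem _ h hzs)
      rwa [add_sub_cancel_left, smul_smul, inv_mul_cancel₀ ht0, one_smul] at this
    · filter_upwards [hl.eventually
        ((diagSpan s).closed_of_finiteDimensional.isOpen_compl.mem_nhds hzs)] with t ht _
      exact ht
  obtain ⟨t, ht0, h3, h4, h5⟩ := ((frequently_gt_nhds (0 : ℝ)).and_eventually
    (h1.and (h2.and hpos))).exists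
  have hmem := toTetraBoundary_mem h5
  rw [← hK, SimplicialComplex.mem_space_iff] at hmem
  obtain ⟨g, hg, hgt⟩ := hmem
  have hg3 := card_le_three hK hg
  by_cases hgc : g.card = 3
  · exact h3 g (Finset.mem_filter.2 ⟨hfin.mem_toFinset.2 hg, hgc⟩) hgt
  · exact h4 g (Finset.mem_filter.2 ⟨hfin.mem_toFinset.2 hg, by omega⟩) ht0.ne'
      (mem_diagSpan_of_toTetraBoundary h5 hgt)

open scoped Classical in
/-- In a direction transversal to an edge `e` there is exactly one triangle adjacent to `e`. -/
theorem eventually_card_triangles_eq_one (hfin : K.faces.Finite) (hK : K.space = tetraBoundary)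
    (he : e ∈ K.faces) {a b u : Fin 4 → ℝ} (hab : a ≠ b) (heab : e = {a, b})
    (hu : u ∉ diagSpan e) :
    ∀ᶠ t : ℝ in 𝓝 0, t ≠ 0 → ((Finset.filter (fun s : Finset (Fin 4 → ℝ) => s.card = 3 ∧ e ⊆ s)
      hfin.toFinset).filter fun s : Finset (Fin 4 → ℝ) =>
      toTetraBoundary (midpoint ℝ a b + t • u) ∈
        convexHull ℝ (s : Set (Fin 4 → ℝ))).card = 1 := by
  have hye : midpoint ℝ a b ∈ convexHull ℝ (e : Set (Fin 4 → ℝ)) := by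
    rw [heab, Finset.coe_pair, convexHull_pair]
    exact midpoint_mem_segment a b
  have hy : midpoint ℝ a b ∈ tetraBoundary := hK ▸ K.convexHull_subset_space he hye
  have hecard : e.card = 2 := by rw [heab, Finset.card_pair hab]
  set y := midpoint ℝ a b with hydef
  obtain ⟨ht, hpos⟩ := tendsto_toTetraBoundary hy u
  have h1 : ∀ᶠ t : ℝ in 𝓝 0, ∀ s ∈ hfin.toFinset,
      toTetraBoundary (y + t • u) ∈ convexHull ℝ (s : Set (Fin 4 → ℝ)) →
        y ∈ convexHull ℝ (s : Set (Fin 4 → ℝ)) := by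
    rw [eventually_all_finset]
    intro s hs
    by_cases hys : y ∈ convexHull ℝ (s : Set (Fin 4 → ℝ))
    · exact Eventually.of_forall fun t _ => hys
    · filter_upwards [ht.eventually ((isClosed_convexHull_finset' s).isOpen_compl.mem_nhds hys)]
        with t ht h
      exact absurd h ht
  -- The midpoint is interior to `e`, so a simplex that contains it contains both ends of `e`.
  have hsub : ∀ s ∈ K.faces, y ∈ convexHull ℝ (s : Set (Fin 4 → ℝ)) → e ⊆ s := by
    intro s hs hys
    have h2 := K.inter_subset_convexHull he hs ⟨hye, hys⟩
    have hne : ∀ c d : Fin 4 → ℝ, c ≠ d → c ∉ s → e = {c, d} → y ≠ d → False := by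
      intro c d hcd hc he' hyd
      have : (e : Set (Fin 4 → ℝ)) ∩ s ⊆ {d} := by
        rintro x ⟨hx1, hx2⟩
        rw [he', Finset.coe_pair] at hx1
        rcases hx1 with rfl | hx1
        · exact absurd hx2 hc
        · exact hx1
      have h3 := convexHull_mono this h2
      rw [convexHull_singleton] at h3
      exact hyd h3
    intro x hx
    by_contra hxs
    rw [heab, Finset.mem_insert, Finset.mem_singleton] at hx
    rcases hx with rfl | rfl
    · refine hne x b hab hxs heab fun h => hab ?_
      exact (midpoint_eq_right_iff ℝ).1 (hydef.symm.trans h)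
    · refine hne x a hab.symm hxs (heab.trans (Finset.pair_comm _ _)) fun h => hab ?_
      exact (midpoint_eq_left_iff ℝ).1 (hydef.symm.trans h)
  filter_upwards [h1, hpos] with t h1 hpos ht0
  have hnote : toTetraBoundary (y + t • u) ∉ convexHull ℝ (e : Set (Fin 4 → ℝ)) := by
    intro h
    refine hu ?_
    have h2 := Submodule.sub_mem _ (mem_diagSpan_of_toTetraBoundary hpos h)
      (mem_diagSpan_of_mem_convexHull hye)
    have := Submodule.smul_mem _ t⁻¹ h2
    rwa [add_sub_cancel_left, smul_smul, inv_mul_cancel₀ ht0, one_smul] at this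
  obtain ⟨g, hg, hgt⟩ := SimplicialComplex.mem_space_iff.1 (hK ▸ toTetraBoundary_mem hpos)
  have heg := hsub g hg (h1 g (hfin.mem_toFinset.2 hg) hgt)
  have hg3 : g.card = 3 := by
    have h2 := card_le_three hK hg
    have h3 := Finset.card_le_card heg
    by_contra h4
    have := Finset.eq_of_subset_of_card_le heg (by omega)
    exact hnote (this ▸ hgt)
  rw [Finset.card_eq_one]
  refine ⟨g, ?_⟩
  ext g'
  simp only [Finset.mem_filter, Set.Finite.mem_toFinset, Finset.mem_singleton]
  constructor
  · rintro ⟨⟨hg', hg'3, heg'⟩, hgt'⟩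
    by_contra hne
    have h2 := K.inter_subset_convexHull hg hg' ⟨hgt, hgt'⟩
    rw [← Finset.coe_inter] at h2
    have h3 : e = g ∩ g' := by
      refine Finset.eq_of_subset_of_card_le (Finset.subset_inter heg heg') ?_
      have h4 : g ∩ g' ⊂ g := by
        refine Finset.inter_subset_left.ssubset_of_ne fun h => hne ?_
        exact (Finset.eq_of_subset_of_card_le (Finset.inter_eq_left.1 h) (by omega)).symm
      have := Finset.card_lt_card h4
      omega
    exact hnote (h3 ▸ h2)
  · rintro rfl
    exact ⟨⟨hg, hg3, heg⟩, hgt⟩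

/-- A triangle adjacent to the edge `e` lies on exactly one side of it. -/
theorem eventually_mem_triangle_iff (hK : K.space = tetraBoundary) (hs : s ∈ K.faces)
    (hcard : s.card = 3) {a b u : Fin 4 → ℝ} (hab : a ≠ b) (heab : e = {a, b}) (hes : e ⊆ s)
    (hu : u ∉ diagSpan e) :
    ∃ γ : ℝ, γ ≠ 0 ∧ ∀ᶠ t : ℝ in 𝓝 0, (toTetraBoundary (midpoint ℝ a b + t • u) ∈
        convexHull ℝ (s : Set (Fin 4 → ℝ)) ↔ 0 ≤ t * γ) := by
  classical
  have hecard : e.card = 2 := by rw [heab, Finset.card_pair hab]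
  have hae : a ∈ e := by simp [heab]
  have hbe : b ∈ e := by simp [heab]
  have hye : midpoint ℝ a b ∈ convexHull ℝ (e : Set (Fin 4 → ℝ)) := by
    rw [heab, Finset.coe_pair, convexHull_pair]
    exact midpoint_mem_segment a b
  have hsub : convexHull ℝ (s : Set (Fin 4 → ℝ)) ⊆ tetraBoundary :=
    hK ▸ K.convexHull_subset_space hs
  have hy : midpoint ℝ a b ∈ tetraBoundary :=
    hsub (convexHull_mono (Finset.coe_subset.2 hes) hye)
  obtain ⟨-, hpos⟩ := tendsto_toTetraBoundary hy u
  obtain ⟨c, hc⟩ : ∃ c, s \ e = {c} := by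
    rw [← Finset.card_eq_one, Finset.card_sdiff_of_subset hes, hcard, hecard]
  have hcs : c ∈ s \ e := hc ▸ Finset.mem_singleton_self c
  rw [Finset.mem_sdiff] at hcs
  have hsum : ∀ f : (Fin 4 → ℝ) → (Fin 4 → ℝ), ∑ y ∈ s, f y = f c + (f a + f b) := by
    intro f
    rw [← Finset.sum_sdiff hes, hc, Finset.sum_singleton, heab, Finset.sum_pair hab]
  have hsumr : ∀ f : (Fin 4 → ℝ) → ℝ, ∑ y ∈ s, f y = f c + (f a + f b) := by
    intro f
    rw [← Finset.sum_sdiff hes, hc, Finset.sum_singleton, heab, Finset.sum_pair hab]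
  obtain ⟨w, d, huw⟩ := exists_weights hK hs hcard u
  rw [hsum] at huw
  have hmem : ∀ y ∈ s, ∀ x ∈ e, y = x → y ∈ e := fun y _ x hx h => h ▸ hx
  -- The sign is that of the coefficient of the third vertex `c` in `u`. For small `t` the weights
  -- of `a` and `b` stay near one half, so only the weight `t * w c` decides.
  refine ⟨w c, fun h0 => hu ?_, ?_⟩
  · rw [huw, h0, zero_smul, zero_add]
    exact Submodule.add_mem _ (Submodule.add_mem _
      (Submodule.smul_mem _ _ (Submodule.subset_span (mem_insert_of_mem _ hae)))
      (Submodule.smul_mem _ _ (Submodule.subset_span (mem_insert_of_mem _ hbe))))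
      (Submodule.smul_mem _ _ (Submodule.subset_span (mem_insert _ _)))
  have hpos' : ∀ r : ℝ, ∀ᶠ t : ℝ in 𝓝 0, 0 < 1 / 2 + t * r := fun r => by
    have : Continuous fun t : ℝ => 1 / 2 + t * r := by fun_prop
    refine this.continuousAt.eventually (lt_mem_nhds ?_)
    norm_num
  filter_upwards [hpos, hpos' (w a), hpos' (w b)] with t ht hta htb
  -- the weights of the point under consideration
  set v : (Fin 4 → ℝ) → ℝ := fun y => (if y ∈ e then 1 / 2 else 0) + t * w y with hv
  have hva : v a = 1 / 2 + t * w a := by simp [hv, hae]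
  have hvb : v b = 1 / 2 + t * w b := by simp [hv, hbe]
  have hvc : v c = t * w c := by simp [hv, hcs.2]
  have hz : midpoint ℝ a b + t • u = ∑ y ∈ s, v y • y + (t * d) • (1 : Fin 4 → ℝ) := by
    rw [hsum, hva, hvb, hvc, huw, midpoint_eq_smul_add, invOf_eq_inv]
    module
  constructor
  · intro h
    obtain ⟨l, hl0, hl1, hl⟩ := Finset.mem_convexHull'.1 h
    have h1 := eq_smul_toTetraBoundary_add ht
    set N := coordExcess (midpoint ℝ a b + t • u)
    set m := minCoord (midpoint ℝ a b + t • u)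
    have h2 := (weights_eq_zero hK hs (w := fun y => v y - N * l y) (d := t * d - m) (by
      rw [← hl] at h1
      rw [hz] at h1
      simp only [sub_smul, mul_smul, Finset.sum_sub_distrib, ← Finset.smul_sum] at h1 ⊢
      rw [← sub_eq_zero] at h1
      rw [← h1]
      module)).2 c hcs.1
    rw [hvc] at h2
    have := mul_nonneg ht.le (hl0 c hcs.1)
    linarith
  · intro h
    set N := v c + (v a + v b) with hN
    have hNpos : 0 < N := by rw [hN, hva, hvb, hvc]; linarith
    have hp : ∑ y ∈ s, (N⁻¹ * v y) • y ∈ convexHull ℝ (s : Set (Fin 4 → ℝ)) := by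
      refine Finset.mem_convexHull'.2 ⟨fun y => N⁻¹ * v y, fun y hy => ?_, ?_, rfl⟩
      · refine mul_nonneg (inv_nonneg.2 hNpos.le) ?_
        by_cases hye : y ∈ e
        · rw [heab, Finset.mem_insert, Finset.mem_singleton] at hye
          rcases hye with rfl | rfl
          · rw [hva]; exact hta.le
          · rw [hvb]; exact htb.le
        · have : y ∈ s \ e := Finset.mem_sdiff.2 ⟨hy, hye⟩
          rw [hc, Finset.mem_singleton] at this
          rw [this, hvc]; exact h
      · rw [hsumr, ← mul_add, ← mul_add, ← hN, inv_mul_cancel₀ hNpos.ne']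
    have h3 : midpoint ℝ a b + t • u =
        N • ∑ y ∈ s, (N⁻¹ * v y) • y + (t * d) • (1 : Fin 4 → ℝ) := by
      rw [hz, Finset.smul_sum]
      congr 1
      refine Finset.sum_congr rfl fun y _ => ?_
      rw [smul_smul, mul_inv_cancel_left₀ hNpos.ne']
    rw [h3, toTetraBoundary_add (hsub hp) hNpos]
    exact hp

open scoped Classical in
/-- In a triangulation of the boundary of the tetrahedron each edge is in two triangles. -/
theorem card_triangles_of_edge (hfin : K.faces.Finite) (hK : K.space = tetraBoundary)
    (he : e ∈ K.faces) (hecard : e.card = 2) :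
    (hfin.toFinset.filter fun s : Finset (Fin 4 → ℝ) => s.card = 3 ∧ e ⊆ s).card = 2 := by
  obtain ⟨a, b, hab, heab⟩ := Finset.card_eq_two.1 hecard
  obtain ⟨u, -, hu⟩ := SetLike.exists_of_lt (lt_top_iff_ne_top.2 (diagSpan_ne_top hecard.le))
  set F := hfin.toFinset.filter fun s : Finset (Fin 4 → ℝ) => s.card = 3 ∧ e ⊆ s with hF
  have h1 := eventually_card_triangles_eq_one hfin hK he hab heab hu
  have hside : ∀ s : Finset (Fin 4 → ℝ), ∃ γ : ℝ, s ∈ F → γ ≠ 0 ∧ ∀ᶠ t : ℝ in 𝓝 0,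
      (toTetraBoundary (midpoint ℝ a b + t • u) ∈ convexHull ℝ (s : Set (Fin 4 → ℝ)) ↔
        0 ≤ t * γ) := by
    intro s
    by_cases hs : s ∈ F
    · have hs' := hs
      rw [hF, Finset.mem_filter, hfin.mem_toFinset] at hs'
      obtain ⟨γ, hγ⟩ := eventually_mem_triangle_iff hK hs'.1 hs'.2.1 hab heab hs'.2.2 hu
      exact ⟨γ, fun _ => hγ⟩
    · exact ⟨0, fun h => absurd h hs⟩
  choose γ hγ using hside
  have h2 : ∀ᶠ t : ℝ in 𝓝 0, ∀ s ∈ F,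
      (toTetraBoundary (midpoint ℝ a b + t • u) ∈ convexHull ℝ (s : Set (Fin 4 → ℝ)) ↔
        0 ≤ t * γ s) := by
    rw [eventually_all_finset]
    exact fun s hs => (hγ s hs).2
  have hneg : Tendsto (fun t : ℝ => -t) (𝓝 0) (𝓝 0) := by
    have : Continuous fun t : ℝ => -t := continuous_neg
    simpa using this.tendsto 0
  obtain ⟨t, ht, ⟨h3, h4⟩, h5, h6⟩ := ((frequently_gt_nhds (0 : ℝ)).and_eventually
    ((h1.and h2).and ((hneg.eventually h1).and (hneg.eventually h2)))).exists
  have h3 := h3 ht.ne'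
  have h5 := h5 (neg_ne_zero.2 ht.ne')
  rw [Finset.card_filter] at h3 h5
  rw [← hF] at h3 h5
  -- Each adjacent triangle contains exactly one of the points displaced by `t` and `-t`, and each
  -- of these points is in exactly one triangle: together two.
  have h7 : ∀ s ∈ F, 1 =
      (if toTetraBoundary (midpoint ℝ a b + t • u) ∈ convexHull ℝ (s : Set (Fin 4 → ℝ)) then 1
        else 0) +
      (if toTetraBoundary (midpoint ℝ a b + -t • u) ∈ convexHull ℝ (s : Set (Fin 4 → ℝ)) then 1
        else 0) := by
    intro s hs
    simp only [h4 s hs, h6 s hs]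
    rcases lt_or_gt_of_ne (hγ s hs).1 with h | h
    · rw [if_neg (not_le.2 (mul_neg_of_pos_of_neg ht h)),
        if_pos (by rw [neg_mul, ← mul_neg]; exact mul_nonneg ht.le (by linarith))]
    · rw [if_pos (mul_nonneg ht.le h.le),
        if_neg (by rw [not_le, neg_mul, neg_lt_zero]; exact mul_pos ht h)]
  rw [Finset.card_eq_sum_ones, Finset.sum_congr rfl h7, Finset.sum_add_distrib, h3, h5]

end Complex

/-! ### Piecewise-linear spheres are two-sided -/

section PLSphere

variable {K : SimplicialComplex ℝ (Fin 4 → ℝ)} {f : (Fin 4 → ℝ) → E3}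
  {s t : Finset (Fin 4 → ℝ)}

theorem image_convexHull_of_eqOn {A : (Fin 4 → ℝ) →ᵃ[ℝ] E3}
    (hA : EqOn f A (convexHull ℝ (s : Set (Fin 4 → ℝ)))) {I : Set (Fin 4 → ℝ)} (hI : I ⊆ s) :
    f '' convexHull ℝ I = convexHull ℝ (f '' I) := by
  have h1 : EqOn f A (convexHull ℝ I) := hA.mono (convexHull_mono hI)
  rw [h1.image_eq, (h1.mono (subset_convexHull ℝ I)).image_eq, A.image_convexHull]

-- Were the images dependent, Radon's theorem would give two disjoint faces of the simplex whose
-- images meet, against injectivity.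
open scoped Classical in
theorem affineIndependent_image (hs : AffineIndependent ℝ ((↑) : s → Fin 4 → ℝ))
    {A : (Fin 4 → ℝ) →ᵃ[ℝ] E3} (hA : EqOn f A (convexHull ℝ (s : Set (Fin 4 → ℝ))))
    (hf : InjOn f (convexHull ℝ (s : Set (Fin 4 → ℝ)))) :
    AffineIndependent ℝ (Subtype.val : ↥(s.image f) → E3) := by
  have h1 : AffineIndependent ℝ (fun y : s => f y) := by
    by_contra h
    obtain ⟨I, z, hz1, hz2⟩ := Convex.radon_partition h
    have himg : ∀ J : Set s, (fun y : s => f y) '' J = f '' ((↑) '' J) := fun J => by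
      rw [image_image]
    have hcoe : ∀ J : Set s, ((s.filter fun y => y ∈ ((↑) '' J : Set (Fin 4 → ℝ)) :
        Finset (Fin 4 → ℝ)) : Set (Fin 4 → ℝ)) = (↑) '' J := by
      intro J
      ext y
      simp only [Finset.coe_filter, mem_ofPred_eq, and_iff_right_iff_imp]
      rintro ⟨y, -, rfl⟩; exact y.2
    have hsub : ∀ J : Set s, ((↑) '' J : Set (Fin 4 → ℝ)) ⊆ s := by
      rintro J _ ⟨y, -, rfl⟩; exact y.2
    rw [himg, ← image_convexHull_of_eqOn hA (hsub _)] at hz1 hz2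
    obtain ⟨x, hx, rfl⟩ := hz1
    obtain ⟨x', hx', hxx⟩ := hz2
    have := hf (convexHull_mono (hsub _) hx') (convexHull_mono (hsub _) hx) hxx
    subst this
    have h2 := AffineIndependent.convexHull_inter (R := ℝ) hs
      (t₁ := s.filter fun y => y ∈ ((↑) '' I : Set (Fin 4 → ℝ)))
      (t₂ := s.filter fun y => y ∈ ((↑) '' Iᶜ : Set (Fin 4 → ℝ))) (Finset.filter_subset _ _)
      (Finset.filter_subset _ _)
    rw [hcoe, hcoe, ← image_inter Subtype.val_injective, inter_compl_self, image_empty,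
      convexHull_empty] at h2
    exact (h2 ▸ ⟨hx, hx'⟩ : x' ∈ (∅ : Set (Fin 4 → ℝ)))
  refine h1.range.mono (s := ((s.image f : Finset E3) : Set E3)) fun y hy => ?_
  obtain ⟨z, hz, rfl⟩ := Finset.mem_image.1 hy
  exact ⟨⟨z, hz⟩, rfl⟩

/-- A piecewise-linear sphere is two-sided. -/
theorem IsPLSphere.exists_isSide {S : Set E3} (hS : IsPLSphere S) : ∃ w, IsSide S w := by
  classical
  obtain ⟨f, ⟨K, hfin, hK, hA⟩, hf, rfl⟩ := hS
  choose! A hA using hA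
  have hsub : ∀ s ∈ K.faces, convexHull ℝ (s : Set (Fin 4 → ℝ)) ⊆ tetraBoundary := fun s hs =>
    hK ▸ K.convexHull_subset_space hs
  have hmem : ∀ s ∈ K.faces, (s : Set (Fin 4 → ℝ)) ⊆ tetraBoundary := fun s hs =>
    (subset_convexHull ℝ _).trans (hsub s hs)
  have himg : ∀ s ∈ K.faces, convexHull ℝ ((s.image f : Finset E3) : Set E3) =
      f '' convexHull ℝ (s : Set (Fin 4 → ℝ)) := fun s hs => by
    rw [Finset.coe_image, image_convexHull_of_eqOn (hA s hs) subset_rfl]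
  have hinj : ∀ s ∈ K.faces, ∀ t ∈ K.faces, s.image f ⊆ t.image f → s ⊆ t := by
    intro s hs t ht h y hy
    obtain ⟨z, hz, hzy⟩ := Finset.mem_image.1 (h (Finset.mem_image_of_mem f hy))
    exact hf (hmem t ht hz) (hmem s hs hy) hzy ▸ hz
  set F := hfin.toFinset.filter fun s : Finset (Fin 4 → ℝ) => s.card = 3 with hF
  have hFm : ∀ s, s ∈ F ↔ s ∈ K.faces ∧ s.card = 3 := fun s => by
    rw [hF, Finset.mem_filter, hfin.mem_toFinset]
  have hcyc : IsTriangulatedCycle (F.image fun s => s.image f) := by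
    refine ⟨?_, ?_, ?_, ?_⟩
    · rw [Finset.forall_mem_image]
      intro s hs
      rw [hFm] at hs
      rw [Finset.card_image_of_injOn (hf.mono (hmem s hs.1)), hs.2]
    · rw [Finset.forall_mem_image]
      intro s hs
      rw [hFm] at hs
      exact affineIndependent_image (K.indep hs.1) (hA s hs.1) (hf.mono (hsub s hs.1))
    · simp only [Finset.forall_mem_image]
      intro s hs t ht
      rw [hFm] at hs ht
      rw [himg s hs.1, himg t ht.1, ← hf.image_inter (hsub s hs.1) (hsub t ht.1)]
      refine (image_mono (K.inter_subset_convexHull hs.1 ht.1)).trans ?_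
      rw [image_convexHull_of_eqOn (hA s hs.1) inter_subset_left]
      refine convexHull_mono ?_
      rw [Finset.coe_image, Finset.coe_image]
      exact image_inter_subset _ _ _
    · intro e he
      rcases (Finset.filter (fun s => e ⊆ s) (F.image fun s => s.image f)).eq_empty_or_nonempty
        with h | ⟨s', hs'⟩
      · rw [h]; simp
      rw [Finset.mem_filter, Finset.mem_image] at hs'
      obtain ⟨⟨s, hs, rfl⟩, hes⟩ := hs'
      obtain ⟨e', he's, rfl⟩ := Finset.subset_image_iff.1 hes
      rw [hFm] at hs
      have he'c : e'.card = 2 := by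
        rwa [Finset.card_image_of_injOn (hf.mono ((Finset.coe_subset.2 he's).trans
          (hmem s hs.1)))] at he
      have he' : e' ∈ K.faces := K.down_closed hs.1 he's (Finset.card_pos.1 (by omega))
      have h2 := card_triangles_of_edge hfin hK he' he'c
      have h3 : Finset.filter (fun s => e'.image f ⊆ s) (F.image fun s => s.image f) =
          (hfin.toFinset.filter fun s : Finset (Fin 4 → ℝ) => s.card = 3 ∧ e' ⊆ s).image
            fun s => s.image f := by
        ext u
        simp only [Finset.mem_filter, Finset.mem_image, hFm, hfin.mem_toFinset]
        constructor
        · rintro ⟨⟨t, ht, rfl⟩, h⟩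
          exact ⟨t, ⟨ht.1, ht.2, hinj _ he' _ ht.1 h⟩, rfl⟩
        · rintro ⟨t, ⟨h1, h2, h3⟩, rfl⟩
          exact ⟨⟨t, ⟨h1, h2⟩, rfl⟩, Finset.image_subset_image h3⟩
      rw [h3, Finset.card_image_of_injOn, h2]
      · exact even_two
      · intro t ht t' ht' h
        simp only [Finset.coe_filter, mem_ofPred_eq, hfin.mem_toFinset] at ht ht'
        exact (hinj _ ht.1 _ ht'.1 (subset_of_eq h)).antisymm
          (hinj _ ht'.1 _ ht.1 (subset_of_eq h.symm))
  obtain ⟨w, hw⟩ := hcyc.exists_isSide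
  refine ⟨w, ?_⟩
  convert hw
  ext x
  rw [mem_triangleUnion, Finset.exists_mem_image]
  constructor
  · rintro ⟨z, hz, rfl⟩
    obtain ⟨s, hs, hs3, hzs⟩ := exists_triangle_mem hfin hK hz
    refine ⟨s, (hFm s).2 ⟨hs, hs3⟩, ?_⟩
    rw [himg s hs]
    exact mem_image_of_mem f hzs
  · rintro ⟨s, hs, hx⟩
    rw [hFm] at hs
    rw [himg s hs.1] at hx
    exact image_mono (hsub s hs.1) hx

end PLSphere

/-! ### Circles on the round sphere -/

section Coordinates

theorem mem_S2_iff {x : E3} : x ∈ S2 ↔ x 0 ^ 2 + x 1 ^ 2 + x 2 ^ 2 = 1 := by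
  rw [S2, mem_sphere_zero_iff_norm, EuclideanSpace.norm_eq, Real.sqrt_eq_one, Fin.sum_univ_three]
  simp only [Real.norm_eq_abs, sq_abs]

theorem inner_vec (a b c : ℝ) (x : E3) : inner ℝ !₂[a, b, c] x = a * x 0 + b * x 1 + c * x 2 := by
  simp [PiLp.inner_apply, Fin.sum_univ_three]
  ring

theorem inner_single (i : Fin 3) (x : E3) : inner ℝ (EuclideanSpace.single i (1 : ℝ)) x = x i := by
  simp [EuclideanSpace.inner_single_left]

theorem sq_add_sq_le_one {x : E3} (hx : x ∈ S2) {i j : Fin 3} (hij : i ≠ j) :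
    x i ^ 2 + x j ^ 2 ≤ 1 := by
  rw [mem_S2_iff] at hx
  fin_cases i <;> fin_cases j <;> simp at hij ⊢ <;>
    nlinarith [sq_nonneg (x 0), sq_nonneg (x 1), sq_nonneg (x 2)]

/-- The sum is at most `√2 < 3 / 2`. This inequality keeps the eight small circles apart from each
other and from the equator. -/
theorem abs_add_abs_lt_of_sq {a b : ℝ} (h : a ^ 2 + b ^ 2 ≤ 1) : |a| + |b| < 3 / 2 := by
  have h1 := sq_abs a
  have h2 := sq_abs b
  nlinarith [sq_nonneg (|a| - |b|), abs_nonneg a, abs_nonneg b]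

theorem isClosed_circleOn (u : E3) (c : ℝ) : IsClosed (circleOn u c) :=
  Metric.isClosed_sphere.inter (isClosed_eq (by fun_prop) continuous_const)

/-- The circle is a translate of a sphere, possibly of radius zero, in the plane orthogonal to `u`.
-/
theorem isConnected_circleOn {u : E3} {c : ℝ} (hu : u ≠ 0) (hc : c ^ 2 ≤ ‖u‖ ^ 2) :
    IsConnected (circleOn u c) := by
  have hn : 0 < ‖u‖ ^ 2 := by positivity
  have : Fact (Module.finrank ℝ E3 = 2 + 1) := ⟨by simp⟩
  have hrank : 1 < Module.rank ℝ (ℝ ∙ u)ᗮ := by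
    refine Module.one_lt_rank_of_one_lt_finrank ?_
    rw [Submodule.finrank_orthogonal_span_singleton (n := 2) hu]
    norm_num
  have hr : 0 ≤ 1 - c ^ 2 / ‖u‖ ^ 2 := by
    rw [sub_nonneg, div_le_one hn]; exact hc
  have hs := isConnected_sphere hrank 0 (Real.sqrt_nonneg (1 - c ^ 2 / ‖u‖ ^ 2))
  have himg := hs.image (fun v : (ℝ ∙ u)ᗮ => (c / ‖u‖ ^ 2) • u + (v : E3)) (by fun_prop)
  have hperp : ∀ v : (ℝ ∙ u)ᗮ, inner ℝ u (v : E3) = 0 := fun v =>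
    (Submodule.mem_orthogonal_singleton_iff_inner_right).1 v.2
  have hnorm : ∀ v : E3, inner ℝ u v = 0 →
      ‖(c / ‖u‖ ^ 2) • u + v‖ ^ 2 = c ^ 2 / ‖u‖ ^ 2 + ‖v‖ ^ 2 := by
    intro v hv
    rw [norm_add_sq_real, inner_smul_left, hv, norm_smul, mul_pow, Real.norm_eq_abs, sq_abs]
    field_simp
    simp
  convert himg using 1
  ext x
  constructor
  · rintro ⟨hx, hxc⟩
    rw [S2, mem_sphere_zero_iff_norm] at hx
    have hv : inner ℝ u (x - (c / ‖u‖ ^ 2) • u) = 0 := by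
      rw [inner_sub_right, inner_smul_right, real_inner_self_eq_norm_sq, hxc]
      field_simp
      ring
    refine ⟨⟨x - (c / ‖u‖ ^ 2) • u, Submodule.mem_orthogonal_singleton_iff_inner_right.2 hv⟩,
      ?_, by simp⟩
    have h1 := hnorm _ hv
    rw [add_sub_cancel, hx] at h1
    rw [mem_sphere_zero_iff_norm, Submodule.coe_norm]
    rw [eq_comm, Real.sqrt_eq_iff_mul_self_eq hr (norm_nonneg _)]
    linarith
  · rintro ⟨v, hv, rfl⟩
    rw [mem_sphere_zero_iff_norm] at hv
    refine ⟨?_, ?_⟩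
    · rw [S2, mem_sphere_zero_iff_norm, ← sq_eq_sq₀ (norm_nonneg _) zero_le_one,
        hnorm _ (hperp v), ← Submodule.coe_norm, hv, Real.sq_sqrt hr]
      ring
    · rw [inner_add_right, inner_smul_right, hperp, real_inner_self_eq_norm_sq]
      field_simp
      simp

end Coordinates

/-! ### Connectedness of the caps and of the holed discs -/

section Regions

/-- The part of the open hemisphere of sign `s` outside the four small discs. -/
def holedDisc (s : ℝ) : Set E3 := {x | x ∈ S2 ∧ 0 < s * x 2 ∧ |x 0| + |x 1| + s * x 2 < 3 / 2}

/-- The open spherical cap bounded by the circle `circleOn u c`. -/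
def openCap (u : E3) (c : ℝ) : Set E3 := {x | x ∈ S2 ∧ c < inner ℝ u x}

/-- The cap is the radial projection of a cone, which is convex because `0 ≤ c`. -/
theorem isPreconnected_openCap (u : E3) {c : ℝ} (hc : 0 ≤ c) : IsPreconnected (openCap u c) := by
  have hconv : Convex ℝ {x : E3 | c * ‖x‖ < inner ℝ u x} := by
    intro x hx y hy a b ha hb hab
    rw [mem_ofPred_eq] at *
    rw [inner_add_right, inner_smul_right, inner_smul_right]
    have h1 : ‖a • x + b • y‖ ≤ a * ‖x‖ + b * ‖y‖ := by
      refine (norm_add_le _ _).trans ?_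
      rw [norm_smul, norm_smul, Real.norm_of_nonneg ha, Real.norm_of_nonneg hb]
    have h2 := mul_le_mul_of_nonneg_left h1 hc
    rcases ha.eq_or_lt with rfl | ha
    · have hb1 : b = 1 := by linarith
      subst hb1; linarith
    · have := mul_lt_mul_of_pos_left hx ha
      have := mul_le_mul_of_nonneg_left hy.le hb
      linarith
  have hne : ∀ x ∈ {x : E3 | c * ‖x‖ < inner ℝ u x}, x ≠ 0 := by
    rintro x hx rfl
    simp at hx
  have himg := hconv.isPreconnected.image (fun x => ‖x‖⁻¹ • x) (by
    have h1 : ContinuousOn (fun x : E3 => ‖x‖⁻¹) {x : E3 | c * ‖x‖ < inner ℝ u x} :=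
      continuous_norm.continuousOn.inv₀ fun x hx => norm_ne_zero_iff.2 (hne x hx)
    exact h1.smul continuousOn_id)
  convert himg using 1
  ext x
  constructor
  · rintro ⟨hx, hxc⟩
    rw [S2, mem_sphere_zero_iff_norm] at hx
    exact ⟨x, by rw [mem_ofPred_eq, hx, mul_one]; exact hxc, by simp [hx]⟩
  · rintro ⟨y, hy, rfl⟩
    have hy0 : 0 < ‖y‖ := norm_pos_iff.2 (hne y hy)
    refine ⟨?_, ?_⟩
    · rw [S2, mem_sphere_zero_iff_norm, norm_smul, norm_inv, norm_norm, inv_mul_cancel₀ hy0.ne']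
    · rw [inner_smul_right, inv_mul_eq_div, lt_div_iff₀ hy0]
      exact hy

/-- The vertical projection of `holedDisc` to the plane. -/
def planarRegion : Set (ℝ × ℝ) :=
  {p | p.1 ^ 2 + p.2 ^ 2 < 1 ∧ |p.1| + |p.2| + √(1 - (p.1 ^ 2 + p.2 ^ 2)) < 3 / 2}

/-- Along a ray the function that defines `planarRegion` lies below its tangent. -/
theorem smul_mem_planarRegion {p : ℝ × ℝ} (hp : p ∈ planarRegion) {l : ℝ} (hl : 0 ≤ l)
    (hl1 : l ^ 2 * (p.1 ^ 2 + p.2 ^ 2) < 1)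
    (h : 0 ≤ ((|p.1| + |p.2|) * √(1 - (p.1 ^ 2 + p.2 ^ 2)) - (p.1 ^ 2 + p.2 ^ 2)) * (1 - l)) :
    l • p ∈ planarRegion := by
  obtain ⟨h1, h2⟩ := hp
  set R := p.1 ^ 2 + p.2 ^ 2 with hR
  have hR0 : 0 ≤ R := by positivity
  set z := √(1 - R) with hz
  have hz0 : 0 < z := Real.sqrt_pos.2 (by linarith)
  have hzz : z ^ 2 = 1 - R := Real.sq_sqrt (by linarith)
  set k := |p.1| + |p.2| with hk
  have hsq : (l • p).1 ^ 2 + (l • p).2 ^ 2 = l ^ 2 * R := by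
    simp [hR]; ring
  refine ⟨by rw [hsq]; exact hl1, ?_⟩
  rw [hsq]
  have habs : |(l • p).1| + |(l • p).2| = l * k := by
    simp [abs_mul, abs_of_nonneg hl, hk]; ring
  rw [habs]
  set y := √(1 - l ^ 2 * R) with hy
  have hy0 : 0 ≤ y := Real.sqrt_nonneg _
  have hyy : y ^ 2 = 1 - l ^ 2 * R := Real.sq_sqrt (by linarith)
  have hlR : 0 ≤ 1 - l * R := by
    nlinarith [mul_nonneg hl hR0, sq_nonneg (l * R)]
  -- The tangent inequality for the concave function `√(1 - l ^ 2 * R)` of `l` at `l = 1`,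
  -- multiplied by `z`; the squares differ by `R * (1 - l) ^ 2`.
  have hzy : z * y ≤ 1 - l * R := by
    refine abs_le_of_sq_le_sq' ?_ hlR |>.2
    rw [mul_pow, hzz, hyy]
    nlinarith [mul_nonneg hR0 (sq_nonneg (1 - l))]
  have h3 : z * (l * k + y) ≤ z * (k + z) := by
    nlinarith
  have := le_of_mul_le_mul_left h3 hz0
  linarith

/-- A thin annulus at the boundary of the unit disc. -/
def thinAnnulus : Set (ℝ × ℝ) :=
  (fun q : ℝ × ℝ => (q.1 * Real.cos q.2, q.1 * Real.sin q.2)) '' (Ioo 0.998 1 ×ˢ univ)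

/-- For `r > 0.998` the root is below `0.08` and the other two terms sum to at most `√2 < 1.415`, in
total less than `3 / 2`. -/
theorem thinAnnulus_subset : thinAnnulus ⊆ planarRegion := by
  rintro _ ⟨⟨r, θ⟩, ⟨⟨hr0, hr1⟩, -⟩, rfl⟩
  simp only at hr0 hr1
  have hsq : (r * Real.cos θ) ^ 2 + (r * Real.sin θ) ^ 2 = r ^ 2 := by
    rw [mul_pow, mul_pow, ← mul_add, Real.cos_sq_add_sin_sq, mul_one]
  refine ⟨by simp only [hsq]; nlinarith, ?_⟩
  simp only [hsq]
  have h1 : √(1 - r ^ 2) ≤ 0.08 := by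
    rw [Real.sqrt_le_left (by norm_num)]
    nlinarith
  have h2 : |r * Real.cos θ| + |r * Real.sin θ| ≤ 1.415 := by
    rw [← sq_abs (r * Real.cos θ), ← sq_abs (r * Real.sin θ)] at hsq
    refine abs_le_of_sq_le_sq' ?_ (by norm_num) |>.2
    nlinarith [sq_nonneg (|r * Real.cos θ| - |r * Real.sin θ|)]
  linarith

theorem isPreconnected_thinAnnulus : IsPreconnected thinAnnulus :=
  (isPreconnected_Ioo.prod isPreconnected_univ).image _ (by fun_prop)

theorem exists_polar (p : ℝ × ℝ) : ∃ r θ : ℝ, 0 ≤ r ∧ p = (r * Real.cos θ, r * Real.sin θ) := by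
  refine ⟨‖(⟨p.1, p.2⟩ : ℂ)‖, Complex.arg ⟨p.1, p.2⟩, norm_nonneg _, ?_⟩
  rw [Complex.norm_mul_cos_arg, Complex.norm_mul_sin_arg]

/-- On each ray the defining function is concave, so from any point of the region it does not
increase in one of the two radial directions. Thus the point can be joined to the origin or to the
thin annulus, and these are linked along an axis. -/
theorem isPreconnected_planarRegion : IsPreconnected planarRegion := by
  have haxis : IsPreconnected ((fun t : ℝ => (t, (0 : ℝ))) '' Ico 0 1) :=
    isPreconnected_Ico.image _ (by fun_prop)
  have haxis_sub : (fun t : ℝ => (t, (0 : ℝ))) '' Ico 0 1 ⊆ planarRegion := by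
    rintro _ ⟨t, ⟨h0, h1⟩, rfl⟩
    refine ⟨by simp only; nlinarith, ?_⟩
    have h2 := Real.sqrt_nonneg (1 - t ^ 2)
    have := abs_add_abs_lt_of_sq (a := t) (b := √(1 - t ^ 2))
      (by rw [Real.sq_sqrt (by nlinarith)]; linarith)
    rw [abs_of_nonneg h2] at this
    simpa using this
  have hbase : IsPreconnected (thinAnnulus ∪ (fun t : ℝ => (t, (0 : ℝ))) '' Ico 0 1) := by
    refine isPreconnected_thinAnnulus.union (0.999, 0) ?_ ?_ haxis
    · exact ⟨(0.999, 0), ⟨by constructor <;> norm_num, mem_univ _⟩, by simp⟩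
    · exact ⟨0.999, by constructor <;> norm_num, rfl⟩
  have h0 : (0 : ℝ × ℝ) ∈ (fun t : ℝ => (t, (0 : ℝ))) '' Ico 0 1 := ⟨0, by simp, rfl⟩
  refine isPreconnected_of_forall (0 : ℝ × ℝ) fun p hp => ?_
  -- `D` has the sign of the radial derivative at `p`: move inwards if it is nonnegative, outwards
  -- otherwise.
  set D := (|p.1| + |p.2|) * √(1 - (p.1 ^ 2 + p.2 ^ 2)) - (p.1 ^ 2 + p.2 ^ 2) with hD
  rcases le_or_gt 0 D with hD0 | hD0
  · refine ⟨segment ℝ 0 p, ?_, left_mem_segment _ _ _, right_mem_segment _ _ _,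
      (convex_segment _ _).isPreconnected⟩
    rw [segment_eq_image_lineMap]
    rintro _ ⟨l, ⟨hl0, hl1⟩, rfl⟩
    rw [AffineMap.lineMap_apply_module, smul_zero, zero_add]
    refine smul_mem_planarRegion hp hl0 ?_ (mul_nonneg hD0 (by linarith))
    have := hp.1
    have : l ^ 2 ≤ 1 := by nlinarith
    nlinarith [sq_nonneg p.1, sq_nonneg p.2]
  · obtain ⟨r, θ, hr, hpr⟩ := exists_polar p
    have hR : p.1 ^ 2 + p.2 ^ 2 = r ^ 2 := by
      rw [hpr]
      simp only
      rw [mul_pow, mul_pow, ← mul_add, Real.cos_sq_add_sin_sq, mul_one]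
    have hr1 : r < 1 := by
      have := hp.1
      rw [hR] at this
      nlinarith
    have hrpos : 0 < r := by
      rcases hr.eq_or_lt with rfl | h
      · rw [hR] at hD
        have : 0 ≤ (|p.1| + |p.2|) * √(1 - 0 ^ 2) := by positivity
        linarith
      · exact h
    by_cases hr2 : 0.998 < r
    · exact ⟨_, union_subset thinAnnulus_subset haxis_sub, Or.inr h0,
        Or.inl ⟨(r, θ), ⟨⟨hr2, hr1⟩, mem_univ _⟩, hpr.symm⟩, hbase⟩
    · have hq : (0.999 / r) • p ∈ thinAnnulus := by
        refine ⟨(0.999, θ), ⟨by constructor <;> norm_num, mem_univ _⟩, ?_⟩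
        rw [hpr]
        simp only [Prod.smul_mk, smul_eq_mul]
        field_simp
      refine ⟨segment ℝ p ((0.999 / r) • p) ∪
        (thinAnnulus ∪ (fun t : ℝ => (t, (0 : ℝ))) '' Ico 0 1), ?_, Or.inr (Or.inr h0),
        Or.inl (left_mem_segment _ _ _), ?_⟩
      · refine union_subset ?_ (union_subset thinAnnulus_subset haxis_sub)
        rw [segment_eq_image_lineMap]
        rintro _ ⟨t, ⟨ht0, ht1⟩, rfl⟩
        have h1 : (1 : ℝ) ≤ 0.999 / r := by rw [le_div_iff₀ hrpos]; linarith
        have h2 : AffineMap.lineMap p ((0.999 / r) • p) t = ((1 - t) + t * (0.999 / r)) • p := by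
          rw [AffineMap.lineMap_apply_module, smul_smul, ← add_smul]
        rw [h2]
        have h3 : 1 ≤ (1 - t) + t * (0.999 / r) := by nlinarith
        have h4 : (1 - t) + t * (0.999 / r) ≤ 0.999 / r := by nlinarith
        refine smul_mem_planarRegion hp (by linarith) ?_
          (mul_nonneg_of_nonpos_of_nonpos hD0.le (by linarith))
        rw [hR, ← mul_pow]
        have h5 : ((1 - t) + t * (0.999 / r)) * r ≤ 0.999 := by
          rwa [← le_div_iff₀ hrpos]
        have h6 : 0 ≤ ((1 - t) + t * (0.999 / r)) * r := by
          refine mul_nonneg (by linarith) hr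
        nlinarith
      · exact (convex_segment _ _).isPreconnected.union _ (right_mem_segment _ _ _) (Or.inl hq)
          hbase

theorem isPreconnected_holedDisc {s : ℝ} (hs : s ^ 2 = 1) : IsPreconnected (holedDisc s) := by
  have himg := isPreconnected_planarRegion.image
    (fun p : ℝ × ℝ => (!₂[p.1, p.2, s * √(1 - (p.1 ^ 2 + p.2 ^ 2))] : E3)) (by fun_prop)
  convert himg using 1
  ext x
  constructor
  · rintro ⟨hx, hx2, hx3⟩
    rw [mem_S2_iff] at hx
    have h1 : √(1 - (x 0 ^ 2 + x 1 ^ 2)) = s * x 2 := by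
      rw [Real.sqrt_eq_iff_mul_self_eq (by nlinarith [sq_nonneg (x 2)]) hx2.le]
      nlinarith
    refine ⟨(x 0, x 1), ⟨?_, ?_⟩, ?_⟩
    · have : 0 < (s * x 2) ^ 2 := by positivity
      rw [mul_pow, hs] at this
      simp only
      linarith
    · simp only [h1]; exact hx3
    · simp only [h1]
      ext i
      fin_cases i
      · rfl
      · rfl
      · simp only [Fin.reduceFinMk, ← mul_assoc, ← sq, hs, one_mul]
        rfl
  · rintro ⟨p, ⟨hp1, hp2⟩, rfl⟩
    have h1 : 0 < √(1 - (p.1 ^ 2 + p.2 ^ 2)) := Real.sqrt_pos.2 (by linarith)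
    have h2 : s * (s * √(1 - (p.1 ^ 2 + p.2 ^ 2))) = √(1 - (p.1 ^ 2 + p.2 ^ 2)) := by
      rw [← mul_assoc, ← sq, hs, one_mul]
    refine ⟨?_, ?_, ?_⟩
    · rw [mem_S2_iff]
      simp only [Matrix.cons_val_zero, Matrix.cons_val_one, Matrix.cons_val]
      rw [mul_pow, hs, one_mul, Real.sq_sqrt (by linarith)]
      ring
    · simpa [h2] using h1
    · simpa [h2] using hp2

end Regions

/-! ### The circles of `circlesM` and `circlesN` and their neighbourhoods -/

section Labels

/-- The sign encoded by a Boolean. -/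
def boolSign (b : Bool) : ℝ := if b then 1 else -1

theorem boolSign_not (b : Bool) : boolSign (!b) = -boolSign b := by cases b <;> simp [boolSign]

theorem boolSign_sq (b : Bool) : boolSign b ^ 2 = 1 := by cases b <;> simp [boolSign]

theorem boolSign_mul_le (b : Bool) (t : ℝ) : boolSign b * t ≤ |t| := by
  cases b
  · simpa [boolSign] using neg_le_abs t
  · simpa [boolSign] using le_abs_self t

theorem exists_boolSign_mul_eq (t : ℝ) : ∃ b, boolSign b * t = |t| := by
  rcases le_total 0 t with h | h
  · exact ⟨true, by simp [boolSign, abs_of_nonneg h]⟩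
  · exact ⟨false, by simp [boolSign, abs_of_nonpos h]⟩

/-- The corner of the cube with the given signs. -/
noncomputable def corner (a b c : Bool) : E3 := !₂[boolSign a, boolSign b, boolSign c]

theorem inner_corner (a b c : Bool) (x : E3) :
    inner ℝ (corner a b c) x = boolSign a * x 0 + boolSign b * x 1 + boolSign c * x 2 :=
  inner_vec _ _ _ _

/-- The circles of `circlesM`. -/
noncomputable def circleM : Option (Bool × Bool × Bool) → Set E3
  | none => circleOn !₂[0, 0, 1] 0
  | some (a, b, c) => circleOn (corner a b c) (3 / 2)

/-- The latitudes of the circles of `circlesN`. -/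
noncomputable def latitude : Fin 3 → ℝ := ![4 / 5, 5 / 6, 6 / 7]

/-- The circles of `circlesN`. -/
noncomputable def circleN (k : Fin 3 × Fin 3) : Set E3 :=
  circleOn (EuclideanSpace.single k.1 1) (latitude k.2)

theorem mem_circleM_none {x : E3} : x ∈ circleM none ↔ x ∈ S2 ∧ x 2 = 0 := by
  rw [circleM, circleOn, mem_ofPred_eq, inner_vec]
  simp

theorem mem_circleM_some {x : E3} {a b c : Bool} : x ∈ circleM (some (a, b, c)) ↔
    x ∈ S2 ∧ inner ℝ (corner a b c) x = 3 / 2 := Iff.rfl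

theorem mem_circleN {x : E3} {i j : Fin 3} :
    x ∈ circleN (i, j) ↔ x ∈ S2 ∧ x i = latitude j := by
  rw [circleN, circleOn, mem_ofPred_eq, inner_single]

theorem circleM_subset_S2 (l : Option (Bool × Bool × Bool)) : circleM l ⊆ S2 := by
  rcases l with _ | ⟨a, b, c⟩ <;> exact fun x hx => hx.1

theorem circleN_subset_S2 (k : Fin 3 × Fin 3) : circleN k ⊆ S2 := fun _ hx => hx.1

theorem iUnion_circleM : ⋃ l, circleM l = circlesM := by
  ext x
  simp only [iUnion_option, circlesM, mem_union, mem_iUnion, mem_insert_iff, mem_singleton_iff,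
    exists_prop, exists_eq_or_imp, exists_eq_left, Prod.exists, Bool.exists_bool, circleM, corner,
    boolSign, if_true, Bool.false_eq_true, if_false]
  tauto

theorem iUnion_circleN : ⋃ k, circleN k = circlesN := by
  ext x
  simp only [circlesN, mem_iUnion, mem_insert_iff, mem_singleton_iff,
    exists_prop, exists_eq_or_imp, exists_eq_left, Prod.exists, circleN, Fin.exists_fin_succ,
    latitude]
  simp

theorem latitude_mem (j : Fin 3) : 4 / 5 ≤ latitude j ∧ latitude j < 1 := by
  fin_cases j <;> simp [latitude] <;> norm_num

theorem latitude_strictMono : StrictMono latitude := by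
  intro i j h
  fin_cases i <;> fin_cases j <;> simp [latitude] at h ⊢ <;> norm_num

/-- Twice the square of `4 / 5` exceeds one, so the three nests are disjoint. -/
theorem coord_lt_of_coord_ge {x : E3} (hx : x ∈ S2) {i i' : Fin 3} (h : i ≠ i')
    (hxi : 4 / 5 ≤ x i) : x i' < 4 / 5 := by
  have := sq_add_sq_le_one hx h
  nlinarith

theorem circleN_inj {x : E3} {k k' : Fin 3 × Fin 3} (h : x ∈ circleN k) (h' : x ∈ circleN k') :
    k = k' := by
  obtain ⟨i, j⟩ := k
  obtain ⟨i', j'⟩ := k'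
  rw [mem_circleN] at h h'
  have hi : i = i' := by
    by_contra hne
    have h1 := coord_lt_of_coord_ge h.1 hne (h.2 ▸ (latitude_mem j).1)
    rw [h'.2] at h1
    exact absurd (latitude_mem j').1 (not_le.2 h1)
  subst hi
  rw [latitude_strictMono.injective (h.2.symm.trans h'.2)]

/-- The closed caps around different corners are disjoint. -/
theorem corner_inj {x : E3} (hx : x ∈ S2) {a b c a' b' c' : Bool}
    (h : 3 / 2 ≤ inner ℝ (corner a b c) x) (h' : 3 / 2 ≤ inner ℝ (corner a' b' c') x) :
    (a, b, c) = (a', b', c') := by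
  rw [inner_corner] at h h'
  have h01 := abs_add_abs_lt_of_sq (sq_add_sq_le_one hx (i := 0) (j := 1) (by decide))
  have h02 := abs_add_abs_lt_of_sq (sq_add_sq_le_one hx (i := 0) (j := 2) (by decide))
  have h12 := abs_add_abs_lt_of_sq (sq_add_sq_le_one hx (i := 1) (j := 2) (by decide))
  have e0 := boolSign_mul_le a (x 0)
  have e1 := boolSign_mul_le b (x 1)
  have e2 := boolSign_mul_le c (x 2)
  have e0' := boolSign_mul_le a' (x 0)
  have e1' := boolSign_mul_le b' (x 1)
  have e2' := boolSign_mul_le c' (x 2)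
  have ha : a = a' := by
    by_contra hne
    rw [show a' = !a by cases a <;> cases a' <;> simp_all, boolSign_not] at h'
    linarith
  have hb : b = b' := by
    by_contra hne
    rw [show b' = !b by cases b <;> cases b' <;> simp_all, boolSign_not] at h'
    linarith
  have hc : c = c' := by
    by_contra hne
    rw [show c' = !c by cases c <;> cases c' <;> simp_all, boolSign_not] at h'
    linarith
  rw [ha, hb, hc]

theorem pos_of_corner_le {x : E3} (hx : x ∈ S2) {a b c : Bool}
    (h : 3 / 2 ≤ inner ℝ (corner a b c) x) : 0 < boolSign c * x 2 := by
  rw [inner_corner] at h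
  have h01 := abs_add_abs_lt_of_sq (sq_add_sq_le_one hx (i := 0) (j := 1) (by decide))
  have e0 := boolSign_mul_le a (x 0)
  have e1 := boolSign_mul_le b (x 1)
  linarith

theorem circleM_inj {x : E3} {l l' : Option (Bool × Bool × Bool)} (h : x ∈ circleM l)
    (h' : x ∈ circleM l') : l = l' := by
  rcases l with _ | ⟨a, b, c⟩ <;> rcases l' with _ | ⟨a', b', c'⟩
  · rfl
  · rw [mem_circleM_none] at h
    rw [mem_circleM_some] at h'
    have := pos_of_corner_le h'.1 h'.2.ge
    rw [h.2, mul_zero] at this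
    exact absurd this (lt_irrefl _)
  · rw [mem_circleM_none] at h'
    rw [mem_circleM_some] at h
    have := pos_of_corner_le h.1 h.2.ge
    rw [h'.2, mul_zero] at this
    exact absurd this (lt_irrefl _)
  · rw [mem_circleM_some] at h h'
    rw [corner_inj h.1 h.2.ge h'.2.ge]

theorem norm_corner_sq (a b c : Bool) : ‖corner a b c‖ ^ 2 = 3 := by
  rw [← real_inner_self_eq_norm_sq, inner_corner]
  simp only [corner, Matrix.cons_val_zero, Matrix.cons_val_one, Matrix.cons_val, ← sq,
    boolSign_sq]
  norm_num

theorem isConnected_circleM (l : Option (Bool × Bool × Bool)) : IsConnected (circleM l) := by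
  rcases l with _ | ⟨a, b, c⟩
  · refine isConnected_circleOn (fun h => ?_) (by simp)
    have := congrFun (congrArg (fun x : E3 => (x : Fin 3 → ℝ)) h) 2
    simp at this
  · refine isConnected_circleOn (fun h => ?_) (by rw [norm_corner_sq]; norm_num)
    have := norm_corner_sq a b c
    rw [h] at this
    simp at this

theorem isConnected_circleN (k : Fin 3 × Fin 3) : IsConnected (circleN k) := by
  refine isConnected_circleOn (fun h => ?_) ?_
  · have := congrFun (congrArg (fun x : E3 => (x : Fin 3 → ℝ)) h) k.1
    simp at this
  · have := latitude_mem k.2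
    simp only [PiLp.norm_single, norm_one]
    nlinarith

theorem isClosed_circleM (l : Option (Bool × Bool × Bool)) : IsClosed (circleM l) := by
  rcases l with _ | ⟨a, b, c⟩ <;> exact isClosed_circleOn _ _

theorem isClosed_circleN (k : Fin 3 × Fin 3) : IsClosed (circleN k) := isClosed_circleOn _ _

theorem mem_circlesM_iff {x : E3} : x ∈ circlesM ↔ ∃ l, x ∈ circleM l := by
  rw [← iUnion_circleM, mem_iUnion]

theorem mem_circlesN_iff {x : E3} : x ∈ circlesN ↔ ∃ k, x ∈ circleN k := by
  rw [← iUnion_circleN, mem_iUnion]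

theorem inner_corner_lt_of_mem_holedDisc {x : E3} {c c' : Bool} (hx : x ∈ holedDisc (boolSign c))
    (a b : Bool) : inner ℝ (corner a b c') x < 3 / 2 := by
  obtain ⟨hx, h1, h2⟩ := hx
  by_contra h
  rw [not_lt] at h
  have h3 := pos_of_corner_le hx h
  have hc : c' = c := by
    by_contra hne
    rw [show c' = !c by cases c <;> cases c' <;> simp_all, boolSign_not] at h3
    linarith
  subst hc
  rw [inner_corner] at h
  have e0 := boolSign_mul_le a (x 0)
  have e1 := boolSign_mul_le b (x 1)
  linarith

theorem notMem_circlesM_of_mem_holedDisc {x : E3} {c : Bool} (hx : x ∈ holedDisc (boolSign c)) :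
    x ∉ circlesM := by
  rw [mem_circlesM_iff]
  rintro ⟨_ | ⟨a, b, c'⟩, h⟩
  · have := hx.2.1
    rw [(mem_circleM_none.1 h).2, mul_zero] at this
    exact lt_irrefl _ this
  · exact (inner_corner_lt_of_mem_holedDisc hx a b).ne h.2

theorem notMem_circlesM_of_mem_openCap {x : E3} {a b c : Bool}
    (hx : x ∈ openCap (corner a b c) (3 / 2)) : x ∉ circlesM := by
  rw [mem_circlesM_iff]
  rintro ⟨_ | ⟨a', b', c'⟩, h⟩
  · have := pos_of_corner_le hx.1 hx.2.le
    rw [(mem_circleM_none.1 h).2, mul_zero] at this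
    exact lt_irrefl _ this
  · have := corner_inj hx.1 hx.2.le h.2.ge
    have h2 := h.2
    simp only [Prod.mk.injEq] at this
    obtain ⟨rfl, rfl, rfl⟩ := this
    exact hx.2.ne' h2

/-- Near the equator the complement of `circlesM` consists of two pieces. -/
theorem eventually_mem_of_mem_circleM_none {x : E3} (hx : x ∈ circleM none) (c : Bool) :
    ∀ᶠ z in 𝓝[S2] x, z ∉ circlesM →
      z ∈ holedDisc (boolSign c) ∨ z ∈ holedDisc (boolSign (!c)) := by
  rw [mem_circleM_none] at hx
  have h1 : ∀ᶠ z : E3 in 𝓝 x, |z 0| + |z 1| + |z 2| < 3 / 2 := by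
    have : Continuous fun z : E3 => |z 0| + |z 1| + |z 2| := by fun_prop
    refine this.continuousAt.eventually (gt_mem_nhds ?_)
    have := abs_add_abs_lt_of_sq (sq_add_sq_le_one hx.1 (i := 0) (j := 1) (by decide))
    simp only [hx.2, abs_zero]
    linarith
  filter_upwards [nhdsWithin_le_nhds h1, self_mem_nhdsWithin] with z hz hzS hzM
  have hz2 : z 2 ≠ 0 := fun h => hzM (mem_circlesM_iff.2 ⟨none, mem_circleM_none.2 ⟨hzS, h⟩⟩)
  have key : ∀ b, boolSign b * z 2 = |z 2| → z ∈ holedDisc (boolSign b) := fun b hb =>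
    ⟨hzS, by rw [hb]; exact abs_pos.2 hz2, by rw [hb]; exact hz⟩
  obtain ⟨b, hb⟩ := exists_boolSign_mul_eq (z 2)
  rcases Bool.eq_or_eq_not b c with rfl | rfl
  · exact Or.inl (key _ hb)
  · exact Or.inr (key _ hb)

/-- Near a small circle the complement of `circlesM` consists of two pieces. -/
theorem eventually_mem_of_mem_circleM_some {x : E3} {a b c : Bool}
    (hx : x ∈ circleM (some (a, b, c))) : ∀ᶠ z in 𝓝[S2] x, z ∉ circlesM →
      z ∈ holedDisc (boolSign c) ∨ z ∈ openCap (corner a b c) (3 / 2) := by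
  rw [mem_circleM_some] at hx
  have h1 : ∀ᶠ z : E3 in 𝓝 x, 0 < boolSign c * z 2 := by
    have : Continuous fun z : E3 => boolSign c * z 2 := by fun_prop
    exact this.continuousAt.eventually (lt_mem_nhds (pos_of_corner_le hx.1 hx.2.ge))
  have h2 : ∀ᶠ z : E3 in 𝓝 x, ∀ d : Bool × Bool, (a, b) ≠ d →
      inner ℝ (corner d.1 d.2 c) z < 3 / 2 := by
    rw [eventually_all]
    intro d
    by_cases hd : (a, b) = d
    · exact Eventually.of_forall fun z h => absurd hd h
    have : Continuous fun z : E3 => inner ℝ (corner d.1 d.2 c) z := by fun_prop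
    have h3 : inner ℝ (corner d.1 d.2 c) x < 3 / 2 := by
      by_contra h
      have := corner_inj hx.1 hx.2.ge (not_lt.1 h)
      simp only [Prod.mk.injEq] at this
      exact hd (Prod.ext this.1 this.2.1)
    exact (this.continuousAt.eventually (gt_mem_nhds h3)).mono fun z hz _ => hz
  filter_upwards [nhdsWithin_le_nhds h1, nhdsWithin_le_nhds h2, self_mem_nhdsWithin]
    with z hz1 hz2 hzS hzM
  obtain ⟨a', ha'⟩ := exists_boolSign_mul_eq (z 0)
  obtain ⟨b', hb'⟩ := exists_boolSign_mul_eq (z 1)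
  have h4 : inner ℝ (corner a' b' c) z = |z 0| + |z 1| + boolSign c * z 2 := by
    rw [inner_corner, ha', hb']
  rcases lt_trichotomy (inner ℝ (corner a' b' c) z) (3 / 2) with h | h | h
  · exact Or.inl ⟨hzS, hz1, by rwa [← h4]⟩
  · exact absurd (mem_circlesM_iff.2 ⟨some (a', b', c), hzS, h⟩) hzM
  · refine Or.inr ⟨hzS, ?_⟩
    by_cases hd : (a, b) = (a', b')
    · simp only [Prod.mk.injEq] at hd
      rw [hd.1, hd.2]
      exact h
    · exact absurd (hz2 (a', b') hd) (not_lt.2 h.le)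

theorem eventually_mem_circleN {x : E3} {k : Fin 3 × Fin 3} (hx : x ∈ circleN k) :
    ∀ᶠ z in 𝓝 x, z ∈ circlesN → z ∈ circleN k := by
  have h : ∀ᶠ z in 𝓝 x, ∀ k', k ≠ k' → z ∉ circleN k' := by
    rw [eventually_all]
    intro k'
    by_cases hk : k = k'
    · exact Eventually.of_forall fun z h => absurd hk h
    · filter_upwards [(isClosed_circleN k').isOpen_compl.mem_nhds fun h => hk (circleN_inj hx h)]
        with z hz _ using hz
  filter_upwards [h] with z hz hzN
  obtain ⟨k', hk'⟩ := mem_circlesN_iff.1 hzN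
  by_cases hk : k = k'
  · rwa [hk]
  · exact absurd hk' (hz k' hk)

/-- Every neighbourhood of a point of a circle of latitude meets both sides of the circle. -/
theorem frequently_coord {x : E3} {i j : Fin 3} (hx : x ∈ circleN (i, j)) :
    (∃ᶠ z in 𝓝[S2] x, latitude j < z i) ∧ ∃ᶠ z in 𝓝[S2] x, z i < latitude j := by
  rw [mem_circleN] at hx
  obtain ⟨hxS, hxi⟩ := hx
  obtain ⟨hj0, hj1⟩ := latitude_mem j
  set d := latitude j with hd
  have hx1 : ‖x‖ = 1 := by rwa [S2, mem_sphere_zero_iff_norm] at hxS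
  -- Move along the axis `i` and renormalise. The new coordinate exceeds `d` exactly for small `t >
  -- 0`, as `(d + t) ^ 2 - d ^ 2 * ‖g t‖ ^ 2 = (1 - d ^ 2) * (2 * d * t + t ^ 2)`.
  set g : ℝ → E3 := fun t => x + t • EuclideanSpace.single i (1 : ℝ) with hg
  have hgc : Continuous g := by fun_prop
  have hgi : ∀ t, g t i = d + t := fun t => by simp [hg, hxi]
  have hgn : ∀ t, ‖g t‖ ^ 2 = 1 + 2 * d * t + t ^ 2 := fun t => by
    simp only [hg]
    rw [norm_add_sq_real, inner_smul_right, real_inner_comm, inner_single, norm_smul, hx1, hxi]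
    simp
    ring
  have hg0 : g 0 = x := by simp [hg]
  have hpos : ∀ᶠ t in 𝓝 (0 : ℝ), 0 < ‖g t‖ := by
    refine hgc.norm.continuousAt.eventually (lt_mem_nhds ?_)
    simp only [hg0, hx1]; exact one_pos
  have ht : Tendsto (fun t => ‖g t‖⁻¹ • g t) (𝓝 0) (𝓝[S2] x) := by
    rw [tendsto_nhdsWithin_iff]
    constructor
    · have h1 : ContinuousAt (fun t => ‖g t‖⁻¹ • g t) 0 := by
        have h2 : ContinuousAt (fun t => ‖g t‖⁻¹) 0 :=
          hgc.norm.continuousAt.inv₀ (by rw [hg0, hx1]; exact one_ne_zero)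
        exact h2.smul hgc.continuousAt
      have h3 := h1.tendsto
      rwa [hg0, hx1, inv_one, one_smul] at h3
    · filter_upwards [hpos] with t ht
      rw [S2, mem_sphere_zero_iff_norm, norm_smul, norm_inv, norm_norm, inv_mul_cancel₀ ht.ne']
  have hval : ∀ t, (‖g t‖⁻¹ • g t) i = (d + t) / ‖g t‖ := fun t => by
    rw [PiLp.smul_apply, smul_eq_mul, hgi, inv_mul_eq_div]
  constructor
  · refine ht.frequently (((frequently_gt_nhds (0 : ℝ)).and_eventually hpos).mono
      fun t ⟨h0, h1⟩ => ?_)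
    rw [hval, lt_div_iff₀ h1]
    refine lt_of_pow_lt_pow_left₀ 2 (by linarith) ?_
    rw [mul_pow, hgn]
    have : 0 < (1 - d ^ 2) * (2 * d * t + t ^ 2) := by
      refine mul_pos (by nlinarith) (by positivity)
    nlinarith
  · have hlt : ∀ᶠ t in 𝓝 (0 : ℝ), -(4 / 5) < t := lt_mem_nhds (by norm_num)
    refine ht.frequently (((frequently_lt_nhds (0 : ℝ)).and_eventually (hpos.and hlt)).mono
      fun t ⟨h0, h1, h2⟩ => ?_)
    rw [hval, div_lt_iff₀ h1]
    refine lt_of_pow_lt_pow_left₀ 2 (by positivity) ?_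
    rw [mul_pow, hgn]
    have : (1 - d ^ 2) * ((2 * d + t) * t) < 0 := by
      refine mul_neg_of_pos_of_neg (by nlinarith) (mul_neg_of_pos_of_neg (by linarith) h0)
    nlinarith

end Labels

/-! ### Parametrisation by the round sphere -/

section SphereCharts

/-- The function `H` restricts to a homeomorphism of `S` onto the round sphere that maps `A` onto
`A'`; recorded through the consequences that are needed. -/
structure IsSphereChart (S A A' : Set E3) (H : E3 → E3) : Prop where
  mapsTo : ∀ y ∈ S, H y ∈ S2
  mem_iff : ∀ y ∈ S, y ∈ A ↔ H y ∈ A'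
  map_nhds : ∀ p ∈ S, map H (𝓝[S] p) = 𝓝[S2] (H p)
  surj : ∀ z ∈ S2, ∃ y ∈ S, H y = z
  isPreconnected : ∀ P ⊆ S2, IsPreconnected P → IsPreconnected (S ∩ H ⁻¹' P)
  isClosed : ∀ P, IsClosed P → IsClosed (S ∩ H ⁻¹' P)

theorem SituatedAs.exists_isSphereChart {S A A' : Set E3} (h : SituatedAs S A S2 A') :
    ∃ H, IsSphereChart S A A' H := by
  classical
  obtain ⟨h, hA⟩ := h
  have hH : ∀ y : S, (fun y => if hy : y ∈ S then (h ⟨y, hy⟩ : E3) else 0) (y : E3) = h y :=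
    fun y => dif_pos y.2
  refine ⟨fun y => if hy : y ∈ S then (h ⟨y, hy⟩ : E3) else 0, ?_⟩
  generalize (fun y => if hy : y ∈ S then (h ⟨y, hy⟩ : E3) else 0) = H at hH
  have hpre : ∀ P : Set E3, S ∩ H ⁻¹' P = Subtype.val ∘ h.symm '' (Subtype.val ⁻¹' P) := by
    intro P
    ext y
    constructor
    · rintro ⟨hy, hyP⟩
      refine ⟨h ⟨y, hy⟩, ?_, by simp⟩
      rw [mem_preimage, ← hH ⟨y, hy⟩]
      exact hyP
    · rintro ⟨z, hz, rfl⟩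
      refine ⟨(h.symm z).2, ?_⟩
      rw [mem_preimage, Function.comp_apply, hH, h.apply_symm_apply]
      exact hz
  have hcont : Continuous (Subtype.val ∘ h.symm) := continuous_subtype_val.comp h.symm.continuous
  have hcompact : CompactSpace S2 := isCompact_iff_compactSpace.1 (isCompact_sphere 0 1)
  refine ⟨fun y hy => ?_, fun y hy => ?_, fun p hp => ?_, fun z hz => ?_, fun P hP hPc => ?_,
    fun P hP => ?_⟩
  · rw [hH ⟨y, hy⟩]
    exact (h ⟨y, hy⟩).2
  · have h1 := Set.ext_iff.1 hA (h ⟨y, hy⟩)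
    rw [hH ⟨y, hy⟩]
    constructor
    · exact fun hyA => h1.1 ⟨_, ⟨_, hyA, rfl⟩, rfl⟩
    · intro hyA
      obtain ⟨_, ⟨x, hx, rfl⟩, hxy⟩ := h1.2 hyA
      rwa [h.injective (Subtype.val_injective hxy)] at hx
  · have h1 : 𝓝[S] p = map Subtype.val (𝓝 (⟨p, hp⟩ : S)) := (map_nhds_subtype_val (⟨p, hp⟩ : S)).symm
    have h2 : H ∘ Subtype.val = Subtype.val ∘ h := funext hH
    rw [h1, map_map, h2, ← map_map, h.map_nhds_eq, map_nhds_subtype_val, ← hH]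
  · exact ⟨h.symm ⟨z, hz⟩, (h.symm ⟨z, hz⟩).2, by rw [hH, h.apply_symm_apply]⟩
  · rw [hpre]
    refine IsPreconnected.image ?_ _ hcont.continuousOn
    rw [← Topology.IsInducing.subtypeVal.isPreconnected_image, Subtype.image_preimage_coe,
      inter_eq_right.2 hP]
    exact hPc
  · rw [hpre]
    exact ((hP.preimage continuous_subtype_val).isCompact.image hcont).isClosed

variable {S A A' : Set E3} {H : E3 → E3}

theorem IsSphereChart.eventually (hH : IsSphereChart S A A' H) {p : E3} (hp : p ∈ S)
    {P : E3 → Prop} (h : ∀ᶠ z in 𝓝[S2] (H p), P z) : ∀ᶠ y in 𝓝 p, y ∈ S → P (H y) := by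
  rw [← hH.map_nhds p hp, eventually_map, eventually_nhdsWithin_iff] at h
  exact h

theorem IsSphereChart.frequently (hH : IsSphereChart S A A' H) {p : E3} (hp : p ∈ S)
    {P : E3 → Prop} (h : ∃ᶠ z in 𝓝[S2] (H p), P z) : ∃ᶠ y in 𝓝 p, y ∈ S ∧ P (H y) := by
  rw [← hH.map_nhds p hp, frequently_map, frequently_nhdsWithin_iff] at h
  exact h.mono fun y hy => hy.symm

end SphereCharts

/-! ### The geometric constraint on a small circle -/

section Crossing

variable {S T A' : Set E3} {H HS HT : E3 → E3} {w wS wT : E3 → ZMod 2}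

theorem isPreconnected_S2 : IsPreconnected S2 := by
  refine isPreconnected_sphere ?_ _ _
  refine Module.one_lt_rank_of_one_lt_finrank ?_
  simp

theorem IsSphereChart.inter_preimage_S2 {A : Set E3} (hH : IsSphereChart S A A' H) :
    S ∩ H ⁻¹' S2 = S :=
  inter_eq_left.2 fun y hy => hH.mapsTo y hy

theorem IsSphereChart.notMem {A' : Set E3} (hH : IsSphereChart S (S ∩ T) A' H) {y : E3}
    (hy : y ∈ S) (h : H y ∉ A') : y ∉ T := fun hyT => h ((hH.mem_iff y hy).1 ⟨hy, hyT⟩)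

theorem IsSphereChart.exists_const (hH : IsSphereChart S (S ∩ T) A' H) (hT : IsSide T w)
    {P : Set E3} (hP : IsPreconnected P) (hPS : P ⊆ S2) (hPA : ∀ z ∈ P, z ∉ A') :
    ∃ c, ∀ y ∈ S, H y ∈ P → w y = c := by
  obtain ⟨c, hc⟩ := hT.const_of_isPreconnected (hH.isPreconnected P hPS hP)
    fun y hy => hH.notMem hy.1 (hPA _ hy.2)
  exact ⟨c, fun y hy hyP => hc y ⟨hy, hyP⟩⟩

/-- Two regions of `S \ T` that meet along a part of `S ∩ T` lie on different sides of `T`. -/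
theorem IsSphereChart.two_sides (hH : IsSphereChart S (S ∩ T) A' H) (hT : IsSide T w)
    (hST : IntersectTransversally S T) {p : E3} (hp : p ∈ S ∩ T) {P Q : Set E3}
    (hPQ : ∀ᶠ z in 𝓝[S2] (H p), z ∉ A' → z ∈ P ∨ z ∈ Q) {β γ : ZMod 2}
    (hβ : ∀ y ∈ S, H y ∈ P → w y = β) (hγ : ∀ y ∈ S, H y ∈ Q → w y = γ) :
    β ≠ γ ∧ p ∈ closure (S ∩ H ⁻¹' P) ∧
      ∀ᶠ y in 𝓝 p, y ∈ S → y ∉ T → (H y ∈ P ↔ w y = β) := by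
  obtain ⟨φ, hφ, hφST⟩ := hST p hp
  have hfreq := IsSide.frequently_mem_of_chart (k := 1) (l := 0) (by decide) hT hφ hp.1 hp.2
    (fun y hy => (hφST y hy).1) (fun y hy => (hφST y hy).2)
  have hev : ∀ᶠ y in 𝓝 p, y ∈ S → y ∉ T → H y ∈ P ∨ H y ∈ Q := by
    filter_upwards [hH.eventually hp.1 hPQ] with y hy hyS hyT
    exact hy hyS fun h => hyT ((hH.mem_iff y hyS).2 h).2
  have hne : β ≠ γ := by
    rintro rfl
    obtain ⟨y, ⟨hyS, hyT, hyw⟩, hy⟩ := ((hfreq (β + 1)).and_eventually hev).exists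
    refine ZMod.two_add_one_ne β (hyw.symm.trans ?_)
    exact (hy hyS hyT).elim (hβ y hyS) (hγ y hyS)
  refine ⟨hne, mem_closure_iff_frequently.2 (((hfreq β).and_eventually hev).mono ?_), ?_⟩
  · rintro y ⟨⟨hyS, hyT, hyw⟩, hy⟩
    exact ⟨hyS, (hy hyS hyT).resolve_right fun h => hne (hyw.symm.trans (hγ y hyS h))⟩
  · filter_upwards [hev] with y hy hyS hyT
    exact ⟨hβ y hyS, fun h => (hy hyS hyT).resolve_right fun h' => hne (h.symm.trans (hγ y hyS h'))⟩

theorem holedDisc_subset_S2 (s : ℝ) : holedDisc s ⊆ S2 := fun _ hx => hx.1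

theorem openCap_subset_S2 (u : E3) (c : ℝ) : openCap u c ⊆ S2 := fun _ hx => hx.1

theorem IsSphereChart.eventually_mem_circleN (hHT : IsSphereChart T (S ∩ T) circlesN HT)
    {x : E3} (hx : x ∈ T) {k : Fin 3 × Fin 3} (hxk : HT x ∈ circleN k) :
    ∀ᶠ y in 𝓝 x, y ∈ S → y ∈ T → HT y ∈ circleN k := by
  filter_upwards [hHT.eventually hx (nhdsWithin_le_nhds (_root_.eventually_mem_circleN hxk))]
    with y hy hyS hyT
  exact hy hyT ((hHT.mem_iff y hyT).1 ⟨hyS, hyT⟩)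

/-- The circles around the holed hemisphere that is not adjacent to a given small circle
of `S ∩ T` are on the same side of this circle in `T`. -/
theorem not_both_sides_of_circle (hS : IsSide S wS) (hT : IsSide T wT)
    (hST : IntersectTransversally S T) (hHS : IsSphereChart S (S ∩ T) circlesM HS)
    (hHT : IsSphereChart T (S ∩ T) circlesN HT) {i j : Fin 3} {a b c : Bool}
    (hC : T ∩ HT ⁻¹' circleN (i, j) = S ∩ HS ⁻¹' circleM (some (a, b, c)))
    {p q : E3} (hp : p ∈ S ∩ T) (hq : q ∈ S ∩ T)
    (hpM : ∃ l, HS p ∈ circleM l ∧ ∀ a b, l ≠ some (a, b, c))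
    (hqM : ∃ l, HS q ∈ circleM l ∧ ∀ a b, l ≠ some (a, b, c))
    (hpi : latitude j < HT p i) (hqi : HT q i < latitude j) : False := by
  obtain ⟨βD, hβD⟩ := hHS.exists_const hT (isPreconnected_openCap (corner a b c)
    (c := 3 / 2) (by norm_num)) (openCap_subset_S2 _ _) fun z => notMem_circlesM_of_mem_openCap
  have hdisc : ∀ d, ∃ β, ∀ y ∈ S, HS y ∈ holedDisc (boolSign d) → wT y = β := fun d =>
    hHS.exists_const hT (isPreconnected_holedDisc (boolSign_sq d)) (holedDisc_subset_S2 _)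
      fun z => notMem_circlesM_of_mem_holedDisc
  obtain ⟨β₁, hβ₁⟩ := hdisc c
  obtain ⟨β, hβ⟩ := hdisc (!c)
  have hCS : ∀ x, x ∈ T → HT x ∈ circleN (i, j) →
      x ∈ S ∩ T ∧ HS x ∈ circleM (some (a, b, c)) := fun x hx hxk => by
    have : x ∈ S ∩ HS ⁻¹' circleM (some (a, b, c)) := hC ▸ ⟨hx, hxk⟩
    exact ⟨⟨this.1, hx⟩, this.2⟩
  have hDside := fun x (hx : x ∈ T) (hxk : HT x ∈ circleN (i, j)) =>
    hHS.two_sides hT hST (hCS x hx hxk).1 (P := openCap (corner a b c) (3 / 2))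
      (Q := holedDisc (boolSign c)) ((eventually_mem_of_mem_circleM_some (hCS x hx hxk).2).mono
        fun z hz h => (hz h).symm) hβD hβ₁
  -- The cap is opposite to the holed disc around it, across its own circle, and this disc is
  -- opposite to the other holed disc, across the equator. Two changes of side cancel.
  have hβDv : βD = β := by
    obtain ⟨z, hz⟩ := (isConnected_circleN (i, j)).nonempty
    obtain ⟨x, hx, rfl⟩ := hHT.surj z (circleN_subset_S2 _ hz)
    obtain ⟨z', hz'⟩ := (isConnected_circleM none).nonempty
    obtain ⟨x', hx', rfl⟩ := hHS.surj z' (circleM_subset_S2 _ hz')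
    have h1 := (hDside x hx hz).1
    have h2 := (hHS.two_sides hT hST ((hHS.mem_iff x' hx').2 (mem_circlesM_iff.2 ⟨_, hz'⟩))
      (eventually_mem_of_mem_circleM_none hz' c) hβ₁ hβ).1
    rw [ZMod.two_eq_add_one h1, ZMod.two_eq_add_one h2.symm]
  subst hβDv
  -- The far holed disc is adjacent to the equator and to the small circles of the other sign, hence
  -- to every circle without the sign `c`.
  have hclos : ∀ p ∈ S ∩ T, (∃ l, HS p ∈ circleM l ∧ ∀ a b, l ≠ some (a, b, c)) →
      p ∈ closure (S ∩ HS ⁻¹' holedDisc (boolSign (!c))) := by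
    rintro p hp ⟨_ | ⟨a', b', c'⟩, hl, hne⟩
    · exact (hHS.two_sides hT hST hp
        ((eventually_mem_of_mem_circleM_none hl c).mono fun z hz h => (hz h).symm) hβ hβ₁).2.1
    · have : c' = !c := by
        by_contra h
        exact hne a' b' (by rw [show c' = c by cases c <;> cases c' <;> simp_all])
      subst this
      obtain ⟨γ, hγ⟩ := hHS.exists_const hT (isPreconnected_openCap (corner a' b' (!c))
        (c := 3 / 2) (by norm_num)) (openCap_subset_S2 _ _)
        fun z => notMem_circlesM_of_mem_openCap
      exact (hHS.two_sides hT hST hp (eventually_mem_of_mem_circleM_some hl) hβ hγ).2.1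
  have hcoord : Continuous fun z : E3 => z i := by fun_prop
  have hinner : Continuous fun z : E3 => inner ℝ (corner a b c) z := by fun_prop
  have hDC : S ∩ HS ⁻¹' openCap (corner a b c) (3 / 2) ∪ T ∩ HT ⁻¹' circleN (i, j) =
      S ∩ HS ⁻¹' {z | 3 / 2 ≤ inner ℝ (corner a b c) z} := by
    rw [hC, ← inter_union_distrib_left]
    ext y
    refine and_congr_right fun hy => ?_
    have hy2 := hHS.mapsTo y hy
    simp only [mem_union, mem_preimage, mem_circleM_some, openCap, mem_ofPred_eq, hy2, true_and,
      le_iff_lt_or_eq, eq_comm]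
  have hSD : S \ (S ∩ HS ⁻¹' openCap (corner a b c) (3 / 2)) =
      S ∩ HS ⁻¹' {z | inner ℝ (corner a b c) z ≤ 3 / 2} := by
    ext y
    refine and_congr_right fun hy => ?_
    simp only [mem_inter_iff, hy, true_and, mem_preimage, openCap, mem_ofPred_eq,
      hHS.mapsTo y hy, not_lt]
  have hT1C : T ∩ HT ⁻¹' {z | latitude j < z i} ∪ T ∩ HT ⁻¹' circleN (i, j) =
      T ∩ HT ⁻¹' {z | latitude j ≤ z i} := by
    rw [← inter_union_distrib_left]
    ext y
    refine and_congr_right fun hy => ?_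
    simp only [mem_union, mem_preimage, mem_circleN, mem_ofPred_eq, hHT.mapsTo y hy, true_and,
      le_iff_lt_or_eq, eq_comm]
  have hT2C : T ∩ HT ⁻¹' {z | z i < latitude j} ∪ T ∩ HT ⁻¹' circleN (i, j) =
      T ∩ HT ⁻¹' {z | z i ≤ latitude j} := by
    rw [← inter_union_distrib_left]
    ext y
    refine and_congr_right fun hy => ?_
    simp only [mem_union, mem_preimage, mem_circleN, mem_ofPred_eq, hHT.mapsTo y hy, true_and,
      le_iff_lt_or_eq]
  have hTne : ∀ y ∈ T, y ∉ S → HT y i ≠ latitude j := fun y hy hyS h =>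
    hyS (hCS y hy (mem_circleN.2 ⟨hHT.mapsTo y hy, h⟩)).1.1
  have hacc : ∀ x ∈ T, HT x ∈ circleN (i, j) → ∀ P : E3 → Prop, (∀ z, P z → z i ≠ latitude j) →
      (∃ᶠ z in 𝓝[S2] HT x, P z) → ∃ᶠ y in 𝓝 x, y ∈ T ∧ y ∉ S ∧ y ∈ T ∩ HT ⁻¹' {z | P z} := by
    intro x hx hxk P hP hfr
    refine ((hHT.frequently hx hfr).and_eventually (hHT.eventually_mem_circleN hx hxk)).mono ?_
    rintro y ⟨⟨hyT, hyP⟩, hy⟩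
    exact ⟨hyT, fun hyS => hP _ hyP (mem_circleN.1 (hy hyS hyT)).2, hyT, hyP⟩
  have hacc₁ := fun x hx hxk => hacc x hx hxk (fun z => latitude j < z i) (fun z hz => hz.ne')
    (frequently_coord hxk).1
  have hacc₂ := fun x hx hxk => hacc x hx hxk (fun z => z i < latitude j) (fun z hz => hz.ne)
    (frequently_coord hxk).2
  refine not_accumulate_both (S := S) (T := T) (C := T ∩ HT ⁻¹' circleN (i, j))
    (D := S ∩ HS ⁻¹' openCap (corner a b c) (3 / 2))
    (T₁ := T ∩ HT ⁻¹' {z | latitude j < z i}) (T₂ := T ∩ HT ⁻¹' {z | z i < latitude j})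
    (v := S ∩ HS ⁻¹' holedDisc (boolSign (!c))) hS hT ?_ ?_ ?_ inter_subset_left
    (fun y hy => hHS.notMem hy.1 (notMem_circlesM_of_mem_openCap hy.2)) ?_ ?_ ?_ ?_ ?_ ?_ ?_ ?_ ?_
    (fun x hx => (hacc₁ x hx.1 hx.2).mono fun y hy => ⟨hy.2.2, hy.2.1⟩)
    (hHS.isPreconnected _ (holedDisc_subset_S2 _) (isPreconnected_holedDisc (boolSign_sq _)))
    (fun y hy => hHS.notMem hy.1 (notMem_circlesM_of_mem_holedDisc hy.2)) ?_
    (fun y hy => hβ y hy.1 hy.2) ⟨hp.2, hpi⟩ (hclos p hp hpM) ⟨hq.2, hqi⟩ (hclos q hq hqM)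
  · rw [← hHS.inter_preimage_S2]
    exact hHS.isClosed _ Metric.isClosed_sphere
  · rw [← hHT.inter_preimage_S2]
    exact hHT.isClosed _ Metric.isClosed_sphere
  · rw [← hHT.inter_preimage_S2]
    exact hHT.isPreconnected _ subset_rfl isPreconnected_S2
  · rw [union_assoc, hT2C, ← inter_union_distrib_left]
    exact inter_eq_left.2 fun y _ => lt_or_ge (latitude j) (HT y i)
  · exact Set.disjoint_left.2 fun y h1 h2 => lt_asymm (α := ℝ) h1.2 h2.2
  · exact Set.disjoint_left.2 fun y h1 h2 => h1.2.ne' (mem_circleN.1 h2.2).2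
  · exact Set.disjoint_left.2 fun y h1 h2 => h1.2.ne (mem_circleN.1 h2.2).2
  · rw [hDC]
    exact hHS.isClosed _ (isClosed_le continuous_const hinner)
  · rw [hT1C]
    exact hHT.isClosed _ (isClosed_le continuous_const hcoord)
  · rw [hT2C]
    exact hHT.isClosed _ (isClosed_le hcoord continuous_const)
  · rw [hSD]
    exact hHS.isClosed _ (isClosed_le hinner continuous_const)
  · rintro x ⟨hx, hxk⟩
    obtain ⟨φ, hφ, hφST⟩ := hST x (hCS x hx hxk).1
    obtain ⟨α, hα⟩ := hS.exists_mem_iff_of_chart (k := 1) (l := 0) hφ (hCS x hx hxk).1.1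
      (fun y hy => (hφST y hy).1) (fun y hy => (hφST y hy).2)
      (T₁ := T ∩ HT ⁻¹' {z | latitude j < z i}) (T₂ := T ∩ HT ⁻¹' {z | z i < latitude j})
      (Eventually.of_forall fun y hyT hyS =>
        ((hTne y hyT hyS).lt_or_gt.imp (fun h => ⟨hyT, h⟩) fun h => ⟨hyT, h⟩).symm)
      (fun y h1 h2 => lt_asymm (α := ℝ) h1.2 h2.2)
      (fun y hy => by
        filter_upwards [self_mem_nhdsWithin, nhdsWithin_le_nhds (hHT.eventually hy.1
          (nhdsWithin_le_nhds (hcoord.continuousAt.eventually (lt_mem_nhds hy.2))))]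
          with y' hy' h using ⟨hy', h hy'⟩)
      (fun y hy => by
        filter_upwards [self_mem_nhdsWithin, nhdsWithin_le_nhds (hHT.eventually hy.1
          (nhdsWithin_le_nhds (hcoord.continuousAt.eventually (gt_mem_nhds hy.2))))]
          with y' hy' h using ⟨hy', h hy'⟩)
      (hacc₁ x hx hxk) (hacc₂ x hx hxk)
    refine ⟨α, ?_⟩
    filter_upwards [hα, hHT.eventually_mem_circleN hx hxk, (hDside x hx hxk).2.2] with y h1 h2 h3
    exact ⟨fun hyS hyT => ⟨hyT, h2 hyS hyT⟩, h1, fun hyS hyT =>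
      ⟨fun h => (h3 hyS hyT).1 h.2, fun h => ⟨hyS, (h3 hyS hyT).2 h⟩⟩⟩
  · exact fun y hy h => (inner_corner_lt_of_mem_holedDisc hy.2 a b).not_gt h.2.2

end Crossing

/-! ### Matching the circles in the two spheres -/

section Families

variable {X ι κ : Type*} [TopologicalSpace X] {A : ι → Set X} {B : κ → Set X}

/-- A preconnected subset of a finite union of disjoint closed sets lies in one of them. -/
theorem IsPreconnected.exists_subset_of_iUnion [Finite ι] {C : Set X} (hC : IsPreconnected C)
    (hne : C.Nonempty) (hA : ∀ i, IsClosed (A i)) (hdis : ∀ i j x, x ∈ A i → x ∈ A j → i = j)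
    (hCA : C ⊆ ⋃ i, A i) : ∃ i, C ⊆ A i := by
  obtain ⟨x, hx⟩ := hne
  obtain ⟨i, hi⟩ := mem_iUnion.1 (hCA hx)
  refine ⟨i, fun y hy => ?_⟩
  by_contra hyi
  have hcov : ∀ z ∈ C, z ∉ A i → z ∈ ⋃ k : {k // k ≠ i}, A k := fun z hz hzi => by
    obtain ⟨k, hk⟩ := mem_iUnion.1 (hCA hz)
    exact mem_iUnion.2 ⟨⟨k, by rintro rfl; exact hzi hk⟩, hk⟩
  obtain ⟨z, -, hzi, hz⟩ := isPreconnected_closed_iff.1 hC (A i) (⋃ k : {k // k ≠ i}, A k) (hA i)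
    (isClosed_iUnion_of_finite fun k => hA k)
    (fun z hz => or_iff_not_imp_left.2 fun h => hcov z hz h) ⟨x, hx, hi⟩ ⟨y, hy, hcov y hy hyi⟩
  obtain ⟨k, hk⟩ := mem_iUnion.1 hz
  exact k.2 (hdis _ _ z hk hzi)

/-- Two finite families of disjoint closed connected sets with the same union agree up to the
indexing. -/
theorem exists_equiv_of_iUnion_eq [Finite ι] [Finite κ] (hA : ∀ i, IsClosed (A i))
    (hB : ∀ k, IsClosed (B k)) (hAdis : ∀ i j x, x ∈ A i → x ∈ A j → i = j)
    (hBdis : ∀ i j x, x ∈ B i → x ∈ B j → i = j) (hAc : ∀ i, IsConnected (A i))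
    (hBc : ∀ k, IsConnected (B k)) (h : ⋃ i, A i = ⋃ k, B k) :
    ∃ σ : κ ≃ ι, ∀ k, B k = A (σ k) := by
  choose σ hσ using fun k => (hBc k).isPreconnected.exists_subset_of_iUnion (hBc k).nonempty hA
    hAdis (h ▸ subset_iUnion B k)
  choose τ hτ using fun i => (hAc i).isPreconnected.exists_subset_of_iUnion (hAc i).nonempty hB
    hBdis (h ▸ subset_iUnion A i)
  have h1 : ∀ k, τ (σ k) = k := fun k => by
    obtain ⟨x, hx⟩ := (hBc k).nonempty
    exact hBdis _ _ x (hτ _ (hσ _ hx)) hx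
  have h2 : ∀ i, σ (τ i) = i := fun i => by
    obtain ⟨x, hx⟩ := (hAc i).nonempty
    exact hAdis _ _ x (hσ _ (hτ _ hx)) hx
  refine ⟨⟨σ, τ, h1, h2⟩, fun k => (hσ k).antisymm ?_⟩
  have := hτ (σ k)
  rwa [h1] at this

theorem IsSphereChart.isConnected {S A A' P : Set E3} {H : E3 → E3} (hH : IsSphereChart S A A' H)
    (hP : IsConnected P) (hPS : P ⊆ S2) : IsConnected (S ∩ H ⁻¹' P) := by
  refine ⟨?_, hH.isPreconnected P hPS hP.isPreconnected⟩
  obtain ⟨z, hz⟩ := hP.nonempty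
  obtain ⟨y, hy, rfl⟩ := hH.surj z (hPS hz)
  exact ⟨y, hy, hz⟩

theorem IsSphereChart.inter_preimage {S A A' : Set E3} {H : E3 → E3}
    (hH : IsSphereChart S A A' H) (hA : A ⊆ S) : S ∩ H ⁻¹' A' = A := by
  ext y
  exact ⟨fun h => (hH.mem_iff y h.1).2 h.2, fun h => ⟨hA h, (hH.mem_iff y (hA h)).1 h⟩⟩

end Families

/-! ### The combinatorial contradiction -/

section Colouring

/-- Three nests of three circles, eight of which carry one of two colours, four each, cannot be
such that for no coloured circle there are both circles inside and outside of it that do not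
have its colour. -/
theorem false_of_colouring {f : Fin 3 × Fin 3 → Option Bool} {e : Fin 3 × Fin 3}
    (he : f e = none) (hne : ∀ k, k ≠ e → ∃ c, f k = some c)
    (hcard : ∀ c (s : Finset (Fin 3 × Fin 3)), (∀ k ∈ s, f k = some c) → s.card ≤ 4)
    (hf : ∀ i j c j₁ i₂ j₂, f (i, j) = some c → j < j₁ → f (i, j₁) ≠ some c →
      (i₂ ≠ i ∨ j₂ < j) → f (i₂, j₂) ≠ some c → False) : False := by
  obtain ⟨i₀, j₀⟩ := e
  -- The outermost circle of such a nest has the uncoloured circle outside, so everything inside it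
  -- shares its colour.
  have hrow : ∀ i, i ≠ i₀ → ∃ c, ∀ j, f (i, j) = some c := by
    intro i hi
    obtain ⟨c, hc⟩ := hne (i, 0) fun h => hi (congrArg Prod.fst h)
    refine ⟨c, fun j => ?_⟩
    rcases (Fin.zero_le j).eq_or_lt with rfl | hj
    · exact hc
    by_contra h
    exact hf i 0 c j i₀ j₀ hc hj h (Or.inl hi.symm) (by simp [he])
  obtain ⟨i₁, i₂, h₁, h₂, h⟩ : ∃ i₁ i₂ : Fin 3, i₁ ≠ i₀ ∧ i₂ ≠ i₀ ∧ ∀ i, i ≠ i₀ → i = i₁ ∨ i = i₂ :=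
    ⟨i₀ + 1, i₀ + 2, by clear * -; revert i₀; decide⟩
  obtain ⟨c₁, hc₁⟩ := hrow i₁ h₁
  obtain ⟨c₂, hc₂⟩ := hrow i₂ h₂
  have hcc : c₁ ≠ c₂ := by
    rintro rfl
    have h6 : (Finset.univ.filter fun k : Fin 3 × Fin 3 => k.1 ≠ i₀).card = 6 := by
      clear * -
      revert i₀; decide
    have := hcard c₁ (Finset.univ.filter fun k => k.1 ≠ i₀) (by
      rintro ⟨i, j⟩ hk
      rcases h i (by simpa using hk) with rfl | rfl
      exacts [hc₁ j, hc₂ j])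
    omega
  have hcol : ∀ c, ∃ i, i ≠ i₀ ∧ ∀ j, f (i, j) = some c := fun c => by
    by_cases hc : c = c₁
    · exact ⟨i₁, h₁, hc ▸ hc₁⟩
    · refine ⟨i₂, h₂, ?_⟩
      rwa [show c = c₂ by cases c <;> cases c₁ <;> cases c₂ <;> simp_all]
  -- Otherwise the outermost circle of the nest `i₀` has the uncoloured circle inside and a nest of
  -- the opposite colour outside.
  have hj₀ : j₀ = 0 := by
    by_contra hj
    obtain ⟨c, hc⟩ := hne (i₀, 0) fun h => hj (congrArg Prod.snd h).symm
    obtain ⟨i, hi, hic⟩ := hcol (!c)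
    exact hf i₀ 0 c j₀ i 0 hc (Fin.pos_iff_ne_zero.2 hj) (by simp [he]) (Or.inl hi) (by simp [hic])
  subst hj₀
  obtain ⟨c, hc⟩ := hne (i₀, 1) fun h => by simp at h
  -- The uncoloured circle is outside of the middle one, so the innermost one has the colour of the
  -- middle one. With the full nest of that colour this makes five circles.
  have hc' : f (i₀, 2) = some c := by
    by_contra h
    exact hf i₀ 1 c 2 i₀ 0 hc (by decide) h (Or.inr (by decide)) (by simp [he])
  obtain ⟨i, hi, hic⟩ := hcol c
  have h5 : (Finset.univ.filter fun k : Fin 3 × Fin 3 => k.1 = i ∨ k.1 = i₀ ∧ k.2 ≠ 0).card = 5 := by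
    clear * - hi
    revert i i₀; decide
  have := hcard c (Finset.univ.filter fun k => k.1 = i ∨ k.1 = i₀ ∧ k.2 ≠ 0) (by
    rintro ⟨i', j⟩ hk
    rw [Finset.mem_filter] at hk
    rcases hk.2 with hk | ⟨hk, hj⟩
    · simp only at hk
      exact hk ▸ hic j
    · simp only at hk hj
      subst hk
      fin_cases j
      exacts [absurd rfl hj, hc, hc'])
  omega

end Colouring

/-! ### Conclusion -/

theorem theorem1 :
    ¬ ∃ S T : Set E3, IsPLSphere S ∧ IsPLSphere T ∧ IntersectTransversally S T ∧
      SituatedAs S (S ∩ T) S2 circlesM ∧ SituatedAs T (S ∩ T) S2 circlesN := by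
  rintro ⟨S, T, hS, hT, hST, hSM, hTN⟩
  obtain ⟨wS, hwS⟩ := hS.exists_isSide
  obtain ⟨wT, hwT⟩ := hT.exists_isSide
  obtain ⟨HS, hHS⟩ := hSM.exists_isSphereChart
  obtain ⟨HT, hHT⟩ := hTN.exists_isSphereChart
  -- Both families are the components of `S ∩ T`, so they correspond bijectively; no further
  -- information about the two homeomorphisms' relation is used.
  obtain ⟨σ, hσ⟩ := exists_equiv_of_iUnion_eq (A := fun l => S ∩ HS ⁻¹' circleM l)
    (B := fun k => T ∩ HT ⁻¹' circleN k) (fun l => hHS.isClosed _ (isClosed_circleM l))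
    (fun k => hHT.isClosed _ (isClosed_circleN k)) (fun i j x h h' => circleM_inj h.2 h'.2)
    (fun i j x h h' => circleN_inj h.2 h'.2)
    (fun l => hHS.isConnected (isConnected_circleM l) (circleM_subset_S2 l))
    (fun k => hHT.isConnected (isConnected_circleN k) (circleN_subset_S2 k)) (by
      rw [← inter_iUnion, ← inter_iUnion, ← preimage_iUnion, ← preimage_iUnion, iUnion_circleM,
        iUnion_circleN, hHS.inter_preimage inter_subset_left, hHT.inter_preimage inter_subset_right])
  have hpt : ∀ k, ∃ p ∈ S ∩ T, HT p ∈ circleN k ∧ HS p ∈ circleM (σ k) := fun k => by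
    obtain ⟨p, hp⟩ := (hHT.isConnected (isConnected_circleN k) (circleN_subset_S2 k)).nonempty
    have hp' : p ∈ S ∩ HS ⁻¹' circleM (σ k) := hσ k ▸ hp
    exact ⟨p, ⟨hp'.1, hp.1⟩, hp.2, hp'.2⟩
  have hcol : ∀ k c, (σ k).map (fun t => t.2.2) ≠ some c → ∀ a b, σ k ≠ some (a, b, c) := by
    intro k c h a b h'
    rw [h'] at h
    exact h rfl
  -- The colour of a circle is the sign of the hemisphere of `S` containing it, and `none` marks the
  -- equator. A larger latitude means further inside the nest.
  refine false_of_colouring (f := fun k => (σ k).map fun t => t.2.2) (e := σ.symm none) (by simp)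
    (fun k hk => ?_) (fun c s hs => ?_) fun i j c j₁ i₂ j₂ hk hj h₁ hi₂ h₂ => ?_
  · rcases h : σ k with _ | t
    · exact absurd (σ.eq_symm_apply.2 h) hk
    · exact ⟨t.2.2, by simp⟩
  · calc s.card = (s.map σ.toEmbedding).card := (Finset.card_map _).symm
      _ ≤ ((Finset.univ : Finset (Bool × Bool)).image fun t => some (t.1, t.2, c)).card := by
        refine Finset.card_le_card fun l hl => ?_
        obtain ⟨k, hk, rfl⟩ := Finset.mem_map.1 hl
        obtain ⟨⟨a, b, c'⟩, h, rfl⟩ := Option.map_eq_some_iff.1 (hs k hk)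
        exact Finset.mem_image.2 ⟨(a, b), Finset.mem_univ _, h.symm⟩
      _ ≤ 4 := Finset.card_image_le
  · obtain ⟨⟨a, b, c'⟩, h, rfl⟩ := Option.map_eq_some_iff.1 hk
    obtain ⟨p, hp, hpN, hpM⟩ := hpt (i, j₁)
    obtain ⟨q, hq, hqN, hqM⟩ := hpt (i₂, j₂)
    rw [mem_circleN] at hpN hqN
    refine not_both_sides_of_circle hwS hwT hST hHS hHT (h ▸ hσ (i, j)) hp hq
      ⟨_, hpM, hcol _ _ h₁⟩ ⟨_, hqM, hcol _ _ h₂⟩ ?_ ?_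
    · rw [hpN.2]
      exact latitude_strictMono hj
    · by_cases hi : i₂ = i
      · subst hi
        rw [hqN.2]
        exact latitude_strictMono (hi₂.resolve_left fun h => h rfl)
      · exact (coord_lt_of_coord_ge hqN.1 hi (hqN.2 ▸ (latitude_mem j₂).1)).trans_le
          (latitude_mem j).1
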